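/- **Setting.** Let $Q=(Q_0,Q_1)$ be a finite quiver, with source and target maps $s,t$, a contravariant involution $\theta$ and a duality structure $(\sigma,\varsigma)$. That is, $\theta$ is a pair of involutions of $Q_0$ and $Q_1$ with $s(\theta(x))=\theta(t(x))$, $t(\theta(x))=\theta(s(x))$, and $\theta(x)=x$ whenever $t(x)=\theta(s(x))$; and $\sigma:Q_0\to\{\pm1\}$, $\varsigma:Q_1\to\{\pm1\}$ satisfy $\sigma(\theta(i))=\sigma(i)$ and $\varsigma(x)\varsigma(\theta(x))=\sigma(s(x))\sigma(t(x))$. Fix partitions $Q_0=Q_0^-\sqcup Q_0^\theta\sqcup Q_0^+$, $Q_1=Q_1^-\sqcup Q_1^\theta\sqcup Q_1^+$ into the fixed points of $\theta$ and two halves exchanged by $\theta$. Let $\mathbf a,\mathbf b\in\mathbb Z_{\ge0}^{Q_0}$ with $\mathbf b$ $\theta$-invariant and $\mathbf b(i)$ even if $i\in Q_0^\theta$, $\sigma(i)=-1$. Put $\mathbf c=\mathbf a+\theta(\mathbf a)+\mathbf b$ and $\underline{\mathbf d}=(\mathbf a,\mathbf b)$. **Polynomials and Weyl groups.** Let ${}^\theta\mathcal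 P_{\mathbf c}$ be the ring of complex polynomials in $x_k(i)$, with $1\le k\le\mathbf c(i)$ for $i\in Q_0^+$ and $1\le k\le\lfloor\mathbf c(i)/2\rfloor$ for $i\in Q_0^\theta$. The Weyl group ${}^\theta W_{\mathbf c}=\prod_{Q_0^+}\mathrm{Sym}_{\mathbf c(i)}\times\prod_{Q_0^\theta}\mathbb Z_2\wr\mathrm{Sym}_{\lfloor\mathbf c(i)/2\rfloor}$ acts by (signed) permutations of variables; it is a Coxeter group generated by the adjacent transpositions and, at $i\in Q_0^\theta$, the sign change of the last variable. Let ${}^\theta W_{\underline{\mathbf d}}=W_{\mathbf a}\times{}^\theta W_{\mathbf b}$ be its standard parabolic subgroup, with factors $\mathrm{Sym}_{\mathbf a(i)}\times\mathrm{Sym}_{\mathbf b(i)}\times\mathrm{Sym}_{\mathbf a(\theta(i))}$ for $i\in Q_0^+$ and $\mathrm{Sym}_{\mathbf a(i)}\times(\mathbb Z_2\wr\mathrm{Sym}_{\lfloor\mathbf b(i)/2\rfloor})$ for $i\in Q_0^\theta$. Let $D$ be the set of minimal length representatives of ${}^\theta W_{\mathbf c}/{}^\theta W_{\underline{\mathbf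 d}}$, and ${}^\theta\Lambda_{\underline{\mathbf d}}$, ${}^\theta\Lambda_{(\mathbf c)}$ the invariants of ${}^\theta W_{\underline{\mathbf d}}$, ${}^\theta W_{\mathbf c}$ in ${}^\theta\mathcal P_{\mathbf c}$. **Roots and Demazure operators.** The positive roots are $x_k(i)-x_l(i)$ ($k<l$) and, for $i\in Q_0^\theta$, also $x_k(i)+x_l(i)$ ($k<l$), $x_k(i)$ if $\sigma(i)=1$ and $\mathbf c(i)$ is odd, $2x_k(i)$ if $\sigma(i)=-1$. Let ${}^\theta r_{\underline{\mathbf d}}$ be the number of positive roots that are not roots of the Levi subgroup of type $\underline{\mathbf d}$. The Demazure operator of a simple reflection $s$ with simple root $\alpha$ is $f\mapsto(f-s(f))/\alpha$. If $\sigma(i)=1$ and $\mathbf c(i)$ is even, the sign change $s$ of the last variable at $i$ is not a reflection in a root, and its operator is $f\mapsto f+s(f)$. For any $w\in {}^\theta W_{\mathbf c}$ with reduced expression $w=s_{1}\cdots s_{r}$ put ${}^\theta\Delta_w={}^\theta\Delta_{s_1}\circ\cdots\circ{}^\theta\Delta_{s_r}$. **The classes.** Write $\mathsf S(i;A,B)=\prod_{k\in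 A,\,l\in B}(x_l(i)-x_k(i))$. Let ${}^\theta\mathtt S_{\underline{\mathbf d}}=\prod_{i\in Q_0^+\sqcup Q_0^\theta}{}^\theta\mathtt S_{\underline{\mathbf d}}(i)$, where for $i\in Q_0^+$ $${}^\theta\mathtt S_{\underline{\mathbf d}}(i)=\mathsf S(i;A_0,A_1)\,\mathsf S(i;A_1,A_2)\,\mathsf S(i;A_0,A_2)$$ with $A_0,A_1,A_2$ the consecutive intervals of lengths $\mathbf a(i),\mathbf b(i),\mathbf a(\theta(i))$ in $\{1,\dots,\mathbf c(i)\}$; and for $i\in Q_0^\theta$, writing $x_k=x_k(i)$, $${}^\theta\mathtt S_{\underline{\mathbf d}}(i)=g_i\prod_{1\le k<l\le\mathbf a(i)}(-x_k-x_l)\prod_{k=1}^{\mathbf a(i)}\ \prod_{l=\mathbf a(i)+1}^{\lfloor\mathbf c(i)/2\rfloor}(x_k^2-x_l^2),$$ with $g_i=\prod_{k\le\mathbf a(i)}(-x_k)$ if $\sigma(i)=1$ and $\mathbf c(i)$ is odd, $g_i=\prod_{k\le\mathbf a(i)}(-2x_k)$ if $\sigma(i)=-1$, and $g_i=1$ otherwise.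 For every $i\in Q_0$ let $y_1(i),\dots,y_{\mathbf c(i)}(i)$ be the torus weights on the standard basis of $\mathbf V_{\mathbf c}(i)$ (where $\mathbf V_{\mathbf c}$ is the standard $\mathbf c$-dimensional space with its $(\theta,\sigma)$-form, for which the $k$-th basis vector at $i$ is dual to the $(\mathbf c(i)+1-k)$-th at $\theta(i)$): $y_k(i)=x_k(i)$ if $i\in Q_0^+$; $y_k(i)=-x_{\mathbf c(i)+1-k}(\theta(i))$ if $i\in Q_0^-$; and, if $i\in Q_0^\theta$, the list $x_1(i),\dots,x_{\lfloor\mathbf c(i)/2\rfloor}(i)$, followed by $0$ if $\mathbf c(i)$ is odd, followed by $-x_{\lfloor\mathbf c(i)/2\rfloor}(i),\dots,-x_1(i)$. Let $A_0(i),A_1(i),A_2(i)$ be the consecutive intervals of lengths $\mathbf a(i),\mathbf b(i),\mathbf a(\theta(i))$ in $\{1,\dots,\mathbf c(i)\}$. Set ${}^\theta\mathtt E_{\underline{\mathbf d}}=\prod_{x\in Q_1^+\sqcup Q_1^\theta}{}^\theta\mathtt E_{\underline{\mathbf d}}(x)$, where for $x:i\to j$ in $Q_1^+$ $${}^\theta\mathtt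 E_{\underline{\mathbf d}}(x)=\prod_{0\le p<q\le2}\ \prod_{k\in A_p(i),\,l\in A_q(j)}(y_l(j)-y_k(i)),$$ and for $x:i\to j=\theta(i)$ in $Q_1^\theta$ $${}^\theta\mathtt E_{\underline{\mathbf d}}(x)=\prod_{k\preceq l\le\mathbf a(i)}(-y_k(i)-y_l(i))\prod_{m\le\mathbf a(i),\,l\in A_1(j)}(y_l(j)-y_m(i)),$$ with $\preceq$ equal to $\le$ if $\sigma(i)\varsigma(x)=1$ and to $<$ if $\sigma(i)\varsigma(x)=-1$. **The CoHA action.** Let $\mathcal H_{\mathbf a}$ be the ring of polynomials in $x_k(i)$ ($i\in Q_0$, $1\le k\le\mathbf a(i)$) symmetric at each vertex, and ${}^\theta\mathcal M_{\mathbf b}={}^\theta\Lambda_{(\mathbf b)}$, ${}^\theta\mathcal M_{\mathbf c}={}^\theta\Lambda_{(\mathbf c)}$: these are the equivariant cohomology rings of the spaces of representations of dimension $\mathbf a$ and of self-dual representations ${}^\theta\mathfrak R_{\mathbf b}$, ${}^\theta\mathfrak R_{\mathbf c}$. The action $\mathsf{act}:\mathcal H_{\mathbf a}\otimes{}^\theta\mathcal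 M_{\mathbf b}\to{}^\theta\mathcal M_{\mathbf c}$ of the cohomological Hall algebra on the cohomological Hall module is the push-forward, along the variety $F$ of isotropic $Q_0$-graded subspaces $U\subset\mathbf V_{\mathbf c}$ of dimension $\mathbf a$, of $f\cdot g$ times the normal Euler class, computed by localization at the torus-fixed points: $$\mathsf{act}(f,g)=\sum_{U\in F^{T}} f|_{U}\; g|_{U^\perp/U}\;\frac{\mathrm{eu}_T\big({}^\theta\mathfrak R_{\mathbf c}/{}^\theta\mathfrak R_{U}\big)}{\mathrm{eu}_T\big({}^\theta\mathfrak g_{\mathbf c}/{}^\theta\mathfrak p_{U}\big)}.$$ Here ${}^\theta\mathfrak R_U\subset{}^\theta\mathfrak R_{\mathbf c}$ consists of the self-dual representations that stabilize $U\subset U^\perp$, ${}^\theta\mathfrak g_{\mathbf c}$ is the Lie algebra of the isometry group of $\mathbf V_{\mathbf c}$, ${}^\theta\mathfrak p_U$ is the stabilizer of $U$, $\mathrm{eu}_T$ is the product of the torus weights, and $f|_U$, $g|_{U^\perp/U}$ are $f$, $g$ evaluated at the torus weights on $U$ and $U^\perp/U$. **Theorem.** The set $D$ has a unique longest element $w_{\underline{\mathbf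 d}}^{\mathbf c}$, and, for ${}^\theta\Delta_{\underline{\mathbf d}}^{\mathbf c}={}^\theta\Delta_{w_{\underline{\mathbf d}}^{\mathbf c}}$ computed from any reduced expression of it: (1) for every $f\in{}^\theta\Lambda_{\underline{\mathbf d}}$ one has ${}^\theta\Delta_{\underline{\mathbf d}}^{\mathbf c}(f)\in{}^\theta\Lambda_{(\mathbf c)}$ and $$\sum_{w\in D}w\big(f/{}^\theta\mathtt S_{\underline{\mathbf d}}\big)=(-1)^{{}^\theta r_{\underline{\mathbf d}}}\;{}^\theta\Delta_{\underline{\mathbf d}}^{\mathbf c}(f);$$ (2) for all $f\in\mathcal H_{\mathbf a}$ and $g\in{}^\theta\mathcal M_{\mathbf b}$, regarding $f\cdot g$ as an element of ${}^\theta\mathcal P_{\mathbf c}$ by evaluating $f$ at $y_k(i)$ ($k\le\mathbf a(i)$) and $g$ at $x_{\mathbf a(i)+k}(i)$, one has ${}^\theta\Delta_{\underline{\mathbf d}}^{\mathbf c}(f\cdot g\cdot{}^\theta\mathtt E_{\underline{\mathbf d}})\in{}^\theta\Lambda_{(\mathbf c)}$ and $$\mathsf{act}(f,g)=(-1)^{{}^\theta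 r_{\underline{\mathbf d}}}\;{}^\theta\Delta_{\underline{\mathbf d}}^{\mathbf c}\big(f\cdot g\cdot{}^\theta\mathtt E_{\underline{\mathbf d}}\big).$$ -/

import Mathlib

open MvPolynomial

noncomputable section

/-- A quiver with vertices `Q₀` and arrows `Q₁`, a contravariant involution `θ`, a duality structure
`(σ, ς)`, and chosen partitions `Q₀ = Q₀⁻ ⊔ Q₀^θ ⊔ Q₀⁺`, `Q₁ = Q₁⁻ ⊔ Q₁^θ ⊔ Q₁⁺` with
`θ(Q₀⁺) = Q₀⁻`, `θ(Q₁⁺) = Q₁⁻`; here `Q₀⁺ = {i | pos i}` and `Q₁⁺ = {x | apos x}`. -/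
structure DualQuiver (Q₀ Q₁ : Type*) where
  s : Q₁ → Q₀
  t : Q₁ → Q₀
  θ : Q₀ → Q₀
  θ₁ : Q₁ → Q₁
  θ_θ : ∀ i, θ (θ i) = i
  θ₁_θ₁ : ∀ x, θ₁ (θ₁ x) = x
  s_θ₁ : ∀ x, s (θ₁ x) = θ (t x)
  t_θ₁ : ∀ x, t (θ₁ x) = θ (s x)
  θ₁_fixed : ∀ x, t x = θ (s x) → θ₁ x = x
  σ : Q₀ → ℤˣ
  ς : Q₁ → ℤˣ
  σ_θ : ∀ i, σ (θ i) = σ i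
  ς_θ₁ : ∀ x, ς x * ς (θ₁ x) = σ (s x) * σ (t x)
  pos : Q₀ → Prop
  pos_ne : ∀ i, pos i → θ i ≠ i
  pos_iff : ∀ i, θ i ≠ i → (pos i ↔ ¬ pos (θ i))
  apos : Q₁ → Prop
  apos_ne : ∀ x, apos x → θ₁ x ≠ x
  apos_iff : ∀ x, θ₁ x ≠ x → (apos x ↔ ¬ apos (θ₁ x))

namespace DualQuiver

variable {Q₀ Q₁ : Type*} (Q : DualQuiver Q₀ Q₁)

/-- `b` is a dimension vector of a self-dual representation: it is `θ`-invariant, and even at the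
symplectic vertices. -/
def IsSelfDual (b : Q₀ → ℕ) : Prop :=
  (∀ i, b (Q.θ i) = b i) ∧ ∀ i, Q.θ i = i → Q.σ i = -1 → Even (b i)

/-- `D(a) + b = a + θ(a) + b`. -/
def total (a b : Q₀ → ℕ) : Q₀ → ℕ := fun i => a i + a (Q.θ i) + b i

/-! ### Polynomials and the Weyl group -/

open Classical in
/-- The number of variables at the vertex `i`: the rank of the factor of the group
`∏_{Q₀⁺} GL × ∏_{Q₀^θ} (O or Sp)` at `i` (no factor, hence `0`, if `i ∈ Q₀⁻`). -/
def rk (c : Q₀ → ℕ) (i : Q₀) : ℕ :=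
  if Q.pos i then c i else if Q.θ i = i then c i / 2 else 0

/-- The index set of the variables `x_k(i)`; the index `k` is counted from `0`. -/
abbrev Var (c : Q₀ → ℕ) : Type _ := Σ i : Q₀, Fin (Q.rk c i)

/-- `θP_c`, the cohomology ring of the classifying space of the maximal torus. -/
abbrev Poly (c : Q₀ → ℕ) : Type _ := MvPolynomial (Q.Var c) ℂ

/-- The fraction field of `θP_c`. -/
abbrev K (c : Q₀ → ℕ) : Type _ := FractionRing (Q.Poly c)

/-- Permutations of the symbols `± x_k(i)`; the sign is the second coordinate. -/
abbrev SPerm (c : Q₀ → ℕ) : Type _ := Equiv.Perm (Q.Var c × ℤˣ)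

/-- The Weyl group `θW_c = ∏_{Q₀⁺} Sym_{c(i)} × ∏_{Q₀^θ} ℤ₂ ≀ Sym_{⌊c(i)/2⌋}`: vertex-preserving
signed permutations of the variables, without signs at the vertices in `Q₀⁺`. -/
def weyl (c : Q₀ → ℕ) : Subgroup (Q.SPerm c) where
  carrier := {w | (∀ v e, w (v, -e) = ((w (v, e)).1, -(w (v, e)).2)) ∧
    (∀ p, (w p).1.1 = p.1.1) ∧ ∀ p, Q.pos p.1.1 → (w p).2 = p.2}
  one_mem' := ⟨fun _ _ => rfl, fun _ => rfl, fun _ _ => rfl⟩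
  mul_mem' := by
    rintro w w' ⟨h1, h2, h3⟩ ⟨h1', h2', h3'⟩
    refine ⟨fun v e => ?_, fun p => ?_, fun p hp => ?_⟩
    · rw [Equiv.Perm.mul_apply, h1', h1]; rfl
    · rw [Equiv.Perm.mul_apply, h2, h2']
    · rw [Equiv.Perm.mul_apply, h3 _ (by rwa [h2']), h3' p hp]
  inv_mem' := by
    rintro w ⟨h1, h2, h3⟩
    refine ⟨fun v e => ?_, fun p => ?_, fun p hp => ?_⟩
    · rw [Equiv.Perm.inv_eq_iff_eq, h1]; simp
    · have := h2 (w⁻¹ p); simpa using this.symm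
    · have h := h2 (w⁻¹ p)
      have := h3 (w⁻¹ p) (by rw [← h]; simpa using hp)
      simpa using this.symm

/-- The position of the `k`-th basis vector (from `0`) of `V_c(i)`, `c = D(a) + b`, in the standard
isotropic flag `0 ⊂ U ⊂ U^⊥ ⊂ V_c` of type `(a, b)`: `0` in `U`, `1` in `U^⊥/U`, `2` in
`V_c/U^⊥`. -/
def blk (a b : Q₀ → ℕ) (i : Q₀) (k : ℕ) : ℕ :=
  if k < a i then 0 else if k < a i + b i then 1 else 2

/-- The parabolic subgroup `θW_{(a,b)} = W_a × θW_b` of `θW_c`, `c = D(a) + b`. -/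
def weylLevi (a b : Q₀ → ℕ) : Subgroup (Q.SPerm (Q.total a b)) where
  carrier := {w | w ∈ Q.weyl (Q.total a b) ∧
    (∀ p, blk a b (w p).1.1 (w p).1.2 = blk a b p.1.1 p.1.2) ∧
    ∀ p, blk a b p.1.1 p.1.2 = 0 → (w p).2 = p.2}
  one_mem' := ⟨one_mem _, fun _ => rfl, fun _ _ => rfl⟩
  mul_mem' := by
    rintro w w' ⟨h1, h2, h3⟩ ⟨h1', h2', h3'⟩
    refine ⟨mul_mem h1 h1', fun p => ?_, fun p hp => ?_⟩
    · rw [Equiv.Perm.mul_apply, h2, h2']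
    · rw [Equiv.Perm.mul_apply, h3 _ (by rwa [h2']), h3' p hp]
  inv_mem' := by
    rintro w ⟨h1, h2, h3⟩
    have e : ∀ p, w (w⁻¹ p) = p := fun p => by simp
    refine ⟨inv_mem h1, fun p => ?_, fun p hp => ?_⟩
    · have h := h2 (w⁻¹ p)
      rw [e] at h
      exact h.symm
    · have h := h2 (w⁻¹ p)
      have h' := h3 (w⁻¹ p)
      rw [e] at h h'
      exact (h' (by rw [← h, hp])).symm

variable {Q} in
/-- The action of signed permutations on polynomials, `w(x_v) = ± x_u` if `w(v, 1) = (u, ±1)`. -/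
def actPoly {c : Q₀ → ℕ} (w : Q.SPerm c) : Q.Poly c →ₐ[ℂ] Q.Poly c :=
  aeval fun v => ((w (v, 1)).2 : ℤ) • X (w (v, 1)).1

/-- `θΛ_{(c)}`: the invariants of `θW_c`. -/
def IsInv (c : Q₀ → ℕ) (f : Q.Poly c) : Prop := ∀ w ∈ Q.weyl c, actPoly w f = f

/-- `θΛ_{(a,b)}`: the invariants of `θW_{(a,b)}`. -/
def IsLeviInv (a b : Q₀ → ℕ) (f : Q.Poly (Q.total a b)) : Prop :=
  ∀ w ∈ Q.weylLevi a b, actPoly w f = f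

/-- `Λ_a`: the polynomials in all `x_k(i)`, `i ∈ Q₀`, `k < a(i)`, that are symmetric at each
vertex. -/
def IsSymm (a : Q₀ → ℕ) (f : MvPolynomial (Σ i : Q₀, Fin (a i)) ℂ) : Prop :=
  ∀ π : ∀ i, Equiv.Perm (Fin (a i)), rename (Sigma.map id fun i => π i) f = f

/-- The simple reflections of `θW_c`: adjacent transpositions, and at the vertices in `Q₀^θ` the
change of sign of the last variable. -/
abbrev Gen (c : Q₀ → ℕ) : Type _ :=
  {v : Q.Var c // v.2.val + 1 < Q.rk c v.1 ∨ Q.θ v.1 = v.1}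

variable {Q} in
open Classical in
/-- The transposition of `v` and the next variable or, if `v` is the last one at its vertex, the
change of sign of `v`. -/
def refl {c : Q₀ → ℕ} (v : Q.Var c) : Q.SPerm c :=
  if h : v.2.val + 1 < Q.rk c v.1 then
    Equiv.prodCongr (Equiv.swap v ⟨v.1, ⟨v.2.val + 1, h⟩⟩) (Equiv.refl ℤˣ)
  else Equiv.swap (v, 1) (v, -1)

variable {Q} in
/-- The product of a word in the simple reflections. -/
def wordProd {c : Q₀ → ℕ} (L : List (Q.Gen c)) : Q.SPerm c :=
  (L.map fun v => refl v.1).prod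

variable {Q} in
/-- The Coxeter length. -/
def len {c : Q₀ → ℕ} (w : Q.SPerm c) : ℕ :=
  sInf {n | ∃ L : List (Q.Gen c), L.length = n ∧ wordProd L = w}

variable {Q} in
/-- `L` is a reduced expression of `w`. -/
def IsReducedWord {c : Q₀ → ℕ} (L : List (Q.Gen c)) (w : Q.SPerm c) : Prop :=
  wordProd L = w ∧ L.length = len w

/-- `θD`: the elements of minimal length in their cosets in `θW_c / θW_{(a,b)}`. -/
def minReps (a b : Q₀ → ℕ) : Set (Q.SPerm (Q.total a b)) :=
  {w | w ∈ Q.weyl (Q.total a b) ∧ ∀ u ∈ Q.weylLevi a b, len w ≤ len (w * u)}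

/-- `w` is a longest element of `θD`. -/
def IsLongestRep (a b : Q₀ → ℕ) (w : Q.SPerm (Q.total a b)) : Prop :=
  w ∈ Q.minReps a b ∧ ∀ u ∈ Q.minReps a b, len u ≤ len w

/-! ### Roots and Demazure operators -/

/-- Positive roots, as linear forms: `x_k(i) - x_l(i)` with `k < l`; at the vertices in `Q₀^θ` also
`x_k(i) + x_l(i)` with `k < l`, and `x_k(i)` in type B (`σ(i) = 1`, `c(i)` odd), `2 x_k(i)` in
type C (`σ(i) = -1`). The first kind is restricted to pairs related by `lin`, the others to
variables that satisfy `iso`. -/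
def rootSet (c : Q₀ → ℕ) (lin : Q.Var c → Q.Var c → Prop) (iso : Q.Var c → Prop) :
    Set (Q.Poly c) :=
  {α | ∃ v u : Q.Var c, v.1 = u.1 ∧ v.2.val < u.2.val ∧ lin v u ∧ α = X v - X u} ∪
  {α | ∃ v u : Q.Var c, v.1 = u.1 ∧ v.2.val < u.2.val ∧ Q.θ v.1 = v.1 ∧ iso v ∧ iso u ∧
    α = X v + X u} ∪
  {α | ∃ v : Q.Var c, Q.θ v.1 = v.1 ∧ Q.σ v.1 = 1 ∧ Odd (c v.1) ∧ iso v ∧ α = X v} ∪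
  {α | ∃ v : Q.Var c, Q.θ v.1 = v.1 ∧ Q.σ v.1 = -1 ∧ iso v ∧ α = 2 * X v}

/-- `θR_c⁺`. -/
def posRoots (c : Q₀ → ℕ) : Set (Q.Poly c) := Q.rootSet c (fun _ _ => True) fun _ => True

/-- `θR_{(a,b)}⁺`, the positive roots of the Levi subgroup of type `(a, b)`. -/
def leviRoots (a b : Q₀ → ℕ) : Set (Q.Poly (Q.total a b)) :=
  Q.rootSet (Q.total a b) (fun v u => blk a b v.1 v.2 = blk a b u.1 u.2)
    fun v => blk a b v.1 v.2 = 1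

/-- `θr_{(a,b)} = |θR_c⁺ - θR_{(a,b)}⁺|`. -/
def codimRoots (a b : Q₀ → ℕ) : ℕ := (Q.posRoots (Q.total a b) \ Q.leviRoots a b).ncard

variable {Q} in
open Classical in
/-- The simple root of the reflection `refl v`. -/
def root {c : Q₀ → ℕ} (v : Q.Var c) : Q.Poly c :=
  if h : v.2.val + 1 < Q.rk c v.1 then X v - X ⟨v.1, ⟨v.2.val + 1, h⟩⟩
  else if Q.σ v.1 = -1 then 2 * X v else X v

theorem dvd_sub_algHom {ι : Type*} (φ : MvPolynomial ι ℂ →ₐ[ℂ] MvPolynomial ι ℂ)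
    (α : MvPolynomial ι ℂ) (h : ∀ v, α ∣ X v - φ (X v)) (f : MvPolynomial ι ℂ) : α ∣ f - φ f := by
  rw [← Ideal.mem_span_singleton, ← Ideal.Quotient.mk_eq_mk_iff_sub_mem]
  have : Ideal.Quotient.mkₐ ℂ (Ideal.span {α}) =
      (Ideal.Quotient.mkₐ ℂ (Ideal.span {α})).comp φ := by
    apply MvPolynomial.algHom_ext
    intro v
    exact Ideal.Quotient.mk_eq_mk_iff_sub_mem _ _ |>.2 (Ideal.mem_span_singleton.2 (h v))
  exact DFunLike.congr_fun this f

theorem root_dvd {c : Q₀ → ℕ} (v : Q.Var c) (f : Q.Poly c) :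
    root v ∣ f - actPoly (refl v) f := by
  classical
  refine dvd_sub_algHom _ _ (fun u => ?_) f
  rw [actPoly, aeval_X]
  by_cases h : v.2.val + 1 < Q.rk c v.1
  · simp only [root, refl, h, dif_pos]
    rcases eq_or_ne u v with rfl | hu
    · simp [Prod.map]
    · rcases eq_or_ne u ⟨v.1, ⟨v.2.val + 1, h⟩⟩ with rfl | hu'
      · simp only [Equiv.prodCongr_apply, Prod.map, Equiv.swap_apply_right, Equiv.refl_apply,
          Units.val_one, one_smul]
        exact ⟨-1, by ring⟩
      · simp [Prod.map, Equiv.swap_apply_of_ne_of_ne hu hu']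
  · simp only [root, refl, h, dif_neg, not_false_eq_true]
    rcases eq_or_ne u v with rfl | hu
    · rw [Equiv.swap_apply_left]
      have e : (X u : Q.Poly c) - (((-1 : ℤˣ) : ℤ)) • X u = 2 * X u := by
        simp; ring
      simp only [e]
      split_ifs
      · exact dvd_rfl
      · exact Dvd.intro_left _ rfl
    · rw [Equiv.swap_apply_of_ne_of_ne (by simp [hu]) (by simp [hu])]
      simp

variable {Q} in
open Classical in
/-- The Demazure operator of a simple reflection `s` with simple root `α`: `f ↦ (f - s f) / α`
(an exact quotient of polynomials). The change of sign in an even orthogonal factor is not a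
reflection in a root (it lies in the component group of `O`); its Demazure operator, the sum of
`w (∏_{α ∈ R⁺} α)⁻¹` over the group `{1, s}` whose root system is empty, is `f ↦ f + s f`. -/
def demazureGen {c : Q₀ → ℕ} (v : Q.Var c) (f : Q.Poly c) : Q.Poly c :=
  if ¬ v.2.val + 1 < Q.rk c v.1 ∧ Q.σ v.1 = 1 ∧ Even (c v.1) then f + actPoly (refl v) f
  else Classical.choose (Q.root_dvd v f)

variable {Q} in
/-- The composite of the Demazure operators of the letters of a word. -/
def demazure {c : Q₀ → ℕ} (L : List (Q.Gen c)) (f : Q.Poly c) : Q.Poly c :=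
  L.foldr (fun v g => demazureGen v.1 g) f

/-! ### The classes `θS` and `θE` -/

open Classical in
/-- The variable `x_k(i)`, for `k < rk c i`. -/
def xv (c : Q₀ → ℕ) (i : Q₀) (k : ℕ) : Q.Poly c :=
  if h : k < Q.rk c i then X ⟨i, ⟨k, h⟩⟩ else 0

open Classical in
/-- The factor of `θS_{(a,b)}` at a vertex `i ∈ Q₀⁺ ⊔ Q₀^θ`, with `c = D(a) + b`. -/
def classSAt (a b : Q₀ → ℕ) (i : Q₀) : Q.Poly (Q.total a b) :=
  let c := Q.total a b
  let x := Q.xv c i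
  if Q.pos i then
    (∏ k ∈ Finset.range (a i), ∏ l ∈ Finset.Ico (a i) (a i + b i), (x l - x k)) *
    (∏ l ∈ Finset.Ico (a i) (a i + b i), ∏ m ∈ Finset.Ico (a i + b i) (c i), (x m - x l)) *
    (∏ k ∈ Finset.range (a i), ∏ m ∈ Finset.Ico (a i + b i) (c i), (x m - x k))
  else if Q.θ i = i then
    (if Q.σ i = -1 then (-2) ^ a i * ∏ k ∈ Finset.range (a i), x k
      else if Odd (c i) then (-1) ^ a i * ∏ k ∈ Finset.range (a i), x k else 1) *
    (∏ k ∈ Finset.range (a i), ∏ l ∈ Finset.Ico (k + 1) (a i), (-x k - x l)) *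
    (∏ k ∈ Finset.range (a i), ∏ l ∈ Finset.Ico (a i) (c i / 2), (x k ^ 2 - x l ^ 2))
  else 1

/-- `θS_{(a,b)}`. -/
def classS [Fintype Q₀] (a b : Q₀ → ℕ) : Q.Poly (Q.total a b) := ∏ i, Q.classSAt a b i

open Classical in
/-- The sum of `w(f / S)` over all `w ∈ θD`. -/
def shuffle [Fintype Q₀] (a b : Q₀ → ℕ) (f S : Q.Poly (Q.total a b)) : Q.K (Q.total a b) :=
  ∑ w ∈ Finset.univ.filter (· ∈ Q.minReps a b),
    algebraMap (Q.Poly (Q.total a b)) (Q.K (Q.total a b)) (actPoly w f) /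
      algebraMap (Q.Poly (Q.total a b)) (Q.K (Q.total a b)) (actPoly w S)

open Classical in
/-- The weight of the maximal torus on the `k`-th basis vector (from `0`) of `V_c(i)`, for any
`i ∈ Q₀`. The vectors number `k` in `V_c(i)` and `c(i) - 1 - k` in `V_c(θ(i))` are dual for the
bilinear form and have opposite weights. -/
def wt (c : Q₀ → ℕ) (i : Q₀) (k : ℕ) : Q.Poly c :=
  if Q.pos i then Q.xv c i k
  else if Q.θ i = i then
    if 2 * k + 1 < c i then Q.xv c i k
    else if 2 * k + 1 = c i then 0 else -Q.xv c i (c i - 1 - k)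
  else -Q.xv c (Q.θ i) (c i - 1 - k)

open Classical in
/-- The factor of `θE_{(a,b)}` at an arrow in `Q₁⁺ ⊔ Q₁^θ`, with `c = D(a) + b`. -/
def classEAt (a b : Q₀ → ℕ) (x : Q₁) : Q.Poly (Q.total a b) :=
  let c := Q.total a b
  let i := Q.s x
  let j := Q.t x
  let y := Q.wt c
  if Q.apos x then
    (∏ k ∈ Finset.range (a i), ∏ l ∈ Finset.Ico (a j) (a j + b j), (y j l - y i k)) *
    (∏ l ∈ Finset.Ico (a i) (a i + b i), ∏ m ∈ Finset.Ico (a j + b j) (c j), (y j m - y i l)) *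
    (∏ k ∈ Finset.range (a i), ∏ m ∈ Finset.Ico (a j + b j) (c j), (y j m - y i k))
  else if Q.θ₁ x = x then
    (∏ k ∈ Finset.range (a i),
      ∏ l ∈ Finset.Ico (if Q.σ i * Q.ς x = 1 then k else k + 1) (a i), (-y i k - y i l)) *
    (∏ m ∈ Finset.range (a i), ∏ l ∈ Finset.Ico (a j) (a j + b j), (y j l - y i m))
  else 1

/-- `θE_{(a,b)}`. -/
def classE [Fintype Q₁] (a b : Q₀ → ℕ) : Q.Poly (Q.total a b) := ∏ x, Q.classEAt a b x

open Classical in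
/-- The inclusion `H_a ⊗ θM_b ≅ θΛ_{(a,b)} ⊆ θP_c` on the first factor: `x_k(i)` goes to the
weight of the `k`-th basis vector of `U(i)`, `U` the standard isotropic subspace. -/
def inclA (a b : Q₀ → ℕ) :
    MvPolynomial (Σ i : Q₀, Fin (a i)) ℂ →ₐ[ℂ] Q.Poly (Q.total a b) :=
  aeval fun v => Q.wt (Q.total a b) v.1 v.2

/-- The same on the second factor: `x_k(i)` goes to `x_{a(i)+k}(i)`. -/
def inclB (a b : Q₀ → ℕ) : Q.Poly b →ₐ[ℂ] Q.Poly (Q.total a b) :=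
  aeval fun v => Q.xv (Q.total a b) v.1 (a v.1 + v.2)

/-! ### The action of the CoHA on the CoHM

For `c = D(a) + b`, the action `H_a ⊗ θM_b → θM_c` is `p_* ∘ i_*`, for the closed embedding
`i : θR_{(a,b)} → θR_c` and the fibration `p` with fibre the variety `F` of isotropic flags
`0 ⊂ U ⊂ U^⊥ ⊂ V_c` with `dim U = a`. The representation spaces are
contractible, so these groups are rings of invariant polynomials inside the cohomology `θP_c` of the
classifying space of the torus. There `i_*` is multiplication by the Euler class of the normal
bundle, and `p_*` (integration along `F`) is the Atiyah-Bott sum: `p_* ∘ i_*` is the sum, over the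
torus-fixed points `U` of `F`, of the restrictions of the classes to `U`, times the Euler class
of the normal space at `U` of `i`, over the Euler class of the tangent space of `F` at `U`. The
representation spaces, the Lie algebra and the stabilizers below are the actual ones, over the
field of functions on the Lie algebra of the torus, on which that Lie algebra has a universal
element. -/

/-- The index set of the basis of `V_c`. -/
abbrev Bas (c : Q₀ → ℕ) : Type _ := Σ i : Q₀, Fin (c i)

/-- The basis vectors `p` and `q` are dual to each other up to sign for the bilinear form. -/
def IsDual (c : Q₀ → ℕ) (p q : Bas c) : Prop :=
  q.1 = Q.θ p.1 ∧ p.2.val + q.2.val + 1 = c p.1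

open Classical in
/-- The Gram matrix of the form on `V_c`: `V_c(i)` and `V_c(j)` are orthogonal unless `j = θ(i)`,
and `⟨u, v⟩ = σ(i) ⟨v, u⟩` on `V_c(i) + V_c(θ(i))`. -/
def gram (c : Q₀ → ℕ) : Matrix (Bas c) (Bas c) (Q.K c) := fun p q =>
  if Q.IsDual c p q then
    if Q.pos p.1 ∨ Q.θ p.1 = p.1 ∧ 2 * p.2.val + 1 ≤ c p.1 then 1 else ((Q.σ p.1 : ℤ) : Q.K c)
  else 0

open Classical in
/-- The universal element of the Lie algebra of the maximal torus, acting on `V_c`. -/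
def torus (c : Q₀ → ℕ) : Matrix (Bas c) (Bas c) (Q.K c) :=
  Matrix.diagonal fun p => algebraMap (Q.Poly c) (Q.K c) (Q.wt c p.1 p.2)

theorem total_θ {a b : Q₀ → ℕ} (hb : Q.IsSelfDual b) (i : Q₀) :
    Q.total a b (Q.θ i) = Q.total a b i := by
  simp only [total, Q.θ_θ, hb.1 i]
  omega

theorem wt_add_wt (c : Q₀ → ℕ) (hc : ∀ i, c (Q.θ i) = c i) (p q : Bas c) (h : Q.IsDual c p q) :
    Q.wt c p.1 p.2 + Q.wt c q.1 q.2 = 0 := by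
  obtain ⟨i, k, hk'⟩ := p
  obtain ⟨j, l, hl'⟩ := q
  obtain ⟨h1, h2⟩ := h
  simp only at h1 h2
  subst h1
  change Q.wt c i k + Q.wt c (Q.θ i) l = 0
  clear hk' hl'
  have hl : c i - 1 - k = l := by omega
  have hk : c i - 1 - l = k := by omega
  simp only [wt]
  rw [hc i, Q.θ_θ, hl, hk]
  by_cases hf : Q.θ i = i
  · have hp : ¬ Q.pos i := fun hp => Q.pos_ne i hp hf
    rw [hf]
    simp only [hp, if_false, if_true]
    rcases lt_trichotomy (2 * k + 1) (c i) with h | h | h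
    · rw [if_pos h, if_neg (by omega), if_neg (by omega), add_neg_cancel]
    · rw [if_neg (by omega), if_pos h, if_neg (by omega), if_pos (by omega), add_zero]
    · rw [if_neg (by omega), if_neg (by omega), if_pos (by omega), neg_add_cancel]
  · by_cases hp : Q.pos i
    · have hn : ¬ Q.pos (Q.θ i) := (Q.pos_iff i hf).1 hp
      simp [hp, hn, Ne.symm hf]
    · have hn : Q.pos (Q.θ i) := by
        by_contra h; exact hp ((Q.pos_iff i hf).2 h)
      simp [hp, hn, hf]

theorem torus_transpose (c : Q₀ → ℕ) : (Q.torus c).transpose = Q.torus c := by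
  classical
  rw [torus, Matrix.diagonal_transpose]

variable [Fintype Q₀]

/-- `θR_c`: the self-dual representations `ρ`, i.e. those with
`⟨ρ_x(u), v⟩ = ς(x) ⟨u, ρ_{θ(x)}(v)⟩`. The map `ρ_x : V_c(s(x)) → V_c(t(x))` is written as an
endomorphism of `V_c` that is zero on, and onto, the other vertices. -/
def repSpace (c : Q₀ → ℕ) : Submodule (Q.K c) (Q₁ → Matrix (Bas c) (Bas c) (Q.K c)) where
  carrier := {ρ | (∀ x p q, (p.1 = Q.t x ∧ q.1 = Q.s x) ∨ ρ x p q = 0) ∧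
    ∀ x, (ρ x).transpose * Q.gram c = ((Q.ς x : ℤ) : Q.K c) • (Q.gram c * ρ (Q.θ₁ x))}
  zero_mem' := by simp
  add_mem' := by
    rintro ρ ρ' ⟨h1, h2⟩ ⟨h1', h2'⟩
    refine ⟨fun x p q => ?_, fun x => ?_⟩
    · rcases h1 x p q with h | h
      · exact Or.inl h
      · rcases h1' x p q with h' | h'
        · exact Or.inl h'
        · right; simp [h, h']
    · rw [Pi.add_apply, Pi.add_apply, Matrix.transpose_add, Matrix.add_mul, Matrix.mul_add, h2, h2',
        smul_add]
  smul_mem' := by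
    rintro r ρ ⟨h1, h2⟩
    refine ⟨fun x p q => ?_, fun x => ?_⟩
    · rcases h1 x p q with h | h
      · exact Or.inl h
      · right; simp [h]
    · rw [Pi.smul_apply, Pi.smul_apply, Matrix.transpose_smul, Matrix.smul_mul, Matrix.mul_smul, h2,
        smul_comm]

/-- The Lie algebra of `θG_c`. -/
def lieAlg (c : Q₀ → ℕ) : Submodule (Q.K c) (Matrix (Bas c) (Bas c) (Q.K c)) where
  carrier := {A | (∀ p q, p.1 = q.1 ∨ A p q = 0) ∧ A.transpose * Q.gram c + Q.gram c * A = 0}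
  zero_mem' := by simp
  add_mem' := by
    rintro A A' ⟨h1, h2⟩ ⟨h1', h2'⟩
    refine ⟨fun p q => ?_, ?_⟩
    · rcases h1 p q with h | h
      · exact Or.inl h
      · rcases h1' p q with h' | h'
        · exact Or.inl h'
        · right; simp [h, h']
    · rw [Matrix.transpose_add, Matrix.add_mul, Matrix.mul_add, add_add_add_comm, h2, h2', add_zero]
  smul_mem' := by
    rintro r A ⟨h1, h2⟩
    refine ⟨fun p q => ?_, ?_⟩
    · rcases h1 p q with h | h
      · exact Or.inl h
      · right; simp [h]
    · rw [Matrix.transpose_smul, Matrix.smul_mul, Matrix.mul_smul, ← smul_add, h2, smul_zero]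

open Classical in
/-- The torus-fixed points of the isotropic flag variety: the isotropic subspaces `U` of `V_c`,
`c = D(a) + b`, with `dim U = a` that are spanned by basis vectors, given by their sets of basis
vectors. -/
def fixedPts (a b : Q₀ → ℕ) : Finset (Finset (Bas (Q.total a b))) :=
  Finset.univ.filter fun I => (∀ i, (I.filter fun p => p.1 = i).card = a i) ∧
    ∀ p ∈ I, ∀ q ∈ I, ¬ Q.IsDual _ p q

open Classical in
/-- The position of the basis vector `q` in the flag `0 ⊂ U ⊂ U^⊥ ⊂ V_c` of the fixed point `I`:
`0` in `U`, `1` in `U^⊥/U`, `2` in `V_c/U^⊥`. -/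
def step {c : Q₀ → ℕ} (I : Finset (Bas c)) (q : Bas c) : ℕ :=
  if q ∈ I then 0 else if ∃ p ∈ I, Q.IsDual c p q then 2 else 1

/-- The endomorphisms of `V_c` that preserve the flag of `I`. -/
def flagEnd {c : Q₀ → ℕ} (I : Finset (Bas c)) :
    Submodule (Q.K c) (Matrix (Bas c) (Bas c) (Q.K c)) where
  carrier := {A | ∀ p q, Q.step I q < Q.step I p → A p q = 0}
  zero_mem' := fun _ _ _ => rfl
  add_mem' := fun h h' p q hpq => by simp [h p q hpq, h' p q hpq]
  smul_mem' := fun r A h p q hpq => by simp [h p q hpq]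

/-- The representations of `θR_c` for which the flag of `I` is stable. -/
def repStab {c : Q₀ → ℕ} (I : Finset (Bas c)) :
    Submodule (Q.K c) (Q₁ → Matrix (Bas c) (Bas c) (Q.K c)) :=
  Q.repSpace c ⊓ Submodule.pi Set.univ fun _ => Q.flagEnd I

/-- The Lie algebra of the stabilizer of the flag of `I` in `θG_c`. -/
def lieStab {c : Q₀ → ℕ} (I : Finset (Bas c)) :
    Submodule (Q.K c) (Matrix (Bas c) (Bas c) (Q.K c)) :=
  Q.lieAlg c ⊓ Q.flagEnd I

open Classical in
/-- The universal element of the Lie algebra of the torus, acting by commutator on the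
endomorphisms of `V_c`. -/
def adT (c : Q₀ → ℕ) : Module.End (Q.K c) (Matrix (Bas c) (Bas c) (Q.K c)) :=
  LinearMap.mulLeft (Q.K c) (Q.torus c) - LinearMap.mulRight (Q.K c) (Q.torus c)

/-- The same on representations. -/
def repT (c : Q₀ → ℕ) : Module.End (Q.K c) (Q₁ → Matrix (Bas c) (Bas c) (Q.K c)) :=
  LinearMap.pi fun x => Q.adT c ∘ₗ LinearMap.proj x

theorem adT_apply (c : Q₀ → ℕ) (A : Matrix (Bas c) (Bas c) (Q.K c)) :
    Q.adT c A = Q.torus c * A - A * Q.torus c := by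
  rfl

theorem adT_entry (c : Q₀ → ℕ) (A : Matrix (Bas c) (Bas c) (Q.K c)) (p q : Bas c) :
    Q.adT c A p q = (algebraMap (Q.Poly c) (Q.K c) (Q.wt c p.1 p.2) -
      algebraMap (Q.Poly c) (Q.K c) (Q.wt c q.1 q.2)) * A p q := by
  classical
  rw [adT_apply, torus, Matrix.sub_apply, Matrix.diagonal_mul, Matrix.mul_diagonal]
  ring

theorem torus_gram (c : Q₀ → ℕ) (hc : ∀ i, c (Q.θ i) = c i) :
    Q.torus c * Q.gram c = -(Q.gram c * Q.torus c) := by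
  classical
  ext p q
  rw [torus, Matrix.neg_apply, Matrix.diagonal_mul, Matrix.mul_diagonal]
  by_cases h : Q.IsDual c p q
  · have := congrArg (algebraMap (Q.Poly c) (Q.K c)) (Q.wt_add_wt c hc p q h)
    rw [map_add, map_zero] at this
    rw [eq_neg_of_add_eq_zero_left this]
    ring
  · simp [gram, h]

theorem adT_transpose_mul (c : Q₀ → ℕ) (hc : ∀ i, c (Q.θ i) = c i)
    (A B : Matrix (Bas c) (Bas c) (Q.K c)) (r : Q.K c)
    (h : A.transpose * Q.gram c = r • (Q.gram c * B)) :
    (Q.adT c A).transpose * Q.gram c = r • (Q.gram c * Q.adT c B) := by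
  have hg := Q.torus_gram c hc
  have hg' : Q.gram c * Q.torus c = -(Q.torus c * Q.gram c) := by rw [hg, neg_neg]
  rw [adT_apply, adT_apply, Matrix.transpose_sub, Matrix.transpose_mul, Matrix.transpose_mul,
    torus_transpose, Matrix.sub_mul, Matrix.mul_assoc, hg, Matrix.mul_assoc, h, Matrix.mul_neg,
    ← Matrix.mul_assoc, h, Matrix.mul_sub, ← Matrix.mul_assoc (Q.gram c) (Q.torus c), hg']
  simp only [Matrix.smul_mul, Matrix.mul_smul, Matrix.neg_mul, smul_sub, smul_neg, Matrix.mul_assoc]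
  abel

theorem repT_repSpace (c : Q₀ → ℕ) (hc : ∀ i, c (Q.θ i) = c i) :
    ∀ ρ ∈ Q.repSpace c, Q.repT c ρ ∈ Q.repSpace c := by
  rintro ρ ⟨h1, h2⟩
  refine ⟨fun x p q => ?_, fun x => Q.adT_transpose_mul c hc _ _ _ (h2 x)⟩
  rcases h1 x p q with h | h
  · exact Or.inl h
  · right
    change Q.adT c (ρ x) p q = 0
    rw [adT_entry, h, mul_zero]

theorem adT_lieAlg (c : Q₀ → ℕ) (hc : ∀ i, c (Q.θ i) = c i) :
    ∀ A ∈ Q.lieAlg c, Q.adT c A ∈ Q.lieAlg c := by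
  rintro A ⟨h1, h2⟩
  refine ⟨fun p q => ?_, ?_⟩
  · rcases h1 p q with h | h
    · exact Or.inl h
    · right
      rw [adT_entry, h, mul_zero]
  · have := Q.adT_transpose_mul c hc A A (-1) (by rw [neg_one_smul, eq_neg_of_add_eq_zero_left h2])
    rw [this, neg_one_smul, neg_add_cancel]

theorem adT_flagEnd {c : Q₀ → ℕ} (I : Finset (Bas c)) :
    ∀ A ∈ Q.flagEnd I, Q.adT c A ∈ Q.flagEnd I := by
  intro A h p q hpq
  rw [adT_entry, h p q hpq, mul_zero]

theorem repT_repStab {c : Q₀ → ℕ} (hc : ∀ i, c (Q.θ i) = c i) (I : Finset (Bas c)) :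
    ∀ ρ ∈ Q.repStab I, Q.repT c ρ ∈ Q.repStab I :=
  fun ρ h => ⟨Q.repT_repSpace c hc ρ h.1, fun x _ => Q.adT_flagEnd I _ (h.2 x trivial)⟩

theorem adT_lieStab {c : Q₀ → ℕ} (hc : ∀ i, c (Q.θ i) = c i) (I : Finset (Bas c)) :
    ∀ A ∈ Q.lieStab I, Q.adT c A ∈ Q.lieStab I :=
  fun A h => ⟨Q.adT_lieAlg c hc A h.1, Q.adT_flagEnd I A h.2⟩

/-- The Euler class of the torus representation `N / N'` (for `N' ≤ N`): the product of its weights,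
which is the determinant of the universal element `φ` of the Lie algebra of the torus on `N / N'`. -/
def eulerQuot {k M : Type*} [Field k] [AddCommGroup M] [Module k M] (φ : Module.End k M)
    (N N' : Submodule k M) (h : ∀ x ∈ N, φ x ∈ N) (h' : ∀ x ∈ N', φ x ∈ N') : k :=
  LinearMap.det (Submodule.mapQ (N'.submoduleOf N) (N'.submoduleOf N) (φ.restrict h)
    fun x hx => h' x hx)

variable {Q} in
open Classical in
/-- For `s = 0` the weights of the torus on `U(i)`, for `s = 1` those on `(U^⊥/U)(i)`, listed in the
order of the basis of `V_c(i)`. For `s = 1` and `i ∈ Q₀^θ` the second half of the list consists of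
the negatives of the first half (with a `0` in between if the length is odd). -/
def chernRoot {c : Q₀ → ℕ} (I : Finset (Bas c)) (s : ℕ) (i : Q₀) (n : ℕ) : Q.K c :=
  (((Finset.univ.filter fun k : Fin (c i) => Q.step I ⟨i, k⟩ = s).sort (· ≤ ·)).map
    fun k => algebraMap (Q.Poly c) (Q.K c) (Q.wt c i k)).getD n 0

/-- The restriction of the class `f ∈ H_a` to the fixed point `I`: `f` evaluated at the Chern roots
of `U`. -/
def restrA {a b : Q₀ → ℕ} (I : Finset (Bas (Q.total a b))) :
    MvPolynomial (Σ i : Q₀, Fin (a i)) ℂ →ₐ[ℂ] Q.K (Q.total a b) :=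
  aeval fun v => chernRoot I 0 v.1 v.2

/-- The restriction of the class `g ∈ θM_b` to the fixed point `I`: `g` evaluated at the Chern roots
of `U^⊥/U`. -/
def restrB {a b : Q₀ → ℕ} (I : Finset (Bas (Q.total a b))) :
    Q.Poly b →ₐ[ℂ] Q.K (Q.total a b) :=
  aeval fun v => chernRoot I 1 v.1 v.2

/-- The action `act : H_a ⊗ θM_b → θM_{D(a)+b}`. -/
def act {a b : Q₀ → ℕ} (hb : Q.IsSelfDual b) (f : MvPolynomial (Σ i : Q₀, Fin (a i)) ℂ)
    (g : Q.Poly b) : Q.K (Q.total a b) :=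
  ∑ I ∈ Q.fixedPts a b, Q.restrA I f * Q.restrB I g *
    eulerQuot (Q.repT (Q.total a b)) (Q.repSpace _) (Q.repStab I)
      (Q.repT_repSpace _ (Q.total_θ hb)) (Q.repT_repStab (Q.total_θ hb) I) /
    eulerQuot (Q.adT (Q.total a b)) (Q.lieAlg _) (Q.lieStab I)
      (Q.adT_lieAlg _ (Q.total_θ hb)) (Q.adT_lieStab (Q.total_θ hb) I)

end DualQuiver

end

/-! Everything takes place in the fraction field of the polynomial ring, on which the Weyl group W
acts. Let φ(α) be the inverse of a root α. Every Demazure operator has the form f ↦ φ(α) f + s(φ(α)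
f). For a reflection φ is odd, and this is (f - s f)/α. At an even orthogonal vertex the sign change
is treated as the short simple reflection of type B with φ equal to 1, and this is f + s f. So W
always comes with the same combinatorial root system, of type A at the vertices in Q₀⁺ and of type B
at the fixed ones; the symplectic, odd orthogonal and even orthogonal cases differ only in φ, which
is `rootInv`.

These operators satisfy the braid relations, even where φ is 1 on the short roots (`TypeA.tw_eq`,
`TypeB.tw_eq`), so the composite along a reduced word depends only on the element of W
(`RootAction.Tw_eq_of_reduced`). For the longest element w₀ the word can start with any letter, so
the coefficients of the composite in the twisted group algebra are all equal. A triangularity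
argument (`RootAction.Tw_leading`) computes one of them, and the result is the symmetrizer: the
operator of w₀ sends f to the sum over v in W of v(f ∏ φ(α)), with α running over the positive roots
(`RootAction.foldr_dem_longest`).

To pass to cosets of the parabolic subgroup H, write w₀ = w u with w the longest minimal
representative and u the longest element of H. Choose g such that the operator of u sends g to 1. If
f is H-invariant, then the operator of w at f is the operator of w₀ at f g, and grouping the sum
over W by cosets of H leaves the sum over minimal representatives of v(f ∏ φ(α)), with α now running
over the positive roots outside the Levi (`RootAction.IsLevi.foldr_dem_eq`). The class S is the
product of the negatives of these roots (`classS_eq`), whence the sign. Invariance of the result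
holds because a sum over cosets of an H-invariant function is W-invariant.

For the action of the CoHA, the fixed points are the isotropic coordinate subspaces. They form one
W-orbit, and the stabilizer of the standard one is H, so they are indexed by the minimal
representatives (`sum_fixedPts`). The summand at the point of w is w applied to f g E / S. For f g
this follows by listing the basis in an order adapted to the flag (`exists_flag_eq`, `restr_flag`).
For the Euler classes, self-duality ties the matrix entry (p, q) to the entry at (dual q, dual p) up
to sign; the torus acts diagonally on entries, so the determinant is a product of weights over one
entry from each such pair (`eulerQuot_eq_prod`), and these products are E and S (`prod_repIdx`,
`prod_lieIdx`). Hence the action is the shuffle sum of f g E, to which the first statement applies.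
-/

/-! ### Inversions and lengths for an abstract root action -/

/-- A group `G` acting on a finite set `Φ` of roots, with height function `h` (a root is positive if
its height is), and generators `s i` that send the simple root `α i` to its negative and permute
the other positive roots. -/
structure RootAction (G R I : Type*) [Group G] [MulAction G R] where
  Φ : Finset R
  h : R → ℤ
  neg : R → R
  s : I → G
  α : I → R
  neg_neg : ∀ z, neg (neg z) = z
  h_neg : ∀ z, h (neg z) = -h z
  neg_mem : ∀ z ∈ Φ, neg z ∈ Φ
  smul_neg : ∀ (g : G) z, g • neg z = neg (g • z)
  smul_mem : ∀ (g : G), ∀ z ∈ Φ, g • z ∈ Φ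
  h_ne : ∀ z ∈ Φ, h z ≠ 0
  s_mul_s : ∀ i, s i * s i = 1
  s_smul : ∀ i, s i • α i = neg (α i)
  α_mem : ∀ i, α i ∈ Φ
  α_pos : ∀ i, 0 < h (α i)
  s_smul_pos : ∀ i, ∀ z ∈ Φ, 0 < h z → z ≠ α i → 0 < h (s i • z)
  -- There is no addition on `R`. This field and the next one replace the fact that a positive root
  -- is a nonnegative combination of simple roots.
  exists_descent : ∀ (g : G), ∀ z ∈ Φ, 0 < h z → h (g • z) < 0 → ∃ i, h (g • α i) < 0
  exists_ascent : ∀ (g : G), ∀ z ∈ Φ, 0 < h z → 0 < h (g • z) → ∃ i, 0 < h (g • α i)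
  eq_one : ∀ g : G, (∀ z ∈ Φ, 0 < h z → 0 < h (g • z)) → g = 1

namespace RootAction

variable {G R I : Type*} [Group G] [MulAction G R] (A : RootAction G R I)

open Classical in
/-- The positive roots. -/
noncomputable def posSet : Finset R := A.Φ.filter fun z => 0 < A.h z

open Classical in
/-- The positive roots that `w` makes negative. -/
noncomputable def inversions (w : G) : Finset R := A.Φ.filter fun z => 0 < A.h z ∧ A.h (w • z) < 0

/-- The number of positive roots that `w` makes negative. -/
noncomputable def N (w : G) : ℕ := (A.inversions w).card

/-- The product of a word in the generators. -/
def word (L : List I) : G := (L.map A.s).prod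

theorem mem_inversions {w : G} {z : R} :
    z ∈ A.inversions w ↔ z ∈ A.Φ ∧ 0 < A.h z ∧ A.h (w • z) < 0 := by
  simp [inversions]

theorem mem_posSet {z : R} : z ∈ A.posSet ↔ z ∈ A.Φ ∧ 0 < A.h z := by
  simp [posSet]

@[simp] theorem word_nil : A.word [] = 1 := rfl

@[simp] theorem word_cons (i : I) (L : List I) : A.word (i :: L) = A.s i * A.word L := by
  simp [word]

@[simp] theorem word_append (L M : List I) : A.word (L ++ M) = A.word L * A.word M := by
  simp [word]

theorem s_inv (i : I) : (A.s i)⁻¹ = A.s i := inv_eq_of_mul_eq_one_left (A.s_mul_s i)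

theorem s_smul_s_smul (i : I) (z : R) : A.s i • A.s i • z = z := by
  rw [smul_smul, A.s_mul_s, one_smul]

theorem word_reverse (L : List I) : A.word L.reverse = (A.word L)⁻¹ := by
  induction L with
  | nil => simp
  | cons i L ih => simp [ih, A.s_inv]

theorem h_smul_s_smul (w : G) (i : I) : A.h (w • A.s i • A.α i) = -A.h (w • A.α i) := by
  rw [A.s_smul, A.smul_neg, A.h_neg]

theorem h_smul_ne (w : G) {z : R} (hz : z ∈ A.Φ) : A.h (w • z) ≠ 0 := A.h_ne _ (A.smul_mem w z hz)

theorem s_smul_neg_of_neg (i : I) {z : R} (hz : z ∈ A.Φ) (h : A.h z < 0) (hne : z ≠ A.neg (A.α i)) :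
    A.h (A.s i • z) < 0 := by
  have := A.s_smul_pos i (A.neg z) (A.neg_mem z hz) (by rw [A.h_neg]; omega)
    (fun e => hne (by rw [← e, A.neg_neg]))
  rw [A.smul_neg, A.h_neg] at this
  omega

/-- The generator `s i` permutes the positive roots other than `α i`. So the inversions of `w * s i`
are the translates by `s i` of those of `w`, together with the new inversion `α i`. -/
theorem N_mul_s_of_pos {w : G} {i : I} (h : 0 < A.h (w • A.α i)) :
    A.N (w * A.s i) = A.N w + 1 := by
  classical
  have hins : A.inversions (w * A.s i) =
      insert (A.α i) ((A.inversions w).image fun z => A.s i • z) := by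
    ext z
    simp only [mem_inversions, Finset.mem_insert, Finset.mem_image, mul_smul]
    constructor
    · rintro ⟨h1, h2, h3⟩
      by_cases hz : z = A.α i
      · exact Or.inl hz
      · exact Or.inr ⟨A.s i • z, ⟨A.smul_mem _ _ h1, A.s_smul_pos i z h1 h2 hz, h3⟩,
          A.s_smul_s_smul i z⟩
    · rintro (rfl | ⟨y, ⟨h1, h2, h3⟩, rfl⟩)
      · refine ⟨A.α_mem i, A.α_pos i, ?_⟩
        rw [A.h_smul_s_smul]; omega
      · refine ⟨A.smul_mem _ _ h1, A.s_smul_pos i y h1 h2 ?_, ?_⟩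
        · rintro rfl; omega
        · rwa [A.s_smul_s_smul]
  rw [N, hins, Finset.card_insert_of_notMem, Finset.card_image_of_injective _ (MulAction.injective _)]
  · rfl
  · intro hm
    obtain ⟨y, hy, e⟩ := Finset.mem_image.1 hm
    have hy' := A.mem_inversions.1 hy
    have : y = A.neg (A.α i) := by rw [← A.s_smul, ← e, A.s_smul_s_smul]
    have h2 := hy'.2.1
    rw [this, A.h_neg] at h2
    have := A.α_pos i
    omega

theorem N_mul_s_of_neg {w : G} {i : I} (h : A.h (w • A.α i) < 0) :
    A.N (w * A.s i) + 1 = A.N w := by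
  rw [← A.N_mul_s_of_pos (w := w * A.s i) (i := i), mul_assoc, A.s_mul_s, mul_one]
  rw [mul_smul, A.h_smul_s_smul]
  omega

theorem N_mul_s_le (w : G) (i : I) : A.N (w * A.s i) ≤ A.N w + 1 := by
  rcases lt_or_gt_of_ne (A.h_smul_ne w (A.α_mem i)) with h | h
  · have := A.N_mul_s_of_neg h; omega
  · exact (A.N_mul_s_of_pos h).le

theorem N_one : A.N (1 : G) = 0 := by
  rw [N, Finset.card_eq_zero, Finset.eq_empty_iff_forall_notMem]
  intro z hz
  have := A.mem_inversions.1 hz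
  rw [one_smul] at this
  omega

theorem eq_one_of_N_eq_zero {w : G} (h : A.N w = 0) : w = 1 := by
  refine A.eq_one w fun z hz hp => ?_
  have h1 := A.h_smul_ne w hz
  by_contra h2
  have : z ∈ A.inversions w := A.mem_inversions.2 ⟨hz, hp, by omega⟩
  rw [N, Finset.card_eq_zero] at h
  simp [h] at this

theorem exists_descent_of_ne_one {w : G} (h : w ≠ 1) : ∃ i, A.h (w • A.α i) < 0 := by
  by_contra! hc
  refine h (A.eq_one w fun z hz hp => ?_)
  by_contra h2
  obtain ⟨i, hi⟩ := A.exists_descent w z hz hp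
    (lt_of_le_of_ne (not_lt.1 h2) (A.h_smul_ne w hz))
  exact absurd hi (not_lt.2 (hc i))

theorem N_word_le (L : List I) : A.N (A.word L) ≤ L.length := by
  induction L using List.reverseRecOn with
  | nil => simp [N_one]
  | append_singleton L i ih =>
    have := A.N_mul_s_le (A.word L) i
    simp
    omega

/-- Strip off right descents: each lowers `N` by one, and `N` vanishes only at `1`. With `N_word_le`
this shows that `N` is the word length. -/
theorem exists_word (w : G) : ∃ L, A.word L = w ∧ L.length = A.N w := by
  induction hn : A.N w generalizing w with
  | zero => exact ⟨[], by simp [A.eq_one_of_N_eq_zero hn], rfl⟩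
  | succ n ih =>
    obtain ⟨i, hi⟩ := A.exists_descent_of_ne_one (w := w) (fun h => by
      rw [h, A.N_one] at hn; omega)
    have h1 := A.N_mul_s_of_neg hi
    obtain ⟨L, h2, h3⟩ := ih (w * A.s i) (by omega)
    refine ⟨L ++ [i], ?_, by simp [h3]⟩
    simp [h2, mul_assoc, A.s_mul_s]

/-- Reversing a shortest word of `w` gives a word of `w⁻¹`, since the generators are involutions. -/
theorem N_inv (w : G) : A.N w⁻¹ = A.N w := by
  have key : ∀ v : G, A.N v⁻¹ ≤ A.N v := fun v => by
    obtain ⟨L, h1, h2⟩ := A.exists_word v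
    have := A.N_word_le L.reverse
    rwa [A.word_reverse, h1, List.length_reverse, h2] at this
  exact le_antisymm (key w) (by simpa using key w⁻¹)

theorem N_le (w : G) : A.N w ≤ A.posSet.card := by
  refine Finset.card_le_card fun z hz => ?_
  have := A.mem_inversions.1 hz
  exact A.mem_posSet.2 ⟨this.1, this.2.1⟩

theorem N_eq_card_iff {w : G} : A.N w = A.posSet.card ↔ ∀ z ∈ A.Φ, 0 < A.h z → A.h (w • z) < 0 := by
  have hsub : A.inversions w ⊆ A.posSet := fun z hz => by
    have := A.mem_inversions.1 hz
    exact A.mem_posSet.2 ⟨this.1, this.2.1⟩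
  constructor
  · intro h z hz hp
    have := Finset.eq_of_subset_of_card_le hsub h.ge
    exact (A.mem_inversions.1 (this ▸ A.mem_posSet.2 ⟨hz, hp⟩)).2.2
  · intro h
    refine congrArg Finset.card (Finset.Subset.antisymm hsub fun z hz => ?_)
    have := A.mem_posSet.1 hz
    exact A.mem_inversions.2 ⟨this.1, this.2, h z this.1 this.2⟩

/-- `N` is bounded by the number of positive roots, so it attains a maximum. A maximizer that kept a
positive root positive would have an ascent, and multiplying by that generator would increase `N`.
-/
theorem exists_longest : ∃ w : G, ∀ z ∈ A.Φ, 0 < A.h z → A.h (w • z) < 0 := by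
  obtain ⟨n, ⟨w, hw⟩, hmax⟩ : ∃ n, (∃ w : G, A.N w = n) ∧ ∀ m, (∃ w : G, A.N w = m) → m ≤ n := by
    have hb : BddAbove {n | ∃ w : G, A.N w = n} := ⟨A.posSet.card, by
      rintro _ ⟨w, rfl⟩; exact A.N_le w⟩
    exact ⟨_, Nat.sSup_mem (s := {n | ∃ w : G, A.N w = n}) ⟨A.N (1 : G), 1, rfl⟩ hb,
      fun m hm => le_csSup hb hm⟩
  refine ⟨w, fun z hz hp => ?_⟩
  by_contra hc
  obtain ⟨i, hi⟩ := A.exists_ascent w z hz hp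
    (lt_of_le_of_ne (not_lt.1 hc) (A.h_smul_ne w hz).symm)
  have h1 := A.N_mul_s_of_pos hi
  have h2 := hmax _ ⟨w * A.s i, rfl⟩
  omega

/-! ### Demazure operators in the twisted group algebra -/

variable {k : Type*} [Field k]

/-- Left multiplication by `(1 + s i) φ(α i)` on `∑ v, v⁻¹ (q v)`. -/
def T (φ : R → k) (i : I) (q : G → k) (v : G) : k :=
  φ (v • A.α i) * q v + φ ((v * A.s i) • A.α i) * q (v * A.s i)

/-- The composite of the operators `T` along a word. -/
def Tw (φ : R → k) (L : List I) (q : G → k) : G → k := L.foldr (A.T φ) q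

@[simp] theorem Tw_nil (φ : R → k) (q : G → k) : A.Tw φ [] q = q := rfl

@[simp] theorem Tw_cons (φ : R → k) (i : I) (L : List I) (q : G → k) :
    A.Tw φ (i :: L) q = A.T φ i (A.Tw φ L q) := rfl

theorem Tw_append (φ : R → k) (L M : List I) (q : G → k) :
    A.Tw φ (L ++ M) q = A.Tw φ L (A.Tw φ M q) := by
  simp [Tw]

/-- Left multiplication by `s i` fixes anything of the form `(1 + s i) x`. As the coefficients are
attached to `v⁻¹`, this becomes invariance under right multiplication of `v`. -/
theorem T_mul_s (φ : R → k) (i : I) (q : G → k) (v : G) : A.T φ i q (v * A.s i) = A.T φ i q v := by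
  simp only [T, mul_assoc, A.s_mul_s, mul_one]
  ring

/-- Along the word, each letter is a right descent of the product of `u` with the letters before
it. -/
def Descends : G → List I → Prop
  | _, [] => True
  | u, i :: L => A.h (u • A.α i) < 0 ∧ Descends (u * A.s i) L

theorem N_mul_word_of_descends {u : G} {L : List I} (h : A.Descends u L) :
    A.N (u * A.word L) + L.length = A.N u := by
  induction L generalizing u with
  | nil => simp
  | cons i L ih =>
    have h1 := A.N_mul_s_of_neg h.1
    have h2 := ih h.2
    rw [word_cons, ← mul_assoc, List.length_cons]
    omega

/-- Any two generators satisfy a braid relation, which the operators `T` satisfy too, and whose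
sides are initial parts of reduced words of any element that has both as descents. -/
def Braided (φ : R → k) : Prop :=
  ∀ i j, i ≠ j → ∃ L M : List I, L.length = M.length ∧ A.word (i :: L) = A.word (j :: M) ∧
    (∀ q, A.Tw φ (i :: L) q = A.Tw φ (j :: M) q) ∧
    ∀ u : G, A.h (u • A.α i) < 0 → A.h (u • A.α j) < 0 → A.Descends u (i :: L)

/-- Lengths were analysed under right multiplication, so the first letter of a reduced word appears
as a right descent of the inverse. -/
theorem descent_of_reduced {i : I} {L : List I} (h : A.N (A.word (i :: L)) = L.length + 1) :
    A.h ((A.word (i :: L))⁻¹ • A.α i) < 0 ∧ A.N (A.word L) = L.length := by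
  have h1 : (A.word (i :: L))⁻¹ * A.s i = (A.word L)⁻¹ := by
    rw [word_cons, mul_inv_rev, mul_assoc, inv_mul_cancel, mul_one]
  have h2 := A.N_word_le L
  rcases lt_or_gt_of_ne (A.h_smul_ne (A.word (i :: L))⁻¹ (A.α_mem i)) with h' | h'
  · have := A.N_mul_s_of_neg h'
    rw [h1, A.N_inv, A.N_inv] at this
    exact ⟨h', by omega⟩
  · have := A.N_mul_s_of_pos h'
    rw [h1, A.N_inv, A.N_inv] at this
    omega

/-- Matsumoto's theorem: the composite of the operators along a reduced word depends only on the
product of the word. -/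
theorem Tw_eq_of_reduced {φ : R → k} (hφ : A.Braided φ) (L M : List I) (hLM : A.word L = A.word M)
    (hL : A.N (A.word L) = L.length) (hM : A.N (A.word M) = M.length) (q : G → k) :
    A.Tw φ L q = A.Tw φ M q := by
  induction hn : L.length generalizing L M with
  | zero =>
    have : M.length = 0 := by rw [← hM, ← hLM, hL, hn]
    rw [List.length_eq_zero_iff.1 hn, List.length_eq_zero_iff.1 this]
  | succ n ih =>
    have hn' : M.length = n + 1 := by rw [← hM, ← hLM, hL, hn]
    cases L with
    | nil => simp at hn
    | cons i L =>
    cases M with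
    | nil => simp at hn'
    | cons j M =>
    simp only [List.length_cons, Nat.add_right_cancel_iff] at hn hn'
    obtain ⟨h1, h2⟩ := A.descent_of_reduced hL
    obtain ⟨h3, h4⟩ := A.descent_of_reduced hM
    by_cases hij : i = j
    · subst hij
      rw [word_cons, word_cons, mul_right_inj] at hLM
      rw [Tw_cons, Tw_cons, ih L M hLM h2 h4 hn]
    · obtain ⟨L', M', e1, e2, e3, e4⟩ := hφ i j hij
      have hd := A.N_mul_word_of_descends (e4 _ h1 (hLM ▸ h3))
      set w := A.word (i :: L) with hw
      -- `S` is a shortest word of what remains of `w` after the braid word; the two lengths add up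
      -- to that of `w`.
      obtain ⟨S, hS, hS'⟩ := A.exists_word (w⁻¹ * A.word (i :: L'))⁻¹
      rw [A.N_inv] at hS'
      have hwS : w = A.word (i :: L') * A.word S := by rw [hS]; group
      have hlen : S.length + (i :: L').length = n + 1 := by
        rw [hS', hd, A.N_inv, hL, List.length_cons, hn]
      have f1 : A.word L = A.word (L' ++ S) := by
        have := hw.symm.trans hwS
        rwa [word_cons, word_cons, mul_assoc, mul_right_inj, ← word_append] at this
      have f2 : A.word M = A.word (M' ++ S) := by
        have := hLM.symm.trans hwS
        rwa [e2, word_cons, word_cons, mul_assoc, mul_right_inj, ← word_append] at this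
      have g1 := ih L (L' ++ S) f1 h2 (by
        rw [← f1, h2, List.length_append, hn]; simp at hlen; omega) hn
      have g2 := ih M (M' ++ S) f2 h4 (by
        rw [← f2, h4, List.length_append, hn']; simp at hlen; omega) hn'
      -- The chain is `i L`, `i L' S`, `j M' S`, `j M`. The outer steps are the induction hypothesis
      -- for the tails, the middle one is the braid relation.
      rw [Tw_cons, g1, ← Tw_cons, ← List.cons_append, Tw_append, e3, ← Tw_append, List.cons_append,
        Tw_cons, ← g2, ← Tw_cons]

/-- Left multiplication, unlike right multiplication, leaves the old inversions in place: the only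
root whose image changes sign is the one that `w` sends to `α i`. Products over inversions therefore
gain a single factor. -/
theorem inversions_s_mul {w : G} {i : I} (h : 0 < A.h (w⁻¹ • A.α i)) [DecidableEq R] :
    A.inversions (A.s i * w) = insert (w⁻¹ • A.α i) (A.inversions w) := by
  ext z
  simp only [mem_inversions, Finset.mem_insert, mul_smul]
  constructor
  · rintro ⟨h1, h2, h3⟩
    by_cases hz : w • z = A.α i
    · left; rw [← hz, inv_smul_smul]
    · right
      refine ⟨h1, h2, ?_⟩
      by_contra hc
      have := A.s_smul_pos i _ (A.smul_mem w z h1)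
        (lt_of_le_of_ne (not_lt.1 hc) (A.h_smul_ne w h1).symm) hz
      omega
  · rintro (rfl | ⟨h1, h2, h3⟩)
    · refine ⟨A.smul_mem _ _ (A.α_mem i), h, ?_⟩
      rw [smul_inv_smul, A.s_smul, A.h_neg]
      have := A.α_pos i
      omega
    · refine ⟨h1, h2, A.s_smul_neg_of_neg i (A.smul_mem w z h1) h3 fun e => ?_⟩
      have e' : z = A.neg (w⁻¹ • A.α i) := by
        rw [← A.smul_neg, ← e, inv_smul_smul]
      rw [e', A.h_neg] at h2
      omega

-- Triangularity. The operator of a letter mixes only the coefficients at `v` and `v * s i`, whose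
-- lengths differ by one. Among elements at least as long as the word, only the inverse of its
-- product can thus have a nonzero coefficient. Each letter multiplies this top coefficient by the
-- value of `φ` at the inversion that it creates.
open Classical in
theorem Tw_leading (φ : R → k) (L : List I) (hL : A.N (A.word L) = L.length) :
    A.Tw φ L (Pi.single 1 1) (A.word L)⁻¹ = ∏ z ∈ A.inversions (A.word L), φ z ∧
    ∀ v, L.length ≤ A.N v → v ≠ (A.word L)⁻¹ → A.Tw φ L (Pi.single 1 1) v = 0 := by
  induction L with
  | nil =>
    refine ⟨?_, fun v _ hv => ?_⟩
    · have : A.inversions (1 : G) = ∅ := Finset.card_eq_zero.1 A.N_one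
      simp [this]
    · rw [word_nil, inv_one] at hv
      simp [hv]
  | cons i L ih =>
    obtain ⟨h1, h2⟩ := A.descent_of_reduced hL
    obtain ⟨ih1, ih2⟩ := ih h2
    have e1 : (A.word (i :: L))⁻¹ * A.s i = (A.word L)⁻¹ := by
      rw [word_cons, mul_inv_rev, mul_assoc, inv_mul_cancel, mul_one]
    have e2 : (A.word (i :: L))⁻¹ = (A.word L)⁻¹ * A.s i := by
      rw [word_cons, mul_inv_rev, A.s_inv]
    refine ⟨?_, fun v hv hne => ?_⟩
    · rw [Tw_cons, T, e1, ih1, ih2 (A.word (i :: L))⁻¹, mul_zero, zero_add]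
      · have hp : 0 < A.h ((A.word L)⁻¹ • A.α i) := by
          rw [← e1, mul_smul, A.h_smul_s_smul]; omega
        rw [word_cons, A.inversions_s_mul hp, Finset.prod_insert]
        intro hm
        have := (A.mem_inversions.1 hm).2.2
        rw [smul_inv_smul] at this
        have := A.α_pos i
        omega
      · rw [A.N_inv, hL, List.length_cons]; omega
      · intro e
        have : A.s i = 1 := by simpa [e2] using e
        have h3 := A.s_smul i
        have h4 := A.α_pos i
        have h5 := A.h_neg (A.α i)
        rw [← h3, this, one_smul] at h5
        omega
    · have hv' : L.length ≤ A.N (v * A.s i) := by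
        rcases lt_or_gt_of_ne (A.h_smul_ne v (A.α_mem i)) with h' | h'
        · have := A.N_mul_s_of_neg h'
          rw [List.length_cons] at hv
          omega
        · have := A.N_mul_s_of_pos h'
          rw [List.length_cons] at hv
          omega
      rw [Tw_cons, T, ih2 v (by rw [List.length_cons] at hv; omega), ih2 _ hv', mul_zero, mul_zero,
        add_zero]
      · intro e
        refine hne ?_
        rw [e2, ← e, mul_assoc, A.s_mul_s, mul_one]
      · rintro rfl
        rw [A.N_inv, h2, List.length_cons] at hv
        omega

open Classical in
/-- The operator of the longest element is the symmetrizer. -/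
theorem Tw_longest {φ : R → k} (hφ : A.Braided φ) (L : List I)
    (hL : ∀ z ∈ A.Φ, 0 < A.h z → A.h (A.word L • z) < 0) (hL' : L.length = A.posSet.card) (v : G) :
    A.Tw φ L (Pi.single 1 1) v = ∏ z ∈ A.posSet, φ z := by
  have hN := A.N_eq_card_iff.2 hL
  have hinv : A.inversions (A.word L) = A.posSet := by
    refine Finset.eq_of_subset_of_card_le (fun z hz => ?_) hN.ge
    have := A.mem_inversions.1 hz
    exact A.mem_posSet.2 ⟨this.1, this.2.1⟩
  -- Every generator is a left descent of the longest element, so some reduced word of it starts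
  -- with `i`. By Matsumoto's theorem the coefficients can be computed from that word, and then
  -- `T_mul_s` applies.
  have hs : ∀ i v, A.Tw φ L (Pi.single 1 1) (v * A.s i) = A.Tw φ L (Pi.single 1 1) v := by
    intro i v
    have hneg : A.h ((A.word L)⁻¹ • A.α i) < 0 := by
      exact (A.N_eq_card_iff (w := (A.word L)⁻¹)).1 (by rw [A.N_inv, hN]) _ (A.α_mem i) (A.α_pos i)
    have h1 := A.N_mul_s_of_neg hneg
    obtain ⟨M, hM, hM'⟩ := A.exists_word ((A.word L)⁻¹ * A.s i)⁻¹
    have e : A.word (i :: M) = A.word L := by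
      rw [word_cons, hM, mul_inv_rev, inv_inv, ← mul_assoc, mul_inv_cancel, one_mul]
    rw [A.N_inv] at hM' h1
    have := A.Tw_eq_of_reduced hφ (i :: M) L e (by rw [e, List.length_cons]; omega)
      (hN.trans hL'.symm) (Pi.single 1 1)
    rw [← this, Tw_cons, T_mul_s]
  have hw : ∀ (M : List I) v, A.Tw φ L (Pi.single 1 1) (v * A.word M) =
      A.Tw φ L (Pi.single 1 1) v := by
    intro M
    induction M with
    | nil => simp
    | cons i M ih => intro v; rw [word_cons, ← mul_assoc, ih, hs]
  -- The generators generate `G`, so the coefficient function is constant; its value is read off at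
  -- the top element.
  rw [← hinv, ← (A.Tw_leading φ L (hN.trans hL'.symm)).1]
  obtain ⟨M, hM, -⟩ := A.exists_word (v⁻¹ * (A.word L)⁻¹)
  have := hw M v
  rw [hM, mul_inv_cancel_left] at this
  exact this.symm

/-! ### Demazure operators -/

variable [MulSemiringAction G k]

/-- The Demazure operator of a generator, extended to the field. -/
def dem (φ : R → k) (i : I) (f : k) : k := φ (A.α i) * f + A.s i • (φ (A.α i) * f)

/-- Translates the operators on the field into the twisted group algebra, where `Pi.single 1 1` is
the identity. Moving `φ (α i)` past `v⁻¹` turns it into `φ (v • α i)`. This is why `T` needs no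
action of `G` on the field, and why the braid relations reduce to identities between values of `φ`.
-/
theorem foldr_dem [Fintype G] {φ : R → k} (hφ : ∀ (g : G) z, g • φ z = φ (g • z)) (L : List I)
    (f : k) [DecidableEq G] :
    L.foldr (A.dem φ) f = ∑ v : G, v⁻¹ • (A.Tw φ L (Pi.single 1 1) v * f) := by
  induction L with
  | nil =>
    rw [Finset.sum_eq_single 1]
    · simp
    · intro v _ hv
      simp [hv]
    · simp
  | cons i L ih =>
    rw [List.foldr_cons, ih, dem, smul_mul', Finset.mul_sum, Finset.smul_sum]
    have e1 : ∀ v : G, φ (A.α i) * v⁻¹ • (A.Tw φ L (Pi.single 1 1) v * f) =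
        v⁻¹ • (φ (v • A.α i) * A.Tw φ L (Pi.single 1 1) v * f) := by
      intro v
      rw [mul_assoc, smul_mul' v⁻¹ (φ _), hφ, inv_smul_smul]
    have e2 : ∑ v : G, A.s i • v⁻¹ • (A.Tw φ L (Pi.single 1 1) v * f) =
        ∑ v : G, v⁻¹ • (A.Tw φ L (Pi.single 1 1) (v * A.s i) * f) := by
      rw [← Equiv.sum_comp (Equiv.mulRight (A.s i))]
      refine Finset.sum_congr rfl fun v _ => ?_
      rw [Equiv.coe_mulRight, smul_smul, mul_inv_rev, mul_inv_cancel_left]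
    have e3 : ∀ v : G, A.s i • φ (A.α i) * v⁻¹ • (A.Tw φ L (Pi.single 1 1) (v * A.s i) * f) =
        v⁻¹ • (φ ((v * A.s i) • A.α i) * A.Tw φ L (Pi.single 1 1) (v * A.s i) * f) := by
      intro v
      rw [mul_assoc, smul_mul' v⁻¹ (φ _), hφ, hφ, mul_smul, inv_smul_smul]
    rw [e2, Finset.mul_sum, ← Finset.sum_add_distrib]
    refine Finset.sum_congr rfl fun v _ => ?_
    rw [e1, e3, ← smul_add, ← add_mul]
    rfl

theorem foldr_dem_longest [Fintype G] {φ : R → k} (hb : A.Braided φ)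
    (hφ : ∀ (g : G) z, g • φ z = φ (g • z)) (L : List I)
    (hL : ∀ z ∈ A.Φ, 0 < A.h z → A.h (A.word L • z) < 0) (hL' : L.length = A.posSet.card) (f : k) :
    L.foldr (A.dem φ) f = ∑ v : G, v • ((∏ z ∈ A.posSet, φ z) * f) := by
  classical
  rw [A.foldr_dem hφ, ← Equiv.sum_comp (Equiv.inv G)]
  refine Finset.sum_congr rfl fun v _ => ?_
  rw [A.Tw_longest hb L hL hL', Equiv.inv_apply, inv_inv]

theorem foldr_dem_mul {φ : R → k} (L : List I) (f g : k)
    (hf : ∀ v : G, v • f = f) : L.foldr (A.dem φ) (f * g) = f * L.foldr (A.dem φ) g := by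
  induction L with
  | nil => rfl
  | cons i L ih =>
    simp only [List.foldr_cons, ih, dem]
    rw [mul_left_comm, smul_mul' _ f, hf, mul_add]

end RootAction

/-! ### Braid relations in rank two -/

namespace RootAction

section RankTwo

variable {G R I : Type*} [Group G] [MulAction G R] (A : RootAction G R I) {k : Type*} [Field k]

/-- The generators `i`, `j` commute. -/
structure Comm (i j : I) : Prop where
  comm : A.s i * A.s j = A.s j * A.s i
  left : A.s i • A.α j = A.α j
  right : A.s j • A.α i = A.α i

/-- The generators `i`, `j` span a system of type `A₂`. -/
structure TypeA (φ : R → k) (i j : I) : Prop where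
  braid : A.s i * (A.s j * A.s i) = A.s j * (A.s i * A.s j)
  smul_eq : A.s i • A.α j = A.s j • A.α i
  neg_of_neg : ∀ v : G, A.h (v • A.α i) < 0 → A.h (v • A.α j) < 0 → A.h (v • A.s i • A.α j) < 0
  val : ∀ v : G, ∃ x y : k, x ≠ 0 ∧ y ≠ 0 ∧ x + y ≠ 0 ∧
    φ (v • A.α i) = x⁻¹ ∧ φ (v • A.α j) = y⁻¹ ∧ φ (v • A.s i • A.α j) = (x + y)⁻¹ ∧
    φ (v • A.neg (A.α i)) = -x⁻¹ ∧ φ (v • A.neg (A.α j)) = -y⁻¹ ∧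
    φ (v • A.neg (A.s i • A.α j)) = -(x + y)⁻¹

/-- The generators `i`, `j` span a system of type `B₂` with `α j` short; `φ` may be `1` on all short
roots. -/
structure TypeB (φ : R → k) (i j : I) : Prop where
  braid : A.s i * (A.s j * (A.s i * A.s j)) = A.s j * (A.s i * (A.s j * A.s i))
  smul_long : A.s i • A.s j • A.α i = A.s j • A.α i
  smul_short : A.s j • A.s i • A.α j = A.s i • A.α j
  neg_of_neg : ∀ v : G, A.h (v • A.α i) < 0 → A.h (v • A.α j) < 0 →
    A.h (v • A.s i • A.α j) < 0 ∧ A.h (v • A.s j • A.α i) < 0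
  val : ∀ v : G, ∃ x y : k, x ≠ 0 ∧ y ≠ 0 ∧ x + y ≠ 0 ∧ x - y ≠ 0 ∧
    φ (v • A.α i) = (x - y)⁻¹ ∧ φ (v • A.s j • A.α i) = (x + y)⁻¹ ∧
    φ (v • A.neg (A.α i)) = -(x - y)⁻¹ ∧ φ (v • A.neg (A.s j • A.α i)) = -(x + y)⁻¹ ∧
    ((∃ m : k, m ≠ 0 ∧ φ (v • A.α j) = (m * y)⁻¹ ∧ φ (v • A.s i • A.α j) = (m * x)⁻¹ ∧
      φ (v • A.neg (A.α j)) = -(m * y)⁻¹ ∧ φ (v • A.neg (A.s i • A.α j)) = -(m * x)⁻¹) ∨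
    (φ (v • A.α j) = 1 ∧ φ (v • A.s i • A.α j) = 1 ∧
      φ (v • A.neg (A.α j)) = 1 ∧ φ (v • A.neg (A.s i • A.α j)) = 1))

variable {A}

theorem Comm.tw_eq {i j : I} (h : A.Comm i j) (φ : R → k) (q : G → k) :
    A.Tw φ [i, j] q = A.Tw φ [j, i] q := by
  funext v
  simp only [Tw_cons, Tw_nil, T, mul_smul, h.left, h.right, A.s_smul, A.smul_neg, mul_assoc, h.comm]
  ring

/-- At `v` both sides involve `q` only on the coset of `v` under the group generated by the two
reflections. Once `braid` has put the group elements in normal form, comparing coefficients gives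
identities between rational functions of the two simple roots. -/
theorem TypeA.tw_eq {φ : R → k} {i j : I} (h : A.TypeA φ i j) (q : G → k) :
    A.Tw φ [i, j, i] q = A.Tw φ [j, i, j] q := by
  funext v
  have e1 : A.s i • A.s j • A.α i = A.α j := by rw [← h.smul_eq, A.s_smul_s_smul]
  have e2 : A.s j • A.s j • A.α i = A.α i := A.s_smul_s_smul _ _
  have n : ∀ (g : G) z, g • A.neg z = A.neg (g • z) := A.smul_neg
  have hv : ∀ z, A.neg (v • z) = v • A.neg z := fun z => (A.smul_neg _ _).symm
  obtain ⟨x, y, hx, hy, hxy, h1, h2, h3, h4, h5, h6⟩ := h.val v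
  rw [h.smul_eq] at h3 h6
  simp only [Tw_cons, Tw_nil, T, mul_smul, h.smul_eq, e1, e2, A.s_smul, n, mul_assoc,
    A.s_mul_s, mul_one]
  simp only [hv, h1, h2, h3, h4, h5, h6, h.braid]
  field_simp
  ring

/-- The same comparison as in type A. Where `φ` is `1` on the short roots it is even on them instead
of odd, so this case is not a specialization of the other one and is checked separately. -/
theorem TypeB.tw_eq {φ : R → k} {i j : I} (h : A.TypeB φ i j) (q : G → k) :
    A.Tw φ [i, j, i, j] q = A.Tw φ [j, i, j, i] q := by
  funext v
  have e2 : A.s j • A.s j • A.α i = A.α i := A.s_smul_s_smul _ _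
  have e1 : A.s i • A.s i • A.α j = A.α j := A.s_smul_s_smul _ _
  have n : ∀ (g : G) z, g • A.neg z = A.neg (g • z) := A.smul_neg
  have hv : ∀ z, A.neg (v • z) = v • A.neg z := fun z => (A.smul_neg _ _).symm
  simp only [Tw_cons, Tw_nil, T, mul_smul, h.smul_long, h.smul_short, e1, e2, A.s_smul, n,
    mul_assoc, A.s_mul_s, mul_one]
  obtain ⟨x, y, hx, hy, hxy, hxy', h1, h2, h3, h4, h5⟩ := h.val v
  simp only [hv, h1, h2, h3, h4, h.braid]
  rcases h5 with ⟨m, hm, h5, h6, h7, h8⟩ | ⟨h5, h6, h7, h8⟩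
  · simp only [h5, h6, h7, h8]
    field_simp
    ring
  · simp only [h5, h6, h7, h8]
    field_simp
    ring

/-- Two different generators span a root system of type `A₁ × A₁`, `A₂` or `B₂`. -/
def RankTwo (A : RootAction G R I) (φ : R → k) : Prop :=
  ∀ i j, i ≠ j → A.Comm i j ∨ A.TypeA φ i j ∨ A.TypeB φ i j ∨ A.TypeB φ j i

/-- If `u` makes both simple roots negative, it makes all positive roots of the rank two system
negative. Moving the simple root of each letter back through the preceding letters yields one of
these roots, so every letter of the braid word is a descent. -/
theorem RankTwo.braided {φ : R → k} (h : A.RankTwo φ) : A.Braided φ := by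
  intro i j hij
  rcases h i j hij with h | h | h | h
  · refine ⟨[j], [i], rfl, by simp [h.comm], h.tw_eq φ, fun u h1 h2 => ⟨h1, ?_, trivial⟩⟩
    rwa [mul_smul, h.left]
  · refine ⟨[j, i], [i, j], rfl, by simp [h.braid], h.tw_eq, fun u h1 h2 => ⟨h1, ?_, ?_, trivial⟩⟩
    · rw [mul_smul]; exact h.neg_of_neg u h1 h2
    · rwa [mul_smul, mul_smul, ← h.smul_eq, A.s_smul_s_smul]
  · refine ⟨[j, i, j], [i, j, i], rfl, by simp [h.braid], h.tw_eq,
      fun u h1 h2 => ⟨h1, ?_, ?_, ?_, trivial⟩⟩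
    · rw [mul_smul]; exact (h.neg_of_neg u h1 h2).1
    · rw [mul_smul, mul_smul, h.smul_long]; exact (h.neg_of_neg u h1 h2).2
    · rwa [mul_smul, mul_smul, mul_smul, h.smul_short, A.s_smul_s_smul]
  · refine ⟨[j, i, j], [i, j, i], rfl, by simp [h.braid], fun q => (h.tw_eq q).symm,
      fun u h1 h2 => ⟨h1, ?_, ?_, ?_, trivial⟩⟩
    · rw [mul_smul]; exact (h.neg_of_neg u h2 h1).2
    · rw [mul_smul, mul_smul, h.smul_short]; exact (h.neg_of_neg u h2 h1).1
    · rwa [mul_smul, mul_smul, mul_smul, h.smul_long, A.s_smul_s_smul]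

end RankTwo

/-! ### Standard parabolic subgroups and sums over their cosets -/

variable {G R I J : Type*} [Group G] [MulAction G R] (A : RootAction G R I) {H : Subgroup G}
  (B : RootAction H R J) (ι : J → I)

/-- `B` is the action of a standard parabolic subgroup on its roots. -/
structure IsLevi : Prop where
  Φ_sub : B.Φ ⊆ A.Φ
  h_eq : ∀ z, B.h z = A.h z
  neg_eq : ∀ z, B.neg z = A.neg z
  s_eq : ∀ j, (B.s j : G) = A.s (ι j)
  α_eq : ∀ j, B.α j = A.α (ι j)
  inj : Function.Injective ι
  -- Required for all `w` in `G`; the field of `B` with the same name covers only elements of `H`.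
  exists_descent : ∀ (w : G), ∀ z ∈ B.Φ, 0 < A.h z → A.h (w • z) < 0 → ∃ j, A.h (w • B.α j) < 0
  smul_pos : ∀ u : H, ∀ z ∈ A.Φ, z ∉ B.Φ → 0 < A.h z → 0 < A.h (u • z)

/-- The elements that keep the positive roots of the Levi subsystem positive. -/
def IsMin (w : G) : Prop := ∀ z ∈ B.Φ, 0 < A.h z → 0 < A.h (w • z)

variable {A B ι}

/-- The inverse of `w` also makes every positive root negative, because it has the same length. So
`w⁻¹ * w'` keeps all positive roots positive and is `1`. -/
theorem longest_unique {w w' : G} (h : ∀ z ∈ A.Φ, 0 < A.h z → A.h (w • z) < 0)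
    (h' : ∀ z ∈ A.Φ, 0 < A.h z → A.h (w' • z) < 0) : w = w' := by
  have h1 := (A.N_eq_card_iff (w := w⁻¹)).1 (by rw [A.N_inv, A.N_eq_card_iff.2 h])
  refine (inv_mul_eq_one.1 (A.eq_one (w⁻¹ * w') fun z hz hp => ?_))
  have h2 := h1 (A.neg (w' • z)) (A.neg_mem _ (A.smul_mem _ _ hz))
    (by rw [A.h_neg]; have := h' z hz hp; omega)
  rw [A.smul_neg, A.h_neg] at h2
  rw [mul_smul]
  omega

namespace IsLevi

variable (hB : A.IsLevi B ι)
include hB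

theorem neg_of_neg {w : G} (hw : A.IsMin B w) {z : R} (hz : z ∈ B.Φ) (h : A.h z < 0) :
    A.h (w • z) < 0 := by
  have := hw (A.neg z) (hB.neg_eq z ▸ B.neg_mem z hz) (by rw [A.h_neg]; omega)
  rw [A.smul_neg, A.h_neg] at this
  omega

/-- On the roots of `B` the element `w` preserves signs, so the inversions of `w * u` among them are
those of `u`. The other positive roots are permuted by `u`, so there the inversions are translates
of those of `w`; all inversions of `w` are of this kind. -/
theorem N_mul {w : G} (hw : A.IsMin B w) (u : H) : A.N (w * u) = A.N w + B.N u := by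
  classical
  have hu : ∀ z : R, (u : G) • z = u • z := fun z => (Subgroup.smul_def u z).symm
  have hins : A.inversions (w * u) =
      (A.inversions w).image (fun z => u⁻¹ • z) ∪ B.inversions u := by
    ext z
    simp only [mem_inversions, Finset.mem_union, Finset.mem_image, mul_smul, hu]
    constructor
    · rintro ⟨h1, h2, h3⟩
      by_cases hz : z ∈ B.Φ
      · refine Or.inr ⟨hz, by rwa [hB.h_eq], ?_⟩
        rw [hB.h_eq]
        by_contra hc
        have h4 := A.h_smul_ne (u : G) h1
        rw [hu] at h4
        have := hw (u • z) (B.smul_mem u z hz) (by omega)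
        omega
      · exact Or.inl ⟨u • z, ⟨A.smul_mem (u : G) z h1, hB.smul_pos u z h1 hz h2, h3⟩,
          inv_smul_smul u z⟩
    · rintro (⟨y, ⟨h1, h2, h3⟩, rfl⟩ | ⟨h1, h2, h3⟩)
      · have hy : y ∉ B.Φ := fun hy => by
          have := hw y hy h2
          omega
        refine ⟨A.smul_mem ((u⁻¹ : H) : G) y h1, hB.smul_pos u⁻¹ y h1 hy h2, ?_⟩
        rwa [smul_inv_smul]
      · rw [hB.h_eq] at h2 h3
        exact ⟨hB.Φ_sub h1, h2, hB.neg_of_neg hw (B.smul_mem u z h1) h3⟩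
  rw [N, hins, Finset.card_union_of_disjoint, Finset.card_image_of_injective _
    (MulAction.injective _)]
  · rfl
  · rw [Finset.disjoint_left]
    rintro z hz hz'
    obtain ⟨y, hy, rfl⟩ := Finset.mem_image.1 hz
    have hy' := A.mem_inversions.1 hy
    have h1 := (B.mem_inversions.1 hz').1
    have : y ∈ B.Φ := by simpa using B.smul_mem u _ h1
    have := hw y this hy'.2.1
    omega

/-- One direction is additivity of lengths. Conversely, if a positive root of `B` becomes negative,
then so does a simple root of `B`, and its reflection shortens `w` inside the coset. -/
theorem isMin_iff (w : G) : A.IsMin B w ↔ ∀ u : H, A.N w ≤ A.N (w * u) := by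
  refine ⟨fun h u => by rw [hB.N_mul h]; omega, fun h z hz hp => ?_⟩
  by_contra hc
  obtain ⟨j, hj⟩ := hB.exists_descent w z hz hp
    (lt_of_le_of_ne (not_lt.1 hc) (A.h_smul_ne w (hB.Φ_sub hz)))
  have h2 := h (B.s j)
  rw [hB.α_eq] at hj
  rw [hB.s_eq, ← A.N_mul_s_of_neg hj] at h2
  omega

theorem exists_mul_isMin (w : G) : ∃ u : H, A.IsMin B (w * u) := by
  refine ⟨Function.argmin fun u : H => A.N (w * u), (hB.isMin_iff _).2 fun u' => ?_⟩
  have := Function.argmin_le (fun u : H => A.N (w * u)) (Function.argmin (fun u : H => A.N (w * u)) * u')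
  rwa [Subgroup.coe_mul, ← mul_assoc] at this

/-- Uniqueness of the minimal element in a coset: applying `N_mul` from `w` to `w * u` and back
forces `u` to have length zero. -/
theorem eq_one_of_isMin_mul {w : G} (hw : A.IsMin B w) {u : H} (hu : A.IsMin B (w * u)) :
    u = 1 := by
  have h1 := hB.N_mul hw u
  have h2 := hB.N_mul hu u⁻¹
  rw [mul_assoc, ← Subgroup.coe_mul, mul_inv_cancel, Subgroup.coe_one, mul_one] at h2
  exact B.eq_one_of_N_eq_zero (by omega)

/-- The minimal length representatives contain a unique longest one; its product with the longest
element of the parabolic subgroup is the longest element. -/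
theorem exists_longest_isMin : ∃ w, A.IsMin B w ∧ (∀ v, A.IsMin B v → A.N v ≤ A.N w) ∧
    (∀ v, A.IsMin B v → A.N w ≤ A.N v → v = w) ∧
    ∃ u : H, (∀ z ∈ B.Φ, 0 < B.h z → B.h (u • z) < 0) ∧
      (∀ z ∈ A.Φ, 0 < A.h z → A.h ((w * u) • z) < 0) := by
  obtain ⟨w, hw⟩ := A.exists_longest
  obtain ⟨u, hu⟩ := B.exists_longest
  have hu' := (B.N_eq_card_iff (w := u⁻¹)).1 (by rw [B.N_inv, B.N_eq_card_iff.2 hu])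
  -- A positive root of `B` is made negative by `u⁻¹`, and the longest element of `G` makes it
  -- positive again.
  have hmin : A.IsMin B (w * (u⁻¹ : H)) := by
    intro z hz hp
    have h1 := hu' z hz (by rwa [hB.h_eq])
    rw [hB.h_eq] at h1
    have h2 := hw (A.neg (u⁻¹ • z)) (A.neg_mem _ (A.smul_mem ((u⁻¹ : H) : G) z (hB.Φ_sub hz)))
      (by rw [A.h_neg]; omega)
    rw [A.smul_neg, A.h_neg] at h2
    rw [mul_smul, ← Subgroup.smul_def]
    omega
  have hwu : w * (u⁻¹ : H) * (u : G) = w := by simp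
  have h1 := hB.N_mul hmin u
  rw [hwu, A.N_eq_card_iff.2 hw] at h1
  refine ⟨w * (u⁻¹ : H), hmin, fun v hv => ?_, fun v hv hle => ?_, u, hu, by rwa [hwu]⟩
  · have h2 := hB.N_mul hv u
    have h3 := A.N_le (v * u)
    omega
  · have h2 := hB.N_mul hv u
    have h3 := A.N_le (v * u)
    -- If `v` is as long as the candidate, then `v * u` inverts as many roots as there are positive
    -- ones, so it is the longest element.
    have h4 := longest_unique ((A.N_eq_card_iff (w := v * u)).1 (by omega)) hw
    rw [← h4]
    simp

section Field

variable {k : Type*} [Field k] {φ : R → k}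

theorem rankTwo (h : A.RankTwo φ) : B.RankTwo φ := by
  have hs : ∀ (u : H) (z : R), u • z = (u : G) • z := fun u z => Subgroup.smul_def u z
  intro i j hij
  have hneg : B.neg = A.neg := funext hB.neg_eq
  have tA : ∀ i j, A.TypeB φ (ι i) (ι j) → B.TypeB φ i j := fun i j h => by
    constructor
    · apply Subtype.ext; simpa [hB.s_eq] using h.braid
    · simpa [hs, hB.s_eq, hB.α_eq] using h.smul_long
    · simpa [hs, hB.s_eq, hB.α_eq] using h.smul_short
    · intro v
      simpa [hs, hB.s_eq, hB.α_eq, hB.h_eq] using h.neg_of_neg v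
    · intro v
      simpa only [hs, hB.s_eq, hB.α_eq, hneg] using h.val v
  rcases h (ι i) (ι j) (hB.inj.ne hij) with h | h | h | h
  · left
    constructor
    · apply Subtype.ext; simpa [hB.s_eq] using h.comm
    · simpa [hs, hB.s_eq, hB.α_eq] using h.left
    · simpa [hs, hB.s_eq, hB.α_eq] using h.right
  · right; left
    constructor
    · apply Subtype.ext; simpa [hB.s_eq] using h.braid
    · simpa [hs, hB.s_eq, hB.α_eq] using h.smul_eq
    · intro v
      simpa [hs, hB.s_eq, hB.α_eq, hB.h_eq] using h.neg_of_neg v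
    · intro v
      simpa only [hs, hB.s_eq, hB.α_eq, hneg] using h.val v
  · exact Or.inr (Or.inr (Or.inl (tA i j h)))
  · exact Or.inr (Or.inr (Or.inr (tA j i h)))

theorem word_map (L : List J) : A.word (L.map ι) = (B.word L : G) := by
  induction L with
  | nil => simp
  | cons j L ih => simp [ih, hB.s_eq]

variable [MulSemiringAction G k]

theorem foldr_dem_map (L : List J) (f : k) :
    (L.map ι).foldr (A.dem φ) f = L.foldr (B.dem φ) f := by
  induction L with
  | nil => rfl
  | cons j L ih =>
    simp only [List.map_cons, List.foldr_cons, ih, dem, hB.α_eq, ← hB.s_eq]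
    rfl

variable [Fintype G]

-- Each element of `G` is uniquely a minimal representative times an element of `H`, and `X` does
-- not see the second factor.
open Classical in
theorem sum_smul_eq (X : k) (hX : ∀ u : H, u • X = X) :
    ∑ v : G, v • X = Fintype.card H • ∑ w ∈ Finset.univ.filter (A.IsMin B), w • X := by
  rw [← Finset.sum_fiberwise_of_maps_to (s := (Finset.univ : Finset G)) (t := Finset.univ.filter (A.IsMin B))
    (g := fun v => v * (hB.exists_mul_isMin v).choose)
    (fun v _ => by simpa using (hB.exists_mul_isMin v).choose_spec), Finset.smul_sum]
  refine Finset.sum_congr rfl fun w hw => ?_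
  have hw' : A.IsMin B w := by simpa using hw
  rw [← Finset.card_univ, ← Finset.sum_const]
  symm
  -- The fibre over `w` is the coset `w H`, parametrized by `H`.
  refine Finset.sum_bij (fun (u : H) _ => w * u) ?_ ?_ ?_ ?_
  · intro u _
    simp only [Finset.mem_filter, Finset.mem_univ, true_and]
    have h1 := (hB.exists_mul_isMin (w * u)).choose_spec
    set u' := (hB.exists_mul_isMin (w * u)).choose
    rw [mul_assoc, ← Subgroup.coe_mul] at h1 ⊢
    rw [hB.eq_one_of_isMin_mul hw' h1]
    simp
  · intro u _ u' _ h
    exact Subtype.ext (mul_left_cancel h)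
  · intro v hv
    simp only [Finset.mem_filter, Finset.mem_univ, true_and] at hv
    refine ⟨(hB.exists_mul_isMin v).choose⁻¹, Finset.mem_univ _, ?_⟩
    rw [← hv]
    simp
  · intro u _
    have := hX u
    rw [Subgroup.smul_def] at this
    rw [mul_smul, this]

open Classical in
/-- The Demazure operator of the longest minimal representative is the sum over the minimal
representatives. -/
theorem foldr_dem_eq [CharZero k] (hr : A.RankTwo φ)
    (hφ : ∀ (g : G) z, g • φ z = φ (g • z)) (h0 : ∀ z ∈ A.Φ, φ z ≠ 0) {w : G}
    (hw : A.IsMin B w) (hmax : ∀ v, A.IsMin B v → A.N v ≤ A.N w) (L : List I) (hL : A.word L = w)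
    (hL' : L.length = A.N w) (f : k) (hf : ∀ u : H, u • f = f) :
    (∀ u : H, u • (f * ∏ z ∈ A.posSet \ B.posSet, φ z) = f * ∏ z ∈ A.posSet \ B.posSet, φ z) ∧
    L.foldr (A.dem φ) f = ∑ v ∈ Finset.univ.filter (A.IsMin B),
      v • (f * ∏ z ∈ A.posSet \ B.posSet, φ z) := by
  -- `H` permutes the positive roots that lie outside its own root system.
  have hinv : ∀ u : H, u • (f * ∏ z ∈ A.posSet \ B.posSet, φ z) =
      f * ∏ z ∈ A.posSet \ B.posSet, φ z := by
    intro u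
    rw [smul_mul', hf, Finset.smul_prod']
    congr 1
    refine Finset.prod_bij (fun z _ => u • z) ?_ ?_ ?_ ?_
    · intro z hz
      simp only [Finset.mem_sdiff, mem_posSet, hB.h_eq, not_and] at hz ⊢
      have hz' : z ∉ B.Φ := fun h => hz.2 h hz.1.2
      refine ⟨⟨A.smul_mem (u : G) z hz.1.1, hB.smul_pos u z hz.1.1 hz' hz.1.2⟩, fun h => ?_⟩
      exact absurd (by simpa using B.smul_mem u⁻¹ _ h) hz'
    · intro z _ z' _ h
      exact MulAction.injective u h
    · intro z hz
      simp only [Finset.mem_sdiff, mem_posSet, hB.h_eq, not_and] at hz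
      have hz' : z ∉ B.Φ := fun h => hz.2 h hz.1.2
      refine ⟨u⁻¹ • z, ?_, smul_inv_smul u z⟩
      simp only [Finset.mem_sdiff, mem_posSet, hB.h_eq, not_and]
      refine ⟨⟨A.smul_mem ((u⁻¹ : H) : G) z hz.1.1, hB.smul_pos u⁻¹ z hz.1.1 hz' hz.1.2⟩,
        fun h => ?_⟩
      exact absurd (by simpa using B.smul_mem u _ h) hz'
    · intro z _
      exact hφ (u : G) z
  refine ⟨hinv, ?_⟩
  obtain ⟨w', hw', hmax', huniq, u, hu, hwu⟩ := hB.exists_longest_isMin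
  obtain rfl : w = w' := huniq w hw (hmax w' hw')
  obtain ⟨M, hM, hM'⟩ := B.exists_word u
  have hsub : B.posSet ⊆ A.posSet := fun z hz => by
    have := B.mem_posSet.1 hz
    rw [hB.h_eq] at this
    exact A.mem_posSet.2 ⟨hB.Φ_sub this.1, this.2⟩
  have hne : ∏ z ∈ B.posSet, φ z ≠ 0 := Finset.prod_ne_zero_iff.2 fun z hz =>
    h0 z (A.mem_posSet.1 (hsub hz)).1
  have hcard : (Fintype.card H : k) ≠ 0 := by simp
  -- Chosen so that the symmetrizer of `H`, the operator of its longest element, sends `g` to `1`.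
  -- Dividing by the order of `H` is where characteristic zero enters.
  set g : k := (∏ z ∈ B.posSet, φ z)⁻¹ * (Fintype.card H : k)⁻¹ with hg
  have h1 : M.foldr (B.dem φ) g = 1 := by
    rw [B.foldr_dem_longest (hB.rankTwo hr).braided (fun u z => hφ (u : G) z) M (by rwa [hM])
      (by rw [hM', B.N_eq_card_iff.2 hu]), hg]
    rw [mul_inv_cancel_left₀ hne]
    have : ∀ v : H, v • (Fintype.card H : k)⁻¹ = (Fintype.card H : k)⁻¹ := fun v => by
      rw [smul_inv'']
      congr 1
      exact map_natCast (MulSemiringAction.toRingHom H k v) _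
    simp only [this, Finset.sum_const, Finset.card_univ, nsmul_eq_mul]
    exact mul_inv_cancel₀ hcard
  -- The `H`-invariant `f` passes through the operators of `H`. So the operator of `w` at `f` is the
  -- operator of `w * u`, the longest element of `G`, at `f * g`.
  have h2 : (L ++ M.map ι).foldr (A.dem φ) (f * g) = L.foldr (A.dem φ) f := by
    rw [List.foldr_append, hB.foldr_dem_map, B.foldr_dem_mul M f g hf, h1, mul_one]
  rw [← h2, A.foldr_dem_longest hr.braided hφ]
  · have h3 : (∏ z ∈ A.posSet, φ z) * (f * g) =
        (f * ∏ z ∈ A.posSet \ B.posSet, φ z) * (Fintype.card H : k)⁻¹ := by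
      rw [hg, ← Finset.prod_sdiff hsub]
      field_simp
    have h4 : ∀ v : G, v • (Fintype.card H : k)⁻¹ = (Fintype.card H : k)⁻¹ := fun v => by
      rw [smul_inv'']
      congr 1
      exact map_natCast (MulSemiringAction.toRingHom G k v) _
    rw [h3]
    simp only [smul_mul', h4]
    rw [← Finset.sum_mul]
    simp only [← smul_mul']
    rw [hB.sum_smul_eq _ hinv, nsmul_eq_mul, mul_comm, inv_mul_cancel_left₀ hcard]
  · rw [word_append, hB.word_map, hL, hM]
    exact hwu
  · have h5 := hB.N_mul hw u
    rw [A.N_eq_card_iff.2 hwu] at h5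
    rw [List.length_append, List.length_map, hL', hM', h5]

end Field

end IsLevi
end RootAction

/-! ### Signed variables, and roots as unordered pairs of them -/

namespace Sym2

/-- Permutations act on unordered pairs. -/
instance permMulAction {P : Type*} : MulAction (Equiv.Perm P) (Sym2 P) where
  smul w z := z.map w
  one_smul z := by change z.map _ = z; simp
  mul_smul w w' z := by
    change z.map _ = (z.map w').map w
    rw [Sym2.map_map]; rfl

theorem perm_smul_mk {P : Type*} (w : Equiv.Perm P) (p r : P) : w • s(p, r) = s(w p, w r) := rfl

end Sym2

noncomputable section

namespace DualQuiver

variable {Q₀ Q₁ : Type*} {Q : DualQuiver Q₀ Q₁} {c : Q₀ → ℕ}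

variable (Q) in
/-- The signed variables `± x_k(i)`. -/
abbrev SVar (c : Q₀ → ℕ) : Type _ := Q.Var c × ℤˣ

/-- The negative of a signed variable. -/
def svNeg (p : Q.SVar c) : Q.SVar c := (p.1, -p.2)

/-- A height function: the variables at each vertex have decreasing positive heights. -/
def ht (p : Q.SVar c) : ℤ := (p.2 : ℤ) * ((Q.rk c p.1.1 : ℤ) - p.1.2.val)

theorem var_ext {v u : Q.Var c} (h : v.1 = u.1) (h' : v.2.val = u.2.val) : v = u := by
  obtain ⟨i, k⟩ := v
  obtain ⟨j, l⟩ := u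
  obtain rfl : i = j := h
  obtain rfl : k = l := Fin.ext h'
  rfl

theorem rk_congr {v u : Q.Var c} (h : v.1 = u.1) : Q.rk c v.1 = Q.rk c u.1 := by rw [h]

@[simp] theorem svNeg_svNeg (p : Q.SVar c) : svNeg (svNeg p) = p := by simp [svNeg]

@[simp] theorem ht_svNeg (p : Q.SVar c) : ht (svNeg p) = -ht p := by simp [svNeg, ht]

theorem ht_one (v : Q.Var c) : ht (v, 1) = (Q.rk c v.1 : ℤ) - v.2.val := by simp [ht]

theorem ht_neg_one (v : Q.Var c) : ht (v, -1) = -((Q.rk c v.1 : ℤ) - v.2.val) := by simp [ht]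

theorem ht_one_pos (v : Q.Var c) : 0 < ht (v, 1) := by
  have := v.2.isLt
  rw [ht_one]
  omega

theorem ht_pair (v : Q.Var c) (e : ℤˣ) : ht (v, e) = e * ht (v, 1) := by simp [ht]

theorem ht_ne_zero (p : Q.SVar c) : ht p ≠ 0 := by
  obtain ⟨v, e⟩ := p
  have := ht_one_pos v
  rw [ht_pair]
  rcases Int.units_eq_one_or e with rfl | rfl <;> simp <;> omega

theorem ht_pos_iff (p : Q.SVar c) : 0 < ht p ↔ p.2 = 1 := by
  obtain ⟨v, e⟩ := p
  have := ht_one_pos v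
  rw [ht_pair]
  rcases Int.units_eq_one_or e with rfl | rfl
  · simpa
  · simp; omega

theorem ht_inj {p r : Q.SVar c} (h : p.1.1 = r.1.1) (h' : ht p = ht r) : p = r := by
  have hs : p.2 = r.2 := by
    have h1 := ht_pos_iff p
    have h2 := ht_pos_iff r
    rw [h'] at h1
    rcases Int.units_eq_one_or p.2 with e | e <;> rcases Int.units_eq_one_or r.2 with e' | e' <;>
      simp_all
  refine Prod.ext (var_ext h ?_) hs
  have hr := rk_congr h
  rw [ht, ht, hs] at h'
  rcases Int.units_eq_one_or r.2 with e | e <;> simp [e] at h' <;> omega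

/-- The reason why roots have nonzero height: heights separate the signed variables at a vertex, so
only a variable and its negative cancel, and `RootRel` excludes that pair. -/
theorem eq_svNeg_of_ht {p r : Q.SVar c} (h : p.1.1 = r.1.1) (h' : ht p + ht r = 0) :
    r = svNeg p := (ht_inj (p := svNeg p) (r := r) h (by rw [ht_svNeg]; omega)).symm

/-! ### The Weyl group -/

theorem weyl_svNeg {w : Q.SPerm c} (hw : w ∈ Q.weyl c) (p : Q.SVar c) :
    w (svNeg p) = svNeg (w p) := hw.1 p.1 p.2

theorem weyl_vertex {w : Q.SPerm c} (hw : w ∈ Q.weyl c) (p : Q.SVar c) : (w p).1.1 = p.1.1 :=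
  hw.2.1 p

theorem weyl_pos {w : Q.SPerm c} (hw : w ∈ Q.weyl c) {p : Q.SVar c} (hp : Q.θ p.1.1 ≠ p.1.1) :
    (w p).2 = p.2 := by
  refine hw.2.2 p ?_
  by_contra h
  have := p.1.2.isLt
  simp [rk, h, hp] at this

theorem ht_weyl {w : Q.SPerm c} (hw : w ∈ Q.weyl c) (v : Q.Var c) (e : ℤˣ) :
    ht (w (v, e)) = e * ht (w (v, 1)) := by
  rcases Int.units_eq_one_or e with rfl | rfl
  · simp
  · rw [show ((v, -1) : Q.SVar c) = svNeg (v, 1) from rfl, weyl_svNeg hw]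
    simp

/-- `g` exchanges the variables `v` and `u`. -/
structure IsSwap (g : Q.SPerm c) (v u : Q.Var c) : Prop where
  left : ∀ e, g (v, e) = (u, e)
  right : ∀ e, g (u, e) = (v, e)
  of_ne : ∀ x e, x ≠ v → x ≠ u → g (x, e) = (x, e)

/-- `g` changes the sign of the variable `v`. -/
structure IsFlip (g : Q.SPerm c) (v : Q.Var c) : Prop where
  self : ∀ e, g (v, e) = (v, -e)
  of_ne : ∀ x e, x ≠ v → g (x, e) = (x, e)

/-- The variable that follows `v` at its vertex. -/
def next (v : Q.Var c) (h : v.2.val + 1 < Q.rk c v.1) : Q.Var c := ⟨v.1, ⟨v.2.val + 1, h⟩⟩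

theorem next_ne (v : Q.Var c) (h : v.2.val + 1 < Q.rk c v.1) : next v h ≠ v := by
  intro e
  have h' : (next v h).2.val = v.2.val := by rw [e]
  simp [next] at h'

open Classical in
theorem isSwap_refl (v : Q.Var c) (h : v.2.val + 1 < Q.rk c v.1) : IsSwap (refl v) v (next v h) := by
  refine ⟨fun e => ?_, fun e => ?_, fun x e hx hx' => ?_⟩
  · simp [refl, h, next]
  · simp [refl, h, next]
  · rw [refl, dif_pos h]
    exact Prod.ext (Equiv.swap_apply_of_ne_of_ne hx hx') rfl

open Classical in
theorem isFlip_refl (v : Q.Var c) (h : ¬ v.2.val + 1 < Q.rk c v.1) : IsFlip (refl v) v := by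
  refine ⟨fun e => ?_, fun x e hx => ?_⟩
  · rw [refl, dif_neg h]
    rcases Int.units_eq_one_or e with rfl | rfl <;> simp
  · rw [refl, dif_neg h, Equiv.swap_apply_of_ne_of_ne (by simp [hx]) (by simp [hx])]

theorem IsSwap.mem_weyl {g : Q.SPerm c} {v u : Q.Var c} (hg : IsSwap g v u) (h : v.1 = u.1) :
    g ∈ Q.weyl c ∧ ∀ p, (g p).2 = p.2 := by
  have h1 : ∀ x e, (g (x, e)).2 = e ∧ (g (x, e)).1.1 = x.1 ∧ (g (x, -e)).1 = (g (x, e)).1 := by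
    intro x e
    by_cases hx : x = v
    · subst hx; simp [hg.left, h]
    by_cases hx' : x = u
    · subst hx'; simp [hg.right, h]
    · simp [hg.of_ne x _ hx hx']
  refine ⟨⟨fun x e => ?_, fun p => (h1 p.1 p.2).2.1, fun p _ => (h1 p.1 p.2).1⟩,
    fun p => (h1 p.1 p.2).1⟩
  refine Prod.ext (h1 x e).2.2 ?_
  rw [(h1 x (-e)).1, (h1 x e).1]

theorem IsFlip.mem_weyl {g : Q.SPerm c} {v : Q.Var c} (hg : IsFlip g v) (h : Q.θ v.1 = v.1) :
    g ∈ Q.weyl c := by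
  refine ⟨fun x e => ?_, fun p => ?_, fun p hp => ?_⟩
  · by_cases hx : x = v
    · subst hx; simp [hg.self]
    · simp [hg.of_ne x _ hx]
  · obtain ⟨x, e⟩ := p
    by_cases hx : x = v
    · subst hx; simp [hg.self]
    · simp [hg.of_ne x _ hx]
  · obtain ⟨x, e⟩ := p
    by_cases hx : x = v
    · subst hx; exact absurd h (Q.pos_ne _ hp)
    · simp [hg.of_ne x _ hx]

theorem refl_mem (v : Q.Gen c) : refl v.1 ∈ Q.weyl c := by
  by_cases h : v.1.2.val + 1 < Q.rk c v.1.1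
  · exact ((isSwap_refl v.1 h).mem_weyl rfl).1
  · exact (isFlip_refl v.1 h).mem_weyl (v.2.resolve_left h)

/-! ### Roots -/

/-- The relation "`e_p + e_r` is a root", for signed variables `p`, `r`. -/
def RootRel (p r : Q.SVar c) : Prop :=
  p.1.1 = r.1.1 ∧ r ≠ svNeg p ∧ (Q.θ p.1.1 = p.1.1 ∨ p.2 ≠ r.2)

theorem rootRel_symm : Std.Symm (RootRel (Q := Q) (c := c)) := by
  refine ⟨fun p r ⟨h1, h2, h3⟩ => ⟨h1.symm, fun h => h2 (by rw [h, svNeg_svNeg]), ?_⟩⟩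
  rwa [← h1, ne_comm]

/-- The height of a root. -/
def rootHt : Sym2 (Q.SVar c) → ℤ := Sym2.lift ⟨fun p r => ht p + ht r, fun _ _ => add_comm _ _⟩

@[simp] theorem rootHt_mk (p r : Q.SVar c) : rootHt s(p, r) = ht p + ht r := rfl

open Classical in
/-- The simple root of a generator. -/
def simpleRoot (v : Q.Var c) : Sym2 (Q.SVar c) :=
  if h : v.2.val + 1 < Q.rk c v.1 then s((v, 1), (next v h, -1)) else s((v, 1), (v, 1))

theorem simpleRoot_of_lt {v : Q.Var c} (h : v.2.val + 1 < Q.rk c v.1) :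
    simpleRoot v = s((v, 1), (next v h, -1)) := by rw [simpleRoot, dif_pos h]

theorem simpleRoot_of_not_lt {v : Q.Var c} (h : ¬ v.2.val + 1 < Q.rk c v.1) :
    simpleRoot v = s((v, 1), (v, 1)) := by rw [simpleRoot, dif_neg h]

/-- `β` labels the blocks of a standard parabolic subgroup. -/
structure IsBlocks (β : Q.Var c → ℕ) : Prop where
  mono : ∀ v u, v.1 = u.1 → v.2.val ≤ u.2.val → β v ≤ β u
  fixed : ∀ v, Q.θ v.1 = v.1 → β v ≤ 1

/-- The relation "`e_p + e_r` is a root of the parabolic subgroup with blocks `β`". -/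
def LeviRel (β : Q.Var c → ℕ) (p r : Q.SVar c) : Prop :=
  RootRel p r ∧ β p.1 = β r.1 ∧ (p.2 ≠ r.2 ∨ β p.1 = 1)

theorem leviRel_symm (β : Q.Var c → ℕ) : Std.Symm (LeviRel β) :=
  ⟨fun p r ⟨h1, h2, h3⟩ => ⟨rootRel_symm.symm p r h1, h2.symm, by rwa [ne_comm, ← h2]⟩⟩

/-- With a single block, labelled `1`, the parabolic subgroup is the whole group. The statements
about blocks thus serve the Weyl group and the Levi subgroup alike. -/
theorem leviRel_one (p r : Q.SVar c) : LeviRel (fun _ => 1) p r ↔ RootRel p r := by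
  simp [LeviRel]

/-- The generator `v` belongs to the parabolic subgroup with blocks `β`. -/
def IsSimple (β : Q.Var c → ℕ) (v : Q.Var c) : Prop :=
  (∀ h : v.2.val + 1 < Q.rk c v.1, β v = β (next v h)) ∧ (¬ v.2.val + 1 < Q.rk c v.1 → β v = 1)

/-- Blocks are intervals because `β` is monotone, so all variables between `v` and `u` lie in their
common block and the inequalities for neighbours can be chained. -/
theorem antitone_of_step {β : Q.Var c → ℕ} (hβ : IsBlocks β) {y : Q.Var c → ℤ}
    (hy : ∀ v (h : v.2.val + 1 < Q.rk c v.1), β v = β (next v h) → y (next v h) < y v) (n : ℕ) :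
    ∀ v u : Q.Var c, v.1 = u.1 → u.2.val = v.2.val + n + 1 → β v = β u → y u < y v := by
  induction n with
  | zero =>
    intro v u h1 h2 h3
    have hlt : v.2.val + 1 < Q.rk c v.1 := by
      have := u.2.isLt; have := rk_congr h1; omega
    obtain rfl : u = next v hlt := var_ext h1.symm h2
    exact hy v hlt h3
  | succ n ih =>
    intro v u h1 h2 h3
    have hlt : v.2.val + 1 < Q.rk c v.1 := by
      have := u.2.isLt; have := rk_congr h1; omega
    have hb1 := hβ.mono v (next v hlt) rfl (by simp [next])
    have hb2 := hβ.mono (next v hlt) u h1 (by simp [next]; omega)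
    have h4 := hy v hlt (by omega)
    have h5 := ih (next v hlt) u h1 (by simp [next]; omega) (by omega)
    omega

theorem antitone_of_simple {β : Q.Var c → ℕ} (hβ : IsBlocks β) {y : Q.Var c → ℤ}
    (hy : ∀ v (h : v.2.val + 1 < Q.rk c v.1), β v = β (next v h) → y (next v h) < y v)
    (v u : Q.Var c) (h : v.1 = u.1) (h' : v.2.val < u.2.val) (h3 : β v = β u) : y u < y v :=
  antitone_of_step hβ hy (u.2.val - v.2.val - 1) v u h (by omega) h3

/-- At a fixed vertex block `1` extends to the last variable, since no label there exceeds `1`.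
There `y` is positive, and it decreases along the block. -/
theorem pos_of_simple {β : Q.Var c → ℕ} (hβ : IsBlocks β) {y : Q.Var c → ℤ}
    (hy : ∀ v (h : v.2.val + 1 < Q.rk c v.1), β v = β (next v h) → y (next v h) < y v)
    (hy' : ∀ v, ¬ v.2.val + 1 < Q.rk c v.1 → Q.θ v.1 = v.1 → β v = 1 → 0 < y v)
    (v : Q.Var c) (h : Q.θ v.1 = v.1) (h1 : β v = 1) : 0 < y v := by
  have hv := v.2.isLt
  let u : Q.Var c := ⟨v.1, ⟨Q.rk c v.1 - 1, by omega⟩⟩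
  have h2 := hβ.mono v u rfl (by simp [u]; omega)
  have h3 := hβ.fixed u h
  have h4 := hy' u (by simp [u]; omega) h (by omega)
  rcases Nat.lt_or_ge v.2.val u.2.val with hlt | hge
  · have := antitone_of_simple hβ hy v u rfl hlt (by omega)
    omega
  · have : v = u := var_ext rfl (by simp only [u] at hge ⊢; omega)
    rwa [this]

/-- A function on signed variables that is compatible with signs and positive on the simple roots
of the parabolic subgroup is positive on its positive roots. -/
theorem pos_of_simpleRoots {β : Q.Var c → ℕ} (hβ : IsBlocks β) {y : Q.Var c → ℤ}
    (hy : ∀ v (h : v.2.val + 1 < Q.rk c v.1), β v = β (next v h) → y (next v h) < y v)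
    (hy' : ∀ v, ¬ v.2.val + 1 < Q.rk c v.1 → Q.θ v.1 = v.1 → β v = 1 → 0 < y v)
    {p r : Q.SVar c} (h : LeviRel β p r) (hp : 0 < ht p + ht r) :
    0 < (p.2 : ℤ) * y p.1 + (r.2 : ℤ) * y r.1 := by
  obtain ⟨⟨h1, h2, h3⟩, h4, h5⟩ := h
  obtain ⟨v, e⟩ := p
  obtain ⟨u, e'⟩ := r
  simp only at h1 h2 h3 h4 h5 hp ⊢
  have hv := ht_one_pos v
  have hu := ht_one_pos u
  have hr := rk_congr h1
  rw [ht_pair v e, ht_pair u e', ht_one, ht_one] at hp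
  rw [ht_one] at hv hu
  rcases Int.units_eq_one_or e with rfl | rfl <;> rcases Int.units_eq_one_or e' with rfl | rfl
  · have hf := h3.resolve_right (by simp)
    have hb := h5.resolve_left (by simp)
    have g1 := pos_of_simple hβ hy hy' v hf hb
    have g2 := pos_of_simple hβ hy hy' u (by rwa [← h1]) (by omega)
    simp; omega
  · have := antitone_of_simple hβ hy v u h1 (by simp at hp; omega) h4
    simp; omega
  · have := antitone_of_simple hβ hy u v h1.symm (by simp at hp; omega) h4.symm
    simp; omega
  · simp at hp; omega

theorem rootHt_smul_simpleRoot {w : Q.SPerm c} (hw : w ∈ Q.weyl c) (v : Q.Var c) :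
    (∀ h : v.2.val + 1 < Q.rk c v.1,
      rootHt (w • simpleRoot v) = ht (w (v, 1)) - ht (w (next v h, 1))) ∧
    (¬ v.2.val + 1 < Q.rk c v.1 → rootHt (w • simpleRoot v) = 2 * ht (w (v, 1))) := by
  refine ⟨fun h => ?_, fun h => ?_⟩
  · rw [simpleRoot_of_lt h, Sym2.perm_smul_mk, rootHt_mk, ht_weyl hw _ (-1)]
    simp; ring
  · rw [simpleRoot_of_not_lt h, Sym2.perm_smul_mk, rootHt_mk]
    ring

/-- The contrapositive of `pos_of_simpleRoots` for `y v = ε * ht (w (v, 1))`. The sign `ε = 1`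
produces descents and `ε = -1` ascents; strictness of the inequality is recovered where it is used.
-/
theorem exists_simple {β : Q.Var c → ℕ} (hβ : IsBlocks β) {w : Q.SPerm c} (hw : w ∈ Q.weyl c)
    (ε : ℤ) {p r : Q.SVar c} (h : LeviRel β p r) (hp : 0 < ht p + ht r)
    (hneg : ε * (ht (w p) + ht (w r)) < 0) :
    ∃ v : Q.Gen c, IsSimple β v.1 ∧ ε * rootHt (w • simpleRoot v.1) ≤ 0 := by
  by_contra! hc
  have := pos_of_simpleRoots hβ (y := fun v => ε * ht (w (v, 1))) ?_ ?_ h hp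
  · obtain ⟨v, e⟩ := p
    obtain ⟨u, e'⟩ := r
    rw [ht_weyl hw v, ht_weyl hw u] at hneg
    simp only at this
    linarith
  · intro v h hb
    have := hc ⟨v, Or.inl h⟩ ⟨fun _ => hb, fun h' => absurd h h'⟩
    rw [(rootHt_smul_simpleRoot hw v).1 h] at this
    linarith
  · intro v h hf hb
    have := hc ⟨v, Or.inr hf⟩ ⟨fun h' => absurd h' h, fun _ => hb⟩
    rw [(rootHt_smul_simpleRoot hw v).2 h] at this
    linarith

/-- Keeping positive roots positive means preserving the order by height at each vertex. Consider a
moved element of greatest height: its image cannot be higher, being moved too. If the image is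
lower, then the preimage is higher, by monotonicity, and it is moved as well. -/
theorem weyl_eq_one {w : Q.SPerm c} [Finite Q₀] (hw : w ∈ Q.weyl c)
    (h : ∀ p r : Q.SVar c, RootRel p r → 0 < ht p + ht r → 0 < ht (w p) + ht (w r)) : w = 1 := by
  have hmono : ∀ p r : Q.SVar c, p.1.1 = r.1.1 → (Q.θ p.1.1 = p.1.1 ∨ p.2 = r.2) → ht r < ht p →
      ht (w r) < ht (w p) := by
    intro p r h1 h2 h3
    have := h p (svNeg r) ⟨h1, fun e => ?_, ?_⟩ (by rw [ht_svNeg]; omega)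
    · rw [weyl_svNeg hw, ht_svNeg] at this; omega
    · have : r = p := by rw [← svNeg_svNeg r, e, svNeg_svNeg]
      rw [this] at h3; omega
    · refine h2.imp id fun e => ?_
      rw [e]
      rcases Int.units_eq_one_or r.2 with e | e <;> simp [svNeg, e]
  by_contra hne
  have : ∃ p, w p ≠ p := by
    by_contra! hc; exact hne (Equiv.ext hc)
  obtain ⟨p, hp, hmax⟩ := Set.exists_max_image {p | w p ≠ p} ht (Set.toFinite _) this
  have hp' : w p ≠ p := hp
  have hsig : ∀ q : Q.SVar c, Q.θ q.1.1 = q.1.1 ∨ (w q).2 = q.2 := fun q => by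
    by_cases hq : Q.θ q.1.1 = q.1.1
    · exact Or.inl hq
    · exact Or.inr (weyl_pos hw hq)
  rcases lt_trichotomy (ht (w p)) (ht p) with h1 | h1 | h1
  · set q := w⁻¹ p with hq
    have hwq : w q = p := by simp [q]
    have hqp : q ≠ p := fun e => hp' (by rw [e] at hwq; exact hwq)
    have hv : q.1.1 = p.1.1 := by rw [← weyl_vertex hw q, hwq]
    rcases lt_trichotomy (ht q) (ht p) with h2 | h2 | h2
    · have := hmono p q hv.symm (by
        rcases hsig q with e | e
        · left; rwa [← hv]
        · right; rw [← e, hwq]) h2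
      rw [hwq] at this; omega
    · exact hqp (ht_inj hv h2)
    · refine absurd h2 (not_lt.2 (hmax q ?_))
      change w q ≠ q
      rw [hwq]; exact hqp.symm
  · exact hp' (ht_inj (weyl_vertex hw p) h1)
  · refine absurd h1 (not_lt.2 (hmax (w p) ?_))
    exact fun e => hp' (w.injective e)

/-- The two exchanged variables have consecutive heights, so no other variable at the vertex lies
between them or their negatives. Only the root of the swap itself, up to sign, changes the sign of
its height. -/
theorem IsSwap.pos_of_pos {g : Q.SPerm c} {v u : Q.Var c} (hg : IsSwap g v u) (hvu : v.1 = u.1)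
    (hu : u.2.val = v.2.val + 1) {p r : Q.SVar c} (h : p.1.1 = r.1.1) (hp : 0 < ht p + ht r)
    (hne : s(p, r) ≠ s((v, 1), (u, -1))) : 0 < ht (g p) + ht (g r) := by
  obtain ⟨x, e⟩ := p
  obtain ⟨y, e'⟩ := r
  simp only at h
  have hxy := rk_congr h
  have hvu' := rk_congr hvu
  have h1 : ∀ x e, x ≠ v → x ≠ u → g (x, e) = (x, e) := hg.of_ne
  have key : ∀ x : Q.Var c, x ≠ v → x ≠ u → x.1 = v.1 →
      Q.rk c x.1 = Q.rk c v.1 ∧ x.2.val ≠ v.2.val ∧ x.2.val ≠ u.2.val := fun x h1 h2 h3 =>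
    ⟨rk_congr h3, fun h => h1 (var_ext h3 h), fun h => h2 (var_ext (h3.trans hvu) h)⟩
  have bx := x.2.isLt
  have by' := y.2.isLt
  have bu := u.2.isLt
  rcases eq_or_ne x v with rfl | hxv
  · rcases eq_or_ne y x with rfl | hyv
    · rw [hg.left, hg.left]
      rcases Int.units_eq_one_or e with rfl | rfl <;> rcases Int.units_eq_one_or e' with rfl | rfl <;>
        simp only [ht_one, ht_neg_one] at * <;> omega
    rcases eq_or_ne y u with rfl | hyu
    · rw [hg.left, hg.right]
      rcases Int.units_eq_one_or e with rfl | rfl <;> rcases Int.units_eq_one_or e' with rfl | rfl <;>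
        simp only [ht_one, ht_neg_one] at * <;> first | omega | exact absurd rfl hne
    · rw [hg.left, h1 y _ hyv hyu]
      have := key y hyv hyu h.symm
      rcases Int.units_eq_one_or e with rfl | rfl <;> rcases Int.units_eq_one_or e' with rfl | rfl <;>
        simp only [ht_one, ht_neg_one] at * <;> omega
  rcases eq_or_ne x u with rfl | hxu
  · rcases eq_or_ne y v with rfl | hyv
    · rw [hg.left, hg.right]
      rcases Int.units_eq_one_or e with rfl | rfl <;> rcases Int.units_eq_one_or e' with rfl | rfl <;>
        simp only [ht_one, ht_neg_one] at * <;> first | omega | exact absurd Sym2.eq_swap hne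
    rcases eq_or_ne y x with rfl | hyu
    · rw [hg.right, hg.right]
      rcases Int.units_eq_one_or e with rfl | rfl <;> rcases Int.units_eq_one_or e' with rfl | rfl <;>
        simp only [ht_one, ht_neg_one] at * <;> omega
    · rw [hg.right, h1 y _ hyv hyu]
      have := key y hyv hyu (h.symm.trans hvu.symm)
      rcases Int.units_eq_one_or e with rfl | rfl <;> rcases Int.units_eq_one_or e' with rfl | rfl <;>
        simp only [ht_one, ht_neg_one] at * <;> omega
  rw [h1 x _ hxv hxu]
  rcases eq_or_ne y v with rfl | hyv
  · rw [hg.left]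
    have := key x hxv hxu h
    rcases Int.units_eq_one_or e with rfl | rfl <;> rcases Int.units_eq_one_or e' with rfl | rfl <;>
      simp only [ht_one, ht_neg_one] at * <;> omega
  rcases eq_or_ne y u with rfl | hyu
  · rw [hg.right]
    have := key x hxv hxu (h.trans hvu.symm)
    rcases Int.units_eq_one_or e with rfl | rfl <;> rcases Int.units_eq_one_or e' with rfl | rfl <;>
      simp only [ht_one, ht_neg_one] at * <;> omega
  rwa [h1 y _ hyv hyu]

/-- The last variable has height `1`, and every other variable at its vertex has absolute height at
least `2`. Changing its sign cannot affect the sign of a sum with another variable. -/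
theorem IsFlip.pos_of_pos {g : Q.SPerm c} {v : Q.Var c} (hg : IsFlip g v)
    (hv : v.2.val + 1 = Q.rk c v.1) {p r : Q.SVar c} (h : RootRel p r) (hp : 0 < ht p + ht r)
    (hne : s(p, r) ≠ s((v, 1), (v, 1))) : 0 < ht (g p) + ht (g r) := by
  obtain ⟨h, hn, -⟩ := h
  obtain ⟨x, e⟩ := p
  obtain ⟨y, e'⟩ := r
  simp only at h
  have hxy := rk_congr h
  have bx := x.2.isLt
  have by' := y.2.isLt
  have key : ∀ x : Q.Var c, x ≠ v → x.1 = v.1 →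
      Q.rk c x.1 = Q.rk c v.1 ∧ x.2.val ≠ v.2.val := fun x h1 h3 =>
    ⟨rk_congr h3, fun h => h1 (var_ext h3 h)⟩
  rcases eq_or_ne x v with rfl | hxv
  · rcases eq_or_ne y x with rfl | hyv
    · rw [hg.self, hg.self]
      rcases Int.units_eq_one_or e with rfl | rfl <;> rcases Int.units_eq_one_or e' with rfl | rfl <;>
        simp only [ht_one, ht_neg_one, neg_neg] at * <;> first | omega | exact absurd rfl hne
    · rw [hg.self, hg.of_ne y _ hyv]
      have := key y hyv h.symm
      rcases Int.units_eq_one_or e with rfl | rfl <;> rcases Int.units_eq_one_or e' with rfl | rfl <;>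
        simp only [ht_one, ht_neg_one, neg_neg] at * <;> omega
  · rw [hg.of_ne x _ hxv]
    rcases eq_or_ne y v with rfl | hyv
    · rw [hg.self]
      have := key x hxv h
      rcases Int.units_eq_one_or e with rfl | rfl <;> rcases Int.units_eq_one_or e' with rfl | rfl <;>
        simp only [ht_one, ht_neg_one, neg_neg] at * <;> omega
    · rwa [hg.of_ne y _ hyv]

end DualQuiver

end

set_option linter.unusedSectionVars false

noncomputable section

namespace DualQuiver

variable {Q₀ Q₁ : Type*} {Q : DualQuiver Q₀ Q₁} {c : Q₀ → ℕ}

theorem weyl_smul_mk (w : Q.weyl c) (p r : Q.SVar c) : w • s(p, r) = s(w.1 p, w.1 r) := rfl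

/-! ### The Weyl group as a root action -/

section Action

variable [Fintype Q₀]

open Classical in
/-- The roots of the parabolic subgroup with blocks `β`. -/
def rootSys (β : Q.Var c → ℕ) : Finset (Sym2 (Q.SVar c)) :=
  Finset.univ.filter (· ∈ Sym2.fromRel (leviRel_symm β))

theorem mem_rootSys (β : Q.Var c → ℕ) (p r : Q.SVar c) : s(p, r) ∈ rootSys β ↔ LeviRel β p r := by
  simp [rootSys]

theorem rootHt_neg (z : Sym2 (Q.SVar c)) : rootHt (z.map svNeg) = -rootHt z := by
  induction z with | _ p r => ?_
  simp; ring

theorem smul_map_svNeg (w : Q.weyl c) (z : Sym2 (Q.SVar c)) :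
    w • z.map svNeg = (w • z).map svNeg := by
  induction z with | _ p r => ?_
  rw [Sym2.map_mk, weyl_smul_mk, weyl_svNeg w.2, weyl_svNeg w.2, weyl_smul_mk, Sym2.map_mk]

theorem map_svNeg_map_svNeg (z : Sym2 (Q.SVar c)) : (z.map svNeg).map svNeg = z := by
  induction z with | _ p r => ?_
  simp

theorem map_svNeg_mem (β : Q.Var c → ℕ) (z : Sym2 (Q.SVar c)) (hz : z ∈ rootSys β) :
    z.map svNeg ∈ rootSys β := by
  induction z with | _ p r => ?_
  rw [Sym2.map_mk, mem_rootSys]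
  obtain ⟨⟨h1, h2, h3⟩, h4, h5⟩ := (mem_rootSys β p r).1 hz
  refine ⟨⟨h1, fun h => h2 ?_, h3.imp id fun h => ?_⟩, h4, h5.imp (fun h => ?_) id⟩
  · rw [← svNeg_svNeg r, h, svNeg_svNeg]
  · simpa [svNeg] using h
  · simpa [svNeg] using h

theorem rootHt_ne_zero (β : Q.Var c → ℕ) (z : Sym2 (Q.SVar c)) (hz : z ∈ rootSys β) :
    rootHt z ≠ 0 := by
  induction z with | _ p r => ?_
  obtain ⟨⟨h1, h2, h3⟩, -⟩ := (mem_rootSys β p r).1 hz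
  exact fun h => h2 (eq_svNeg_of_ht h1 h)

theorem refl_smul_simpleRoot (v : Q.Gen c) :
    (⟨refl v.1, refl_mem v⟩ : Q.weyl c) • simpleRoot v.1 = (simpleRoot v.1).map svNeg := by
  by_cases h : v.1.2.val + 1 < Q.rk c v.1.1
  · have hg := isSwap_refl v.1 h
    rw [simpleRoot_of_lt h, weyl_smul_mk, Sym2.map_mk]
    simp only [hg.left, hg.right, svNeg, neg_neg]
    exact Sym2.eq_swap
  · have hg := isFlip_refl v.1 h
    rw [simpleRoot_of_not_lt h, weyl_smul_mk, Sym2.map_mk]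
    simp only [hg.self, svNeg]

theorem rootHt_simpleRoot_pos (v : Q.Var c) : 0 < rootHt (simpleRoot v) := by
  by_cases h : v.2.val + 1 < Q.rk c v.1
  · rw [simpleRoot_of_lt h, rootHt_mk, ht_one, ht_neg_one]
    simp [next]
  · rw [simpleRoot_of_not_lt h, rootHt_mk]
    have := ht_one_pos v
    omega

theorem simpleRoot_mem {β : Q.Var c → ℕ} (v : Q.Gen c) (h : IsSimple β v.1) :
    simpleRoot v.1 ∈ rootSys β := by
  by_cases hv : v.1.2.val + 1 < Q.rk c v.1.1
  · rw [simpleRoot_of_lt hv, mem_rootSys]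
    refine ⟨⟨rfl, fun e => next_ne v.1 hv ?_, Or.inr (by simp)⟩, h.1 hv,
      Or.inl (by simp)⟩
    simpa [svNeg] using e
  · rw [simpleRoot_of_not_lt hv, mem_rootSys]
    exact ⟨⟨rfl, fun e => by simp [svNeg] at e,
      Or.inl (v.2.resolve_left hv)⟩, rfl, Or.inr (h.2 hv)⟩

theorem refl_smul_pos (v : Q.Gen c) (z : Sym2 (Q.SVar c)) (hz : z ∈ rootSys fun _ => 1)
    (hp : 0 < rootHt z) (hne : z ≠ simpleRoot v.1) :
    0 < rootHt ((⟨refl v.1, refl_mem v⟩ : Q.weyl c) • z) := by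
  induction z with | _ p r => ?_
  have h := ((mem_rootSys _ p r).1 hz).1
  by_cases hv : v.1.2.val + 1 < Q.rk c v.1.1
  · rw [simpleRoot_of_lt hv] at hne
    exact (isSwap_refl v.1 hv).pos_of_pos rfl rfl h.1 hp hne
  · rw [simpleRoot_of_not_lt hv] at hne
    have := v.1.2.isLt
    exact (isFlip_refl v.1 hv).pos_of_pos (by omega) h hp hne

theorem rootSys_subset (β : Q.Var c → ℕ) : rootSys β ⊆ rootSys fun _ => 1 := by
  intro z hz
  induction z with | _ p r => ?_
  have := (mem_rootSys β p r).1 hz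
  exact (mem_rootSys _ p r).2 ⟨this.1, rfl, Or.inr rfl⟩

theorem exists_simple_descent {β : Q.Var c → ℕ} (hβ : IsBlocks β) (w : Q.weyl c)
    (z : Sym2 (Q.SVar c)) (hz : z ∈ rootSys β) (hp : 0 < rootHt z) (hn : rootHt (w • z) < 0) :
    ∃ v : Q.Gen c, IsSimple β v.1 ∧ rootHt (w • simpleRoot v.1) < 0 := by
  induction z with | _ p r => ?_
  obtain ⟨v, h1, h2⟩ := exists_simple hβ w.2 1 ((mem_rootSys β p r).1 hz) hp (by
    rw [one_mul]; exact hn)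
  -- Height zero is impossible: for a swap, `w` would identify two different variables; for a sign
  -- change, a single variable would have height zero.
  refine ⟨v, h1, lt_of_le_of_ne (by rwa [one_mul] at h2) ?_⟩
  have := rootHt_ne_zero β _ (simpleRoot_mem v h1)
  by_cases hv : v.1.2.val + 1 < Q.rk c v.1.1
  · have h3 := (rootHt_smul_simpleRoot w.2 v.1).1 hv
    intro h0
    change rootHt (w.1 • simpleRoot v.1) = 0 at h0
    have := w.1.injective (ht_inj (by rw [weyl_vertex w.2, weyl_vertex w.2]; rfl)
      (sub_eq_zero.1 (h3.symm.trans h0)))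
    exact next_ne v.1 hv (congrArg Prod.fst this).symm
  · have h3 := (rootHt_smul_simpleRoot w.2 v.1).2 hv
    intro h0
    change rootHt (w.1 • simpleRoot v.1) = 0 at h0
    have := ht_ne_zero (w.1 (v.1, 1))
    omega

theorem exists_simple_ascent {β : Q.Var c → ℕ} (hβ : IsBlocks β) (w : Q.weyl c)
    (z : Sym2 (Q.SVar c)) (hz : z ∈ rootSys β) (hp : 0 < rootHt z) (hn : 0 < rootHt (w • z)) :
    ∃ v : Q.Gen c, IsSimple β v.1 ∧ 0 < rootHt (w • simpleRoot v.1) := by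
  induction z with | _ p r => ?_
  obtain ⟨v, h1, h2⟩ := exists_simple hβ w.2 (-1) ((mem_rootSys β p r).1 hz) hp (by
    have : rootHt (w • s(p, r)) = ht (w.1 p) + ht (w.1 r) := rfl
    omega)
  refine ⟨v, h1, lt_of_le_of_ne (by change 0 ≤ rootHt (w.1 • simpleRoot v.1); omega) ?_⟩
  by_cases hv : v.1.2.val + 1 < Q.rk c v.1.1
  · have h3 := (rootHt_smul_simpleRoot w.2 v.1).1 hv
    intro h0
    change 0 = rootHt (w.1 • simpleRoot v.1) at h0
    have := w.1.injective (ht_inj (by rw [weyl_vertex w.2, weyl_vertex w.2]; rfl)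
      (sub_eq_zero.1 (h3.symm.trans h0.symm)))
    exact next_ne v.1 hv (congrArg Prod.fst this).symm
  · have h3 := (rootHt_smul_simpleRoot w.2 v.1).2 hv
    intro h0
    change 0 = rootHt (w.1 • simpleRoot v.1) at h0
    have := ht_ne_zero (w.1 (v.1, 1))
    omega

theorem isBlocks_one : IsBlocks fun _ : Q.Var c => 1 := ⟨fun _ _ _ _ => le_rfl, fun _ _ => le_rfl⟩

theorem isSimple_one (v : Q.Var c) : IsSimple (fun _ => 1) v := ⟨fun _ => rfl, fun _ => rfl⟩

theorem refl_mul_refl (v : Q.Var c) : refl v * refl v = 1 := by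
  classical
  ext1 p
  obtain ⟨x, e⟩ := p
  rw [Equiv.Perm.mul_apply, Equiv.Perm.one_apply]
  by_cases h : v.2.val + 1 < Q.rk c v.1
  · have hg := isSwap_refl v h
    by_cases h1 : x = v
    · rw [h1, hg.left, hg.right]
    by_cases h2 : x = next v h
    · rw [h2, hg.right, hg.left]
    rw [hg.of_ne x e h1 h2, hg.of_ne x e h1 h2]
  · have hg := isFlip_refl v h
    by_cases h1 : x = v
    · rw [h1, hg.self, hg.self, neg_neg]
    rw [hg.of_ne x e h1, hg.of_ne x e h1]

theorem weyl_smul_mem (w : Q.weyl c) (z : Sym2 (Q.SVar c)) (hz : z ∈ rootSys fun _ => 1) :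
    w • z ∈ rootSys fun _ => 1 := by
  induction z with | _ p r => ?_
  obtain ⟨⟨h1, h2, h3⟩, -⟩ := (mem_rootSys _ p r).1 hz
  refine (mem_rootSys _ _ _).2 ⟨⟨?_, fun h => h2 ?_, ?_⟩, rfl, Or.inr rfl⟩
  · rw [weyl_vertex w.2, weyl_vertex w.2, h1]
  · rw [← weyl_svNeg w.2] at h
    exact w.1.injective h
  · rw [weyl_vertex w.2]
    by_cases hf : Q.θ p.1.1 = p.1.1
    · exact Or.inl hf
    · refine Or.inr ?_
      rw [weyl_pos w.2 hf, weyl_pos w.2 (by rwa [← h1])]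
      exact h3.resolve_left hf

variable (Q c) in
/-- The Weyl group with its root system of type `A` at the vertices in `Q₀⁺` and type `B` at those in
`Q₀^θ`. -/
def weylAction : RootAction (Q.weyl c) (Sym2 (Q.SVar c)) (Q.Gen c) where
  Φ := rootSys fun _ => 1
  h := rootHt
  neg := Sym2.map svNeg
  s v := ⟨refl v.1, refl_mem v⟩
  α v := simpleRoot v.1
  neg_neg := map_svNeg_map_svNeg
  h_neg := rootHt_neg
  neg_mem := map_svNeg_mem _
  smul_neg := smul_map_svNeg
  smul_mem := weyl_smul_mem
  h_ne := rootHt_ne_zero _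
  s_mul_s v := Subtype.ext (refl_mul_refl v.1)
  s_smul := refl_smul_simpleRoot
  α_mem v := simpleRoot_mem v (isSimple_one v.1)
  α_pos v := rootHt_simpleRoot_pos v.1
  s_smul_pos := refl_smul_pos
  exists_descent w z hz hp hn :=
    (exists_simple_descent isBlocks_one w z hz hp hn).imp fun _ h => h.2
  exists_ascent w z hz hp hn :=
    (exists_simple_ascent isBlocks_one w z hz hp hn).imp fun _ h => h.2
  eq_one w h := Subtype.ext (weyl_eq_one w.2 fun p r hpr hp =>
    h s(p, r) ((mem_rootSys _ p r).2 ((leviRel_one p r).2 hpr)) hp)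

/-! ### The Levi subgroup -/

variable {a b : Q₀ → ℕ}

variable (Q a b) in
/-- The block of a variable. -/
def vblk (v : Q.Var (Q.total a b)) : ℕ := blk a b v.1 v.2

theorem blk_mono (i : Q₀) {k l : ℕ} (h : k ≤ l) : blk a b i k ≤ blk a b i l := by
  simp only [blk]
  split_ifs <;> omega

/-- At a fixed vertex the rank is half of `a + a + b`, rounded down, so the variables run out before
block `2` begins. -/
theorem isBlocks_vblk : IsBlocks (vblk Q a b) := by
  refine ⟨fun v u h h' => ?_, fun v h => ?_⟩
  · obtain ⟨i, k⟩ := v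
    obtain ⟨j, l⟩ := u
    obtain rfl : i = j := h
    exact blk_mono i h'
  · have h1 := v.2.isLt
    have h2 : Q.rk (Q.total a b) v.1 = Q.total a b v.1 / 2 := by
      rw [rk, if_neg (fun hp => Q.pos_ne _ hp h), if_pos h]
    have h3 : Q.total a b v.1 = a v.1 + a v.1 + b v.1 := by rw [total, h]
    rw [vblk, blk]
    split_ifs <;> omega

variable (Q a b) in
/-- The parabolic subgroup of type `(a, b)` as a subgroup of the Weyl group. -/
abbrev levi : Subgroup (Q.weyl (Q.total a b)) := (Q.weylLevi a b).subgroupOf (Q.weyl (Q.total a b))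

theorem levi_vblk (u : levi Q a b) (p : Q.SVar (Q.total a b)) :
    vblk Q a b (u.1.1 p).1 = vblk Q a b p.1 := u.2.2.1 p

theorem levi_sign (u : levi Q a b) {p : Q.SVar (Q.total a b)} (h : vblk Q a b p.1 ≠ 1) :
    (u.1.1 p).2 = p.2 := by
  by_cases hf : Q.θ p.1.1 = p.1.1
  · have := isBlocks_vblk.fixed p.1 hf
    exact u.2.2.2 p (by change vblk Q a b p.1 = 0; omega)
  · exact weyl_pos u.1.2 hf

theorem levi_smul_mem (u : levi Q a b) (z : Sym2 (Q.SVar (Q.total a b)))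
    (hz : z ∈ rootSys (vblk Q a b)) : u • z ∈ rootSys (vblk Q a b) := by
  have h0 := (weyl_smul_mem u.1 z (rootSys_subset _ hz))
  induction z with | _ p r => ?_
  obtain ⟨h1, h2, h3⟩ := (mem_rootSys _ p r).1 hz
  refine (mem_rootSys _ (u.1.1 p) (u.1.1 r)).2 ⟨((mem_rootSys _ _ _).1 h0).1, ?_, ?_⟩
  · rw [levi_vblk, levi_vblk, h2]
  · rw [levi_vblk]
    by_cases h : vblk Q a b p.1 = 1
    · exact Or.inr h
    · rw [levi_sign u h, levi_sign u (by rwa [← h2])]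
      exact h3

/-- The variable in the earlier block has the larger absolute height, so its sign decides. -/
theorem ht_add_pos_iff {β : Q.Var c → ℕ} (hβ : IsBlocks β) {p r : Q.SVar c} (h : p.1.1 = r.1.1)
    (h' : β p.1 < β r.1) : 0 < ht p + ht r ↔ p.2 = 1 := by
  have hlt : p.1.2.val < r.1.2.val := by
    by_contra hc
    have := hβ.mono r.1 p.1 h.symm (by omega)
    omega
  have hr := rk_congr h
  have h1 := r.1.2.isLt
  obtain ⟨v, e⟩ := p
  obtain ⟨u, e'⟩ := r
  rcases Int.units_eq_one_or e with rfl | rfl <;> rcases Int.units_eq_one_or e' with rfl | rfl <;>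
    simp only [ht_one, ht_neg_one] at * <;> simp <;> omega

/-- A root outside the Levi is of one of two kinds. If it joins two blocks, the variable in the
earlier block decides its sign; the Levi keeps that variable in its block and keeps its sign, since
at a fixed vertex this is block `0`. If it joins equal signs in one block other than `1`, the Levi
keeps both signs. -/
theorem levi_smul_pos (u : levi Q a b) (z : Sym2 (Q.SVar (Q.total a b)))
    (hz : z ∈ rootSys fun _ => 1) (hz' : z ∉ rootSys (vblk Q a b)) (hp : 0 < rootHt z) :
    0 < rootHt (u • z) := by
  have key : ∀ p r : Q.SVar (Q.total a b), p.1.1 = r.1.1 → vblk Q a b p.1 < vblk Q a b r.1 →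
      0 < ht p + ht r → 0 < ht (u.1.1 p) + ht (u.1.1 r) := by
    intro p r h1 h2 h3
    rw [ht_add_pos_iff isBlocks_vblk h1 h2] at h3
    rw [ht_add_pos_iff isBlocks_vblk (by rw [weyl_vertex u.1.2, weyl_vertex u.1.2, h1])
      (by rwa [levi_vblk, levi_vblk])]
    rw [← h3]
    by_cases hf : Q.θ p.1.1 = p.1.1
    · have := isBlocks_vblk.fixed r.1 (by rwa [← h1])
      exact levi_sign u (by omega)
    · exact weyl_pos u.1.2 hf
  induction z with | _ p r => ?_
  obtain ⟨h1, -⟩ := (mem_rootSys _ p r).1 hz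
  rw [mem_rootSys] at hz'
  change 0 < ht (u.1.1 p) + ht (u.1.1 r)
  rw [rootHt_mk] at hp
  rcases lt_trichotomy (vblk Q a b p.1) (vblk Q a b r.1) with h | h | h
  · exact key p r h1.1 h hp
  · have h3 : ¬(p.2 ≠ r.2 ∨ vblk Q a b p.1 = 1) := fun h3 => hz' ⟨h1, h, h3⟩
    push Not at h3
    have hp1 := (ht_pos_iff p)
    have hr1 := (ht_pos_iff r)
    have hpr := ht_ne_zero p
    have hrr := ht_ne_zero r
    have hsum : p.2 = 1 := by
      rw [← hp1]
      by_contra hc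
      rw [hp1, h3.1, ← hr1] at hc
      have : ¬ 0 < ht p := by rwa [hp1, h3.1, ← hr1]
      omega
    have g1 : 0 < ht (u.1.1 p) := by rw [ht_pos_iff, levi_sign u h3.2, hsum]
    have g2 : 0 < ht (u.1.1 r) := by
      rw [ht_pos_iff, levi_sign u (by rw [← h]; exact h3.2), ← h3.1, hsum]
    omega
  · have := key r p h1.1.symm h (by omega)
    omega

theorem refl_mem_levi (v : Q.Gen (Q.total a b)) (hv : IsSimple (vblk Q a b) v.1) :
    (⟨refl v.1, refl_mem v⟩ : Q.weyl (Q.total a b)) ∈ levi Q a b := by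
  rw [Subgroup.mem_subgroupOf]
  by_cases h : v.1.2.val + 1 < Q.rk (Q.total a b) v.1.1
  · have hg := isSwap_refl v.1 h
    refine ⟨refl_mem v, fun p => ?_, fun p _ => (hg.mem_weyl rfl).2 p⟩
    change vblk Q a b (refl v.1 p).1 = vblk Q a b p.1
    obtain ⟨x, e⟩ := p
    by_cases h1 : x = v.1
    · rw [h1, hg.left, hv.1 h]
    by_cases h2 : x = next v.1 h
    · rw [h2, hg.right, hv.1 h]
    rw [hg.of_ne x e h1 h2]
  · have hg := isFlip_refl v.1 h
    refine ⟨refl_mem v, fun p => ?_, fun p hp => ?_⟩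
    · change vblk Q a b (refl v.1 p).1 = vblk Q a b p.1
      obtain ⟨x, e⟩ := p
      by_cases h1 : x = v.1
      · rw [h1, hg.self]
      rw [hg.of_ne x e h1]
    · change vblk Q a b p.1 = 0 at hp
      obtain ⟨x, e⟩ := p
      have h1 : x ≠ v.1 := by
        rintro rfl
        have := hv.2 h
        simp only at hp
        omega
      exact congrArg Prod.snd (hg.of_ne x e h1)

variable (Q a b) in
/-- The Levi subgroup of type `(a, b)` with its root system. -/
def leviAction : RootAction (levi Q a b) (Sym2 (Q.SVar (Q.total a b)))
    {v : Q.Gen (Q.total a b) // IsSimple (vblk Q a b) v.1} where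
  Φ := rootSys (vblk Q a b)
  h := rootHt
  neg := Sym2.map svNeg
  s v := ⟨⟨refl v.1.1, refl_mem v.1⟩, refl_mem_levi v.1 v.2⟩
  α v := simpleRoot v.1.1
  neg_neg := map_svNeg_map_svNeg
  h_neg := rootHt_neg
  neg_mem := map_svNeg_mem _
  smul_neg u := smul_map_svNeg u.1
  smul_mem := levi_smul_mem
  h_ne := rootHt_ne_zero _
  s_mul_s v := Subtype.ext (Subtype.ext (refl_mul_refl v.1.1))
  s_smul v := refl_smul_simpleRoot v.1
  α_mem v := simpleRoot_mem v.1 v.2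
  α_pos v := rootHt_simpleRoot_pos v.1.1
  s_smul_pos v z hz := refl_smul_pos v.1 z (rootSys_subset _ hz)
  exists_descent w z hz hp hn := by
    obtain ⟨v, h1, h2⟩ := exists_simple_descent isBlocks_vblk w.1 z hz hp hn
    exact ⟨⟨v, h1⟩, h2⟩
  exists_ascent w z hz hp hn := by
    obtain ⟨v, h1, h2⟩ := exists_simple_ascent isBlocks_vblk w.1 z hz hp hn
    exact ⟨⟨v, h1⟩, h2⟩
  -- The positive roots outside the Levi stay positive in any case, so the condition on the Levi
  -- roots is enough.
  eq_one u h := by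
    refine Subtype.ext ((weylAction Q (Q.total a b)).eq_one u.1 fun z hz hp => ?_)
    by_cases hz' : z ∈ rootSys (vblk Q a b)
    · exact h z hz' hp
    · exact levi_smul_pos u z hz hz' hp

variable (Q a b) in
theorem isLevi : (weylAction Q (Q.total a b)).IsLevi (leviAction Q a b) Subtype.val where
  Φ_sub := rootSys_subset _
  h_eq _ := rfl
  neg_eq _ := rfl
  s_eq _ := rfl
  α_eq _ := rfl
  inj := Subtype.val_injective
  exists_descent w z hz hp hn := by
    obtain ⟨v, h1, h2⟩ := exists_simple_descent isBlocks_vblk w z hz hp hn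
    exact ⟨⟨v, h1⟩, h2⟩
  smul_pos := levi_smul_pos

/-! ### Lengths -/

theorem wordProd_eq (L : List (Q.Gen c)) : wordProd L = ((weylAction Q c).word L : Q.SPerm c) := by
  induction L with
  | nil => rfl
  | cons v L ih =>
    rw [RootAction.word_cons, Subgroup.coe_mul, ← ih]
    simp [wordProd, weylAction]

/-- Identifies the Coxeter length with the number of inversions in the root system of types A and B.
-/
theorem len_eq (w : Q.weyl c) : len w.1 = (weylAction Q c).N w := by
  refine le_antisymm (Nat.sInf_le ?_) (le_csInf ?_ ?_)
  · obtain ⟨L, h1, h2⟩ := (weylAction Q c).exists_word w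
    exact ⟨L, h2, by rw [wordProd_eq, h1]⟩
  · obtain ⟨L, h1, h2⟩ := (weylAction Q c).exists_word w
    exact ⟨_, L, h2, by rw [wordProd_eq, h1]⟩
  · rintro n ⟨L, rfl, h⟩
    rw [wordProd_eq] at h
    rw [← Subtype.ext h]
    exact (weylAction Q c).N_word_le L

theorem isReducedWord_iff (L : List (Q.Gen c)) (w : Q.weyl c) :
    IsReducedWord L w.1 ↔ (weylAction Q c).word L = w ∧ L.length = (weylAction Q c).N w := by
  rw [IsReducedWord, wordProd_eq, len_eq, Subtype.ext_iff]

theorem mem_minReps_iff (w : Q.weyl (Q.total a b)) :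
    w.1 ∈ Q.minReps a b ↔ (weylAction Q (Q.total a b)).IsMin (leviAction Q a b) w := by
  rw [(isLevi Q a b).isMin_iff]
  constructor
  · rintro ⟨-, h⟩ u
    have := h u.1.1 u.2
    rwa [len_eq, ← Subgroup.coe_mul, len_eq] at this
  · refine fun h => ⟨w.2, fun u hu => ?_⟩
    have := h ⟨⟨u, hu.1⟩, hu⟩
    rw [← len_eq, ← len_eq] at this
    exact this

end Action

end DualQuiver

end

noncomputable section

namespace DualQuiver

variable {Q₀ Q₁ : Type*} {Q : DualQuiver Q₀ Q₁} {c : Q₀ → ℕ}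

/-! ### The action of the Weyl group on polynomials and rational functions -/

theorem actPoly_X (w : Q.SPerm c) (v : Q.Var c) :
    actPoly w (X v) = ((w (v, 1)).2 : ℤ) • X (w (v, 1)).1 := by
  rw [actPoly, aeval_X]

/-- A signed variable as a polynomial. -/
def polyLin (p : Q.SVar c) : Q.Poly c := (p.2 : ℤ) • X p.1

theorem polyLin_svNeg (p : Q.SVar c) : polyLin (svNeg p) = -polyLin p := by
  simp [polyLin, svNeg]

theorem polyLin_one (v : Q.Var c) : polyLin (v, 1) = X v := by simp [polyLin]

theorem actPoly_polyLin {w : Q.SPerm c} (hw : w ∈ Q.weyl c) (p : Q.SVar c) :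
    actPoly w (polyLin p) = polyLin (w p) := by
  obtain ⟨v, e⟩ := p
  have h1 : actPoly w (polyLin (v, 1)) = polyLin (w (v, 1)) := by
    rw [polyLin_one, actPoly_X]; rfl
  rcases Int.units_eq_one_or e with rfl | rfl
  · exact h1
  · have : ((v, -1) : Q.SVar c) = svNeg (v, 1) := rfl
    rw [this, polyLin_svNeg, map_neg, h1, weyl_svNeg hw, polyLin_svNeg]

/-- `actPoly` records only the images of the variables with sign `+1`. The outer factor must commute
with negation in order to act correctly on their signed images under `w'`. -/
theorem actPoly_mul {w w' : Q.SPerm c} (hw : w ∈ Q.weyl c) (f : Q.Poly c) :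
    actPoly (w * w') f = actPoly w (actPoly w' f) := by
  have : actPoly (w * w') = (actPoly w).comp (actPoly w') := by
    refine MvPolynomial.algHom_ext fun v => ?_
    rw [AlgHom.comp_apply, actPoly_X w']
    exact (actPoly_X _ _).trans (actPoly_polyLin hw (w' (v, 1))).symm
  rw [this, AlgHom.comp_apply]

theorem actPoly_one (f : Q.Poly c) : actPoly (1 : Q.SPerm c) f = f := by
  have : actPoly (1 : Q.SPerm c) = AlgHom.id ℂ (Q.Poly c) := by
    refine MvPolynomial.algHom_ext fun v => ?_
    rw [actPoly_X]
    simp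
  rw [this, AlgHom.id_apply]

theorem actPoly_injective (w : Q.weyl c) : Function.Injective (actPoly w.1) := by
  intro f g h
  have := congrArg (actPoly (w⁻¹ : Q.weyl c).1) h
  rwa [← actPoly_mul (w⁻¹).2, ← actPoly_mul (w⁻¹).2, ← Subgroup.coe_mul, inv_mul_cancel,
    Subgroup.coe_one, actPoly_one, actPoly_one] at this

/-- The action of an element of the Weyl group on rational functions. -/
def actK (w : Q.weyl c) : Q.K c →+* Q.K c :=
  IsFractionRing.lift (A := Q.Poly c)
    (g := (algebraMap (Q.Poly c) (Q.K c)).comp (actPoly w.1 : Q.Poly c →+* Q.Poly c))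
    ((IsFractionRing.injective (Q.Poly c) (Q.K c)).comp (actPoly_injective w))

theorem actK_algebraMap (w : Q.weyl c) (f : Q.Poly c) :
    actK w (algebraMap (Q.Poly c) (Q.K c) f) = algebraMap (Q.Poly c) (Q.K c) (actPoly w.1 f) :=
  IsFractionRing.lift_algebraMap _ f

instance weylActionK : MulSemiringAction (Q.weyl c) (Q.K c) where
  smul w f := actK w f
  one_smul f := by
    change actK 1 f = f
    have : actK (1 : Q.weyl c) = RingHom.id (Q.K c) := by
      refine IsLocalization.ringHom_ext (nonZeroDivisors (Q.Poly c)) (RingHom.ext fun g => ?_)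
      rw [RingHom.comp_apply, actK_algebraMap, Subgroup.coe_one, actPoly_one]
      rfl
    rw [this, RingHom.id_apply]
  mul_smul w w' f := by
    change actK (w * w') f = actK w (actK w' f)
    have : actK (w * w') = (actK w).comp (actK w') := by
      refine IsLocalization.ringHom_ext (nonZeroDivisors (Q.Poly c)) (RingHom.ext fun g => ?_)
      rw [RingHom.comp_apply, RingHom.comp_apply, RingHom.comp_apply, actK_algebraMap,
        actK_algebraMap, actK_algebraMap, Subgroup.coe_mul, actPoly_mul w.2]
    rw [this, RingHom.comp_apply]
  smul_zero w := map_zero (actK w)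
  smul_add w := map_add (actK w)
  smul_one w := map_one (actK w)
  smul_mul w := map_mul (actK w)

theorem smul_algebraMap_poly (w : Q.weyl c) (f : Q.Poly c) :
    w • algebraMap (Q.Poly c) (Q.K c) f = algebraMap (Q.Poly c) (Q.K c) (actPoly w.1 f) :=
  actK_algebraMap w f

/-- A signed variable as a rational function. -/
def lin (p : Q.SVar c) : Q.K c := algebraMap (Q.Poly c) (Q.K c) (polyLin p)

theorem smul_lin (w : Q.weyl c) (p : Q.SVar c) : w • lin p = lin (w.1 p) := by
  rw [lin, smul_algebraMap_poly, actPoly_polyLin w.2, lin]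

theorem lin_svNeg (p : Q.SVar c) : lin (svNeg p) = -lin p := by
  rw [lin, polyLin_svNeg, map_neg, lin]

theorem polyLin_injective : Function.Injective (polyLin (Q := Q) (c := c)) := by
  classical
  intro p r h
  obtain ⟨v, e⟩ := p
  obtain ⟨u, e'⟩ := r
  have h1 := congrArg (MvPolynomial.eval (Pi.single v (1 : ℂ))) h
  simp only [polyLin, map_zsmul, eval_X, Pi.single_apply, if_true] at h1
  have hvu : u = v := by
    by_contra hne
    rw [if_neg hne] at h1
    rcases Int.units_eq_one_or e with rfl | rfl <;> simp at h1
  rw [if_pos hvu] at h1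
  refine Prod.ext hvu.symm ?_
  rcases Int.units_eq_one_or e with rfl | rfl <;> rcases Int.units_eq_one_or e' with rfl | rfl <;>
    simp at h1 ⊢ <;> norm_num [Complex.ext_iff] at h1

theorem lin_add_ne_zero {p r : Q.SVar c} (h : r ≠ svNeg p) : lin p + lin r ≠ 0 := by
  intro h0
  rw [add_eq_zero_iff_eq_neg, ← lin_svNeg] at h0
  have := polyLin_injective (IsFractionRing.injective (Q.Poly c) (Q.K c) h0)
  exact h (by rw [this, svNeg_svNeg])

theorem svNeg_ne (p : Q.SVar c) : p ≠ svNeg p := by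
  intro h
  have h1 := ht_svNeg p
  have h2 := ht_ne_zero p
  rw [← h] at h1
  omega

theorem lin_ne_zero (p : Q.SVar c) : lin p ≠ 0 := by
  intro h
  exact lin_add_ne_zero (svNeg_ne p) (by rw [h, add_zero])

/-! ### Inverse roots -/

open Classical in
/-- The inverse of the root `e_p + e_r` as a linear form; it is the short root if `p = r`, and `1`
if that is not a root. -/
def rootInv : Sym2 (Q.SVar c) → Q.K c :=
  Sym2.lift ⟨fun p r => if p = r then
      (if Q.σ p.1.1 = -1 then (2 * lin p)⁻¹ else if Odd (c p.1.1) then (lin p)⁻¹ else 1)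
    else (lin p + lin r)⁻¹, fun p r => by
      by_cases h : p = r
      · rw [h]
      · simp only [if_neg h, if_neg (Ne.symm h), add_comm]⟩

open Classical in
theorem rootInv_of_ne {p r : Q.SVar c} (h : p ≠ r) : rootInv s(p, r) = (lin p + lin r)⁻¹ := by
  change (if p = r then _ else _) = _
  rw [if_neg h]

open Classical in
theorem rootInv_self (p : Q.SVar c) : rootInv s(p, p) =
    if Q.σ p.1.1 = -1 then (2 * lin p)⁻¹ else if Odd (c p.1.1) then (lin p)⁻¹ else 1 := by
  change (if p = p then _ else _) = _
  rw [if_pos rfl]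

theorem rootInv_ne_zero {p r : Q.SVar c} (h : r ≠ svNeg p) : rootInv s(p, r) ≠ 0 := by
  by_cases hpr : p = r
  · rw [← hpr, rootInv_self]
    have := lin_ne_zero p
    split_ifs <;> simp [this]
  · rw [rootInv_of_ne hpr]
    exact inv_ne_zero (lin_add_ne_zero h)

/-- The Weyl group preserves vertices, hence also the type (symplectic, odd or even orthogonal) that
fixes the value on the pairs `s(p, p)`. -/
theorem smul_rootInv (w : Q.weyl c) (z : Sym2 (Q.SVar c)) : w • rootInv z = rootInv (w • z) := by
  induction z with | _ p r => ?_
  rw [weyl_smul_mk]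
  by_cases hpr : p = r
  · rw [← hpr, rootInv_self, rootInv_self, weyl_vertex w.2]
    have h2 : w • (2 : Q.K c) = 2 := map_ofNat (MulSemiringAction.toRingHom _ (Q.K c) w) 2
    split_ifs
    · rw [smul_inv'', smul_mul', smul_lin, h2]
    · rw [smul_inv'', smul_lin]
    · rw [smul_one]
  · rw [rootInv_of_ne hpr, rootInv_of_ne (w.1.injective.ne hpr), smul_inv'', smul_add, smul_lin,
      smul_lin]

theorem inv_neg_K (x : Q.K c) : (-x)⁻¹ = -x⁻¹ := inv_neg

/-- Oddness may fail only when `p = r`, where the value is `1` at an even orthogonal vertex. -/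
theorem rootInv_neg_of_ne {p r : Q.SVar c} (h : p ≠ r) :
    rootInv (s(p, r).map svNeg) = -rootInv s(p, r) := by
  rw [Sym2.map_mk, rootInv_of_ne h, rootInv_of_ne, lin_svNeg, lin_svNeg, ← neg_add, inv_neg_K]
  intro h'
  exact h (by rw [← svNeg_svNeg p, h', svNeg_svNeg])

/-! ### Rank two subsystems -/

theorem IsSwap.comm {g g' : Q.SPerm c} {v u v' u' : Q.Var c} (hg : IsSwap g v u)
    (hg' : IsSwap g' v' u') (h1 : v ≠ v') (h2 : v ≠ u') (h3 : u ≠ v') (h4 : u ≠ u') :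
    g * g' = g' * g := by
  ext1 p
  obtain ⟨x, e⟩ := p
  rw [Equiv.Perm.mul_apply, Equiv.Perm.mul_apply]
  by_cases e1 : x = v
  · rw [e1, hg.left, hg'.of_ne v e h1 h2, hg'.of_ne u e h3 h4, hg.left]
  by_cases e2 : x = u
  · rw [e2, hg.right, hg'.of_ne u e h3 h4, hg'.of_ne v e h1 h2, hg.right]
  rw [hg.of_ne x e e1 e2]
  by_cases e3 : x = v'
  · rw [e3, hg'.left, hg.of_ne u' e h2.symm h4.symm]
  by_cases e4 : x = u'
  · rw [e4, hg'.right, hg.of_ne v' e h1.symm h3.symm]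
  rw [hg'.of_ne x e e3 e4, hg.of_ne x e e1 e2]

theorem IsSwap.comm_flip {g g' : Q.SPerm c} {v u v' : Q.Var c} (hg : IsSwap g v u)
    (hg' : IsFlip g' v') (h1 : v ≠ v') (h3 : u ≠ v') : g * g' = g' * g := by
  ext1 p
  obtain ⟨x, e⟩ := p
  rw [Equiv.Perm.mul_apply, Equiv.Perm.mul_apply]
  by_cases e1 : x = v
  · rw [e1, hg.left, hg'.of_ne v e h1, hg'.of_ne u e h3, hg.left]
  by_cases e2 : x = u
  · rw [e2, hg.right, hg'.of_ne u e h3, hg'.of_ne v e h1, hg.right]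
  rw [hg.of_ne x e e1 e2]
  by_cases e3 : x = v'
  · rw [e3, hg'.self, hg.of_ne v' _ h1.symm h3.symm]
  rw [hg'.of_ne x e e3, hg.of_ne x e e1 e2]

theorem IsFlip.comm {g g' : Q.SPerm c} {v v' : Q.Var c} (hg : IsFlip g v) (hg' : IsFlip g' v')
    (h : v ≠ v') : g * g' = g' * g := by
  ext1 p
  obtain ⟨x, e⟩ := p
  rw [Equiv.Perm.mul_apply, Equiv.Perm.mul_apply]
  by_cases e1 : x = v
  · rw [e1, hg.self, hg'.of_ne v e h, hg'.of_ne v _ h, hg.self]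
  rw [hg.of_ne x e e1]
  by_cases e3 : x = v'
  · rw [e3, hg'.self, hg.of_ne v' _ h.symm]
  rw [hg'.of_ne x e e3, hg.of_ne x e e1]

theorem IsSwap.braid {g g' : Q.SPerm c} {x y z : Q.Var c} (hg : IsSwap g x y) (hg' : IsSwap g' y z)
    (hxy : x ≠ y) (hxz : x ≠ z) (hyz : y ≠ z) : g * (g' * g) = g' * (g * g') := by
  ext1 p
  obtain ⟨t, e⟩ := p
  simp only [Equiv.Perm.mul_apply]
  by_cases e1 : t = x
  · rw [e1, hg.left, hg'.left, hg.of_ne z e hxz.symm hyz.symm, hg'.of_ne x e hxy hxz, hg.left,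
      hg'.left]
  by_cases e2 : t = y
  · rw [e2, hg.right, hg'.of_ne x e hxy hxz, hg.left, hg'.left, hg.of_ne z e hxz.symm hyz.symm,
      hg'.right]
  by_cases e3 : t = z
  · rw [e3, hg.of_ne z e hxz.symm hyz.symm, hg'.right, hg.right, hg'.of_ne x e hxy hxz]
  rw [hg.of_ne t e e1 e2, hg'.of_ne t e e2 e3, hg.of_ne t e e1 e2, hg'.of_ne t e e2 e3]

theorem IsSwap.braid_flip {g g' : Q.SPerm c} {x y : Q.Var c} (hg : IsSwap g x y)
    (hg' : IsFlip g' y) (hxy : x ≠ y) : g * (g' * (g * g')) = g' * (g * (g' * g)) := by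
  ext1 p
  obtain ⟨t, e⟩ := p
  simp only [Equiv.Perm.mul_apply]
  by_cases e1 : t = x
  · rw [e1, hg'.of_ne x e hxy, hg.left, hg'.self, hg.right, hg'.of_ne x _ hxy]
  by_cases e2 : t = y
  · rw [e2, hg'.self, hg.right, hg'.of_ne x _ hxy, hg.left, hg.right, hg'.of_ne x _ hxy, hg.left,
      hg'.self]
  simp only [hg.of_ne t e e1 e2, hg'.of_ne t e e2]

section

variable [Fintype Q₀]

/-- A generator as an element of the Weyl group. -/
abbrev gen (v : Q.Gen c) : Q.weyl c := ⟨refl v.1, refl_mem v⟩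

theorem weylAction_s (v : Q.Gen c) : (weylAction Q c).s v = gen v := rfl

theorem weylAction_α (v : Q.Gen c) : (weylAction Q c).α v = simpleRoot v.1 := rfl

theorem weylAction_neg (z : Sym2 (Q.SVar c)) : (weylAction Q c).neg z = z.map svNeg := rfl

/-- The generator `i` moves no variable after the successor of `i`, and `j` moves none before `j`.
The hypothesis makes these sets disjoint, which is what `hne` records. -/
theorem rankTwo_comm (i j : Q.Gen c) (h : i.1.1 = j.1.1 → i.1.2.val + 1 < j.1.2.val) :
    (weylAction Q c).Comm i j := by
  have hne : ∀ k l : Q.Var c, k.1 = i.1.1 → l.1 = j.1.1 → k.2.val ≤ i.1.2.val + 1 →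
      j.1.2.val ≤ l.2.val → k ≠ l := by
    rintro k l h1 h2 h3 h4 rfl
    have := h (h1.symm.trans h2)
    omega
  have n1 := hne i.1 j.1 rfl rfl (by omega) le_rfl
  constructor
  · apply Subtype.ext
    change refl i.1 * refl j.1 = refl j.1 * refl i.1
    by_cases hi : i.1.2.val + 1 < Q.rk c i.1.1 <;> by_cases hj : j.1.2.val + 1 < Q.rk c j.1.1
    · exact (isSwap_refl i.1 hi).comm (isSwap_refl j.1 hj) n1
        (hne _ _ rfl rfl (by omega) (by simp [next])) (hne _ _ rfl rfl (by simp [next]) le_rfl)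
        (hne _ _ rfl rfl (by simp [next]) (by simp [next]))
    · exact (isSwap_refl i.1 hi).comm_flip (isFlip_refl j.1 hj) n1
        (hne _ _ rfl rfl (by simp [next]) le_rfl)
    · exact ((isSwap_refl j.1 hj).comm_flip (isFlip_refl i.1 hi) n1.symm
        (hne i.1 (next j.1 hj) rfl rfl (by omega) (by simp [next])).symm).symm
    · exact (isFlip_refl i.1 hi).comm (isFlip_refl j.1 hj) n1
  · change gen i • simpleRoot j.1 = simpleRoot j.1
    have key : ∀ l : Q.Var c, l.1 = j.1.1 → j.1.2.val ≤ l.2.val → ∀ e, refl i.1 (l, e) = (l, e) := by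
      intro l h1 h2 e
      by_cases hi : i.1.2.val + 1 < Q.rk c i.1.1
      · exact (isSwap_refl i.1 hi).of_ne l e (hne _ _ rfl h1 (by omega) h2).symm
          (hne (next i.1 hi) _ rfl h1 (by simp [next]) h2).symm
      · exact (isFlip_refl i.1 hi).of_ne l e (hne _ _ rfl h1 (by omega) h2).symm
    by_cases hj : j.1.2.val + 1 < Q.rk c j.1.1
    · rw [simpleRoot_of_lt hj, weyl_smul_mk]
      rw [key _ rfl le_rfl, key (next j.1 hj) rfl (by simp [next])]
    · rw [simpleRoot_of_not_lt hj, weyl_smul_mk]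
      rw [key _ rfl le_rfl]
  · change gen j • simpleRoot i.1 = simpleRoot i.1
    have key : ∀ l : Q.Var c, l.1 = i.1.1 → l.2.val ≤ i.1.2.val + 1 → ∀ e,
        refl j.1 (l, e) = (l, e) := by
      intro l h1 h2 e
      by_cases hj : j.1.2.val + 1 < Q.rk c j.1.1
      · exact (isSwap_refl j.1 hj).of_ne l e (hne _ _ h1 rfl h2 le_rfl)
          (hne _ _ h1 rfl h2 (by simp [next]))
      · exact (isFlip_refl j.1 hj).of_ne l e (hne _ _ h1 rfl h2 le_rfl)
    by_cases hi : i.1.2.val + 1 < Q.rk c i.1.1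
    · rw [simpleRoot_of_lt hi, weyl_smul_mk]
      rw [key _ rfl (by omega), key (next i.1 hi) rfl (by simp [next])]
    · rw [simpleRoot_of_not_lt hi, weyl_smul_mk]
      rw [key _ rfl (by omega)]

theorem rootHt_smul_mk (w : Q.weyl c) (p r : Q.SVar c) :
    (weylAction Q c).h (w • s(p, r)) = ht (w.1 p) + ht (w.1 r) := rfl

theorem weyl_neg_one (w : Q.weyl c) (v : Q.Var c) : w.1 (v, -1) = svNeg (w.1 (v, 1)) :=
  weyl_svNeg w.2 (v, 1)

theorem ne_svNeg_of_ne (w : Q.weyl c) {v u : Q.Var c} (h : v ≠ u) :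
    w.1 (v, 1) ≠ svNeg (w.1 (u, 1)) ∧ w.1 (v, 1) ≠ w.1 (u, 1) := by
  refine ⟨fun e => h ?_, fun e => h (congrArg Prod.fst (w.1.injective e))⟩
  rw [← weyl_neg_one] at e
  exact congrArg Prod.fst (w.1.injective e)

theorem rootInv_smul_sub (w : Q.weyl c) {v u : Q.Var c} (h : v ≠ u) :
    lin (w.1 (v, 1)) - lin (w.1 (u, 1)) ≠ 0 ∧
    rootInv (w • s(((v, 1) : Q.SVar c), (u, -1))) =
      (lin (w.1 (v, 1)) - lin (w.1 (u, 1)))⁻¹ ∧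
    rootInv (w • (weylAction Q c).neg s((v, 1), (u, -1))) =
      -(lin (w.1 (v, 1)) - lin (w.1 (u, 1)))⁻¹ := by
  have h1 := ne_svNeg_of_ne w h
  refine ⟨?_, ?_, ?_⟩
  · rw [sub_eq_add_neg, ← lin_svNeg]
    exact lin_add_ne_zero fun e => h1.2 (by simpa using (congrArg svNeg e).symm)
  · rw [weyl_smul_mk, weyl_neg_one, rootInv_of_ne h1.1, lin_svNeg, sub_eq_add_neg]
  · rw [(weylAction Q c).smul_neg, weyl_smul_mk, weyl_neg_one, weylAction_neg]
    rw [rootInv_neg_of_ne h1.1, rootInv_of_ne h1.1, lin_svNeg, sub_eq_add_neg]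

theorem rootInv_smul_add (w : Q.weyl c) {v u : Q.Var c} (h : v ≠ u) :
    lin (w.1 (v, 1)) + lin (w.1 (u, 1)) ≠ 0 ∧
    rootInv (w • s(((v, 1) : Q.SVar c), (u, 1))) =
      (lin (w.1 (v, 1)) + lin (w.1 (u, 1)))⁻¹ ∧
    rootInv (w • (weylAction Q c).neg s((v, 1), (u, 1))) =
      -(lin (w.1 (v, 1)) + lin (w.1 (u, 1)))⁻¹ := by
  have h1 := ne_svNeg_of_ne w h
  refine ⟨?_, ?_, ?_⟩
  · exact lin_add_ne_zero (ne_svNeg_of_ne w h.symm).1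
  · rw [weyl_smul_mk, rootInv_of_ne h1.2]
  · rw [(weylAction Q c).smul_neg, weyl_smul_mk, weylAction_neg]
    rw [rootInv_neg_of_ne h1.2, rootInv_of_ne h1.2]

/-- For three consecutive variables, the roots `x - y` and `y - z` add up to `x - z`. -/
theorem rankTwo_typeA (i j : Q.Gen c) (hi : i.1.2.val + 1 < Q.rk c i.1.1) (hij : j.1 = next i.1 hi)
    (hj : j.1.2.val + 1 < Q.rk c j.1.1) : (weylAction Q c).TypeA (rootInv (Q := Q)) i j := by
  set x := i.1
  set y := j.1 with hy
  set z := next y hj with hz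
  have hi' : IsSwap (refl x) x y := hij ▸ isSwap_refl x hi
  have hj' : IsSwap (refl y) y z := isSwap_refl y hj
  have hyv : y.2.val = x.2.val + 1 := by rw [hij]; rfl
  have hzv : z.2.val = y.2.val + 1 := rfl
  have hxy : x ≠ y := fun e => by rw [← e] at hyv; omega
  have hyz : y ≠ z := (next_ne y hj).symm
  have hxz : x ≠ z := fun e => by rw [← e] at hzv; omega
  have αi : (weylAction Q c).α i = s((x, 1), (y, -1)) := by
    rw [weylAction_α, simpleRoot_of_lt hi, ← hij]
  have αj : (weylAction Q c).α j = s((y, 1), (z, -1)) := by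
    rw [weylAction_α, simpleRoot_of_lt hj]
  have sij : (weylAction Q c).s i • (weylAction Q c).α j = s((x, 1), (z, -1)) := by
    rw [αj, weylAction_s, weyl_smul_mk]
    change s(refl x _, refl x _) = _
    rw [hi'.right, hi'.of_ne z _ hxz.symm hyz.symm]
  have sji : (weylAction Q c).s j • (weylAction Q c).α i = s((x, 1), (z, -1)) := by
    rw [αi, weylAction_s, weyl_smul_mk]
    change s(refl y _, refl y _) = _
    rw [hj'.left, hj'.of_ne x _ hxy hxz]
  constructor
  · apply Subtype.ext
    exact hi'.braid hj' hxy hxz hyz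
  · rw [sij, sji]
  · intro w
    rw [sij, αi, αj, rootHt_smul_mk, rootHt_smul_mk, rootHt_smul_mk]
    rw [weyl_neg_one, weyl_neg_one, ht_svNeg, ht_svNeg]
    omega
  · intro w
    obtain ⟨a1, a2, a3⟩ := rootInv_smul_sub w hxy
    obtain ⟨b1, b2, b3⟩ := rootInv_smul_sub w hyz
    obtain ⟨c1, c2, c3⟩ := rootInv_smul_sub w hxz
    have e : lin (w.1 (x, 1)) - lin (w.1 (y, 1)) + (lin (w.1 (y, 1)) - lin (w.1 (z, 1))) =
        lin (w.1 (x, 1)) - lin (w.1 (z, 1)) := by ring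
    refine ⟨lin (w.1 (x, 1)) - lin (w.1 (y, 1)), lin (w.1 (y, 1)) - lin (w.1 (z, 1)), a1, b1,
      by rwa [e], ?_⟩
    rw [sij, αi, αj, e]
    exact ⟨a2, b2, c2, a3, b3, c3⟩

theorem rankTwo_typeB (i j : Q.Gen c) (hi : i.1.2.val + 1 < Q.rk c i.1.1) (hij : j.1 = next i.1 hi)
    (hj : ¬ j.1.2.val + 1 < Q.rk c j.1.1) : (weylAction Q c).TypeB (rootInv (Q := Q)) i j := by
  classical
  set x := i.1
  set y := j.1 with hy
  have hi' : IsSwap (refl x) x y := hij ▸ isSwap_refl x hi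
  have hj' : IsFlip (refl y) y := isFlip_refl y hj
  have hyv : y.2.val = x.2.val + 1 := by rw [hij]; rfl
  have hxy : x ≠ y := fun e => by rw [← e] at hyv; omega
  have hv : x.1 = y.1 := by rw [hij]; rfl
  have αi : (weylAction Q c).α i = s((x, 1), (y, -1)) := by
    rw [weylAction_α, simpleRoot_of_lt hi, ← hij]
  have αj : (weylAction Q c).α j = s((y, 1), (y, 1)) := by
    rw [weylAction_α, simpleRoot_of_not_lt hj]
  have sij : (weylAction Q c).s i • (weylAction Q c).α j = s((x, 1), (x, 1)) := by
    rw [αj, weylAction_s, weyl_smul_mk]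
    change s(refl x _, refl x _) = _
    rw [hi'.right]
  have sji : (weylAction Q c).s j • (weylAction Q c).α i = s((x, 1), (y, 1)) := by
    rw [αi, weylAction_s, weyl_smul_mk]
    change s(refl y _, refl y _) = _
    rw [hj'.self, hj'.of_ne x _ hxy, neg_neg]
  constructor
  · apply Subtype.ext
    exact hi'.braid_flip hj' hxy
  · rw [sji, weylAction_s, weyl_smul_mk]
    change s(refl x _, refl x _) = _
    rw [hi'.left, hi'.right, Sym2.eq_swap]
  · rw [sij, weylAction_s, weyl_smul_mk]
    change s(refl y _, refl y _) = _
    rw [hj'.of_ne x _ hxy]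
  · intro w
    rw [sij, sji, αi, αj, rootHt_smul_mk, rootHt_smul_mk, rootHt_smul_mk, rootHt_smul_mk]
    rw [weyl_neg_one, ht_svNeg]
    omega
  · intro w
    obtain ⟨a1, a2, a3⟩ := rootInv_smul_sub w hxy
    obtain ⟨b1, b2, b3⟩ := rootInv_smul_add w hxy
    have hneg : ∀ u : Q.Var c, rootInv (w • (weylAction Q c).neg s((u, 1), (u, 1))) =
        rootInv s(svNeg (w.1 (u, 1)), svNeg (w.1 (u, 1))) := fun u => by
      rw [(weylAction Q c).smul_neg, weyl_smul_mk]; rfl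
    refine ⟨lin (w.1 (x, 1)), lin (w.1 (y, 1)), lin_ne_zero _, lin_ne_zero _, b1, a1, ?_⟩
    rw [sij, sji, αi, αj]
    refine ⟨a2, b2, a3, b3, ?_⟩
    simp only [hneg, weyl_smul_mk, rootInv_self, lin_svNeg, weyl_vertex w.2]
    simp only [svNeg, weyl_vertex w.2, hv]
    -- The short roots enter with factor `2` in type C and factor `1` in type B; at an even
    -- orthogonal vertex their value is the constant `1`.
    by_cases h1 : Q.σ y.1 = -1
    · left
      refine ⟨2, two_ne_zero, ?_⟩
      simp [h1]
    · by_cases h2 : Odd (c y.1)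
      · left
        refine ⟨1, one_ne_zero, ?_⟩
        simp [h1, h2, inv_neg_K]
      · right
        simp [h1, h2]

theorem typeA_symm {i j : Q.Gen c} (h : (weylAction Q c).TypeA (rootInv (Q := Q)) i j) :
    (weylAction Q c).TypeA (rootInv (Q := Q)) j i := by
  refine ⟨h.braid.symm, h.smul_eq.symm, fun v h1 h2 => ?_, fun v => ?_⟩
  · rw [← h.smul_eq]; exact h.neg_of_neg v h2 h1
  · obtain ⟨x, y, h1, h2, h3, h4, h5, h6, h7, h8, h9⟩ := h.val v
    refine ⟨y, x, h2, h1, by rwa [add_comm], h5, h4, ?_, h8, h7, ?_⟩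
    · rw [← h.smul_eq, h6, add_comm]
    · rw [← h.smul_eq, h9, add_comm]

theorem comm_symm {i j : Q.Gen c} (h : (weylAction Q c).Comm i j) : (weylAction Q c).Comm j i :=
  ⟨h.comm.symm, h.right, h.left⟩

-- Two generators at one vertex that are not neighbours commute. Neighbours form type A₂, unless the
-- later one is the sign change of the last variable; then they form type B₂.
variable (Q c) in
theorem rankTwo : (weylAction Q c).RankTwo (rootInv (Q := Q)) := by
  have key : ∀ i j : Q.Gen c, i.1.1 = j.1.1 → i.1.2.val < j.1.2.val →
      (weylAction Q c).Comm i j ∨ (weylAction Q c).TypeA (rootInv (Q := Q)) i j ∨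
        (weylAction Q c).TypeB (rootInv (Q := Q)) i j := by
    intro i j h1 h2
    rcases Nat.lt_or_ge (i.1.2.val + 1) j.1.2.val with h3 | h3
    · exact Or.inl (rankTwo_comm i j fun _ => h3)
    · have hr := rk_congr h1
      have hlt := j.1.2.isLt
      have hi : i.1.2.val + 1 < Q.rk c i.1.1 := by omega
      have hij : j.1 = next i.1 hi := var_ext h1.symm (by simp [next]; omega)
      by_cases hj : j.1.2.val + 1 < Q.rk c j.1.1
      · exact Or.inr (Or.inl (rankTwo_typeA i j hi hij hj))
      · exact Or.inr (Or.inr (rankTwo_typeB i j hi hij hj))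
  intro i j hij
  by_cases hv : i.1.1 = j.1.1
  · rcases lt_trichotomy i.1.2.val j.1.2.val with h | h | h
    · rcases key i j hv h with h | h | h
      · exact Or.inl h
      · exact Or.inr (Or.inl h)
      · exact Or.inr (Or.inr (Or.inl h))
    · exact absurd (Subtype.ext (var_ext hv h)) hij
    · rcases key j i hv.symm h with h | h | h
      · exact Or.inl (comm_symm h)
      · exact Or.inr (Or.inl (typeA_symm h))
      · exact Or.inr (Or.inr (Or.inr h))
  · exact Or.inl (rankTwo_comm i j fun h => absurd h hv)

/-! ### Demazure operators -/

-- Since `rootInv` is odd on true roots, the exact quotient of `f - s f` by the root equals `φ f + s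
-- (φ f)`. At an even orthogonal vertex `φ` is `1`, and the same expression is `f + s f`.
open Classical in
theorem algebraMap_demazureGen (v : Q.Gen c) (f : Q.Poly c) :
    algebraMap (Q.Poly c) (Q.K c) (demazureGen v.1 f) =
      (weylAction Q c).dem (rootInv (Q := Q)) v (algebraMap (Q.Poly c) (Q.K c) f) := by
  have hdem : (weylAction Q c).dem (rootInv (Q := Q)) v (algebraMap (Q.Poly c) (Q.K c) f) =
      rootInv (simpleRoot v.1) * algebraMap (Q.Poly c) (Q.K c) f +
      rootInv ((simpleRoot v.1).map svNeg) * algebraMap (Q.Poly c) (Q.K c) (actPoly (refl v.1) f) := by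
    rw [RootAction.dem, smul_mul', weylAction_s, weylAction_α, smul_rootInv, smul_algebraMap_poly,
      refl_smul_simpleRoot]
  rw [hdem, demazureGen]
  split_ifs with h
  · have h1 : Q.σ v.1.1 ≠ -1 := by rw [h.2.1]; decide
    have h2 : ¬ Odd (c v.1.1) := by rw [Nat.not_odd_iff_even]; exact h.2.2
    rw [simpleRoot_of_not_lt h.1, Sym2.map_mk, rootInv_self, rootInv_self]
    simp [svNeg, h1, h2]
  · have hspec := congrArg (algebraMap (Q.Poly c) (Q.K c)) (Classical.choose_spec (Q.root_dvd v.1 f))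
    rw [map_sub, map_mul] at hspec
    have hroot : rootInv (simpleRoot v.1) = (algebraMap (Q.Poly c) (Q.K c) (root v.1))⁻¹ ∧
        rootInv ((simpleRoot v.1).map svNeg) = -(algebraMap (Q.Poly c) (Q.K c) (root v.1))⁻¹ ∧
        algebraMap (Q.Poly c) (Q.K c) (root v.1) ≠ 0 := by
      by_cases hv : v.1.2.val + 1 < Q.rk c v.1.1
      · have hl : algebraMap (Q.Poly c) (Q.K c) (root v.1) =
            lin (v.1, 1) - lin (next v.1 hv, 1) := by
          rw [root, dif_pos hv, map_sub, lin, lin, polyLin_one, polyLin_one]; rfl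
        obtain ⟨h1, h2, h3⟩ := rootInv_smul_sub (1 : Q.weyl c) (next_ne v.1 hv).symm
        rw [one_smul] at h2 h3
        rw [hl, simpleRoot_of_lt hv]
        exact ⟨h2, h3, h1⟩
      · rw [simpleRoot_of_not_lt hv, Sym2.map_mk, rootInv_self, rootInv_self, lin_svNeg, root,
          dif_neg hv]
        simp only [svNeg]
        have hl := lin_ne_zero (v.1, (1 : ℤˣ))
        have hl' : algebraMap (Q.Poly c) (Q.K c) (X v.1) = lin (v.1, 1) := by
          rw [lin, polyLin_one]
        by_cases h1 : Q.σ v.1.1 = -1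
        · have h2 : algebraMap (Q.Poly c) (Q.K c) 2 = 2 := map_ofNat _ 2
          simp [h1, hl, hl', h2]
        · have h2 : Q.σ v.1.1 = 1 := (Int.units_eq_one_or _).resolve_right h1
          have h3 : Odd (c v.1.1) := by
            rw [← Nat.not_even_iff_odd]
            exact fun h4 => h ⟨hv, h2, h4⟩
          simp [h1, h3, hl, hl', inv_neg_K]
    rw [hroot.1, hroot.2.1]
    rw [neg_mul, ← sub_eq_add_neg, ← mul_sub, hspec, inv_mul_cancel_left₀ hroot.2.2]

theorem algebraMap_demazure (L : List (Q.Gen c)) (f : Q.Poly c) :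
    algebraMap (Q.Poly c) (Q.K c) (demazure L f) =
      L.foldr ((weylAction Q c).dem (rootInv (Q := Q))) (algebraMap (Q.Poly c) (Q.K c) f) := by
  induction L with
  | nil => rfl
  | cons v L ih =>
    rw [List.foldr_cons, ← ih, ← algebraMap_demazureGen]
    rfl

end

end DualQuiver

end

noncomputable section

namespace DualQuiver

variable {Q₀ Q₁ : Type*} {Q : DualQuiver Q₀ Q₁} {c : Q₀ → ℕ}

/-! ### Enumeration of the positive roots -/

variable (Q) in
/-- Indices of roots: `⟨i, k, l, e⟩` stands for `x_k(i) + e x_l(i)`. -/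
abbrev RootIdx (c : Q₀ → ℕ) : Type _ := Σ i : Q₀, Fin (Q.rk c i) × Fin (Q.rk c i) × ℤˣ

/-- The root with a given index. -/
def idxRoot (t : Q.RootIdx c) : Sym2 (Q.SVar c) :=
  s((⟨t.1, t.2.1⟩, 1), (⟨t.1, t.2.2.1⟩, t.2.2.2))

open Classical in
/-- The root with a given index as a polynomial. -/
def idxPoly (t : Q.RootIdx c) : Q.Poly c :=
  if t.2.1 = t.2.2.1 then if Q.σ t.1 = -1 then 2 * X ⟨t.1, t.2.1⟩ else X ⟨t.1, t.2.1⟩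
  else X ⟨t.1, t.2.1⟩ + polyLin (⟨t.1, t.2.2.1⟩, t.2.2.2)

/-- The indices of the positive roots of type `A` and `B`. -/
def IsPosIdx (t : Q.RootIdx c) : Prop :=
  (t.2.1 < t.2.2.1 ∧ (t.2.2.2 = -1 ∨ Q.θ t.1 = t.1)) ∨
    (t.2.1 = t.2.2.1 ∧ t.2.2.2 = 1 ∧ Q.θ t.1 = t.1)

/-- The index does not stand for a sign change that is not a reflection in a root. -/
def IsTrueIdx (t : Q.RootIdx c) : Prop := t.2.1 ≠ t.2.2.1 ∨ Q.σ t.1 = -1 ∨ Odd (c t.1)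

theorem rootInv_idxRoot {t : Q.RootIdx c} (h : IsPosIdx t) (h' : IsTrueIdx t) :
    rootInv (idxRoot t) = (algebraMap (Q.Poly c) (Q.K c) (idxPoly t))⁻¹ := by
  obtain ⟨i, k, l, e⟩ := t
  simp only [idxRoot, idxPoly, IsPosIdx, IsTrueIdx] at *
  by_cases hkl : k = l
  · subst hkl
    obtain ⟨rfl, -⟩ : e = 1 ∧ _ := by simpa using h
    rw [rootInv_self, if_pos rfl, lin, polyLin_one]
    by_cases h1 : Q.σ i = -1
    · have h2 : algebraMap (Q.Poly c) (Q.K c) 2 = 2 := map_ofNat _ 2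
      simp [h1, h2]
    · have h2 : Odd (c i) := by simpa [h1] using h'
      simp [h1, h2]
  · rw [rootInv_of_ne, if_neg hkl, map_add, lin, lin, polyLin_one]
    intro he
    simp at he
    exact hkl he.1

theorem rootInv_idxRoot_of_not {t : Q.RootIdx c} (h : IsPosIdx t) (h' : ¬ IsTrueIdx t) :
    rootInv (idxRoot t) = 1 := by
  obtain ⟨i, k, l, e⟩ := t
  simp only [idxRoot, IsPosIdx, IsTrueIdx, not_or, not_not] at *
  obtain ⟨rfl, h1, h2⟩ := h'
  obtain ⟨rfl, -⟩ : e = 1 ∧ _ := by simpa using h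
  rw [rootInv_self, if_neg h1, if_neg h2]

/-- Requiring `k ≤ l` selects one of the two orderings of the unordered pair. -/
theorem idxRoot_injOn : Set.InjOn (idxRoot (Q := Q) (c := c)) {t | IsPosIdx t} := by
  rintro ⟨i, k, l, e⟩ h ⟨i', k', l', e'⟩ h' he
  simp only [idxRoot, Set.mem_ofPred_eq, IsPosIdx, Sym2.eq_iff, Prod.mk.injEq] at *
  rcases he with ⟨⟨h1, -⟩, h2, rfl⟩ | ⟨⟨h1, h2⟩, h3, h4⟩
  · obtain ⟨rfl, h3⟩ := Sigma.mk.inj_iff.1 h1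
    obtain ⟨-, h4⟩ := Sigma.mk.inj_iff.1 h2
    rw [eq_of_heq h3, eq_of_heq h4]
  · obtain ⟨rfl, h5⟩ := Sigma.mk.inj_iff.1 h1
    obtain ⟨-, h6⟩ := Sigma.mk.inj_iff.1 h3
    obtain rfl := eq_of_heq h5
    obtain rfl := eq_of_heq h6
    subst h2 h4
    have : k = l := by
      rcases h with h | h
      · rcases h' with h' | h'
        · exact absurd (h.1.trans h'.1) (lt_irrefl _)
        · exact h'.1.symm
      · exact h.1
    rw [this]

theorem rootRel_idx {t : Q.RootIdx c} (h : IsPosIdx t) :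
    RootRel (Q := Q) (c := c) (⟨t.1, t.2.1⟩, 1) (⟨t.1, t.2.2.1⟩, t.2.2.2) ∧
      0 < rootHt (idxRoot t) := by
  obtain ⟨i, k, l, e⟩ := t
  simp only [IsPosIdx, idxRoot] at *
  rw [rootHt_mk]
  have hk := k.isLt
  have hl := l.isLt
  rcases h with ⟨h1, h2⟩ | ⟨rfl, rfl, h2⟩
  · have h1' : k.val < l.val := h1
    refine ⟨⟨rfl, fun he => ?_, ?_⟩, ?_⟩
    · simp [svNeg] at he
      exact absurd he.1 (ne_of_gt h1)
    · rcases h2 with rfl | h2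
      · right; simp
      · exact Or.inl h2
    · rcases Int.units_eq_one_or e with rfl | rfl <;> simp only [ht_one, ht_neg_one] <;> omega
  · refine ⟨⟨rfl, fun he => ?_, Or.inl h2⟩, ?_⟩
    · simp [svNeg] at he
    · simp only [ht_one]; omega

theorem exists_idx {p r : Q.SVar c} (h : RootRel p r) (hp : 0 < ht p + ht r) :
    ∃ t : Q.RootIdx c, IsPosIdx t ∧ idxRoot t = s(p, r) := by
  obtain ⟨⟨i, k⟩, e⟩ := p
  obtain ⟨⟨j, l⟩, e'⟩ := r
  obtain ⟨h1, h2, h3⟩ := h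
  obtain rfl : i = j := h1
  simp only [svNeg, ne_eq, Prod.mk.injEq, Sigma.mk.injEq, heq_eq_eq, true_and, not_and] at h2 h3
  rcases Int.units_eq_one_or e with rfl | rfl <;> rcases Int.units_eq_one_or e' with rfl | rfl <;>
    simp only [ht_one, ht_neg_one] at hp
  · have hf : Q.θ i = i := h3.resolve_right (by simp)
    rcases lt_trichotomy k l with hkl | rfl | hkl
    · exact ⟨⟨i, k, l, 1⟩, Or.inl ⟨hkl, Or.inr hf⟩, rfl⟩
    · exact ⟨⟨i, k, k, 1⟩, Or.inr ⟨rfl, rfl, hf⟩, rfl⟩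
    · exact ⟨⟨i, l, k, 1⟩, Or.inl ⟨hkl, Or.inr hf⟩, Sym2.eq_swap⟩
  · have hkl : k < l := Fin.lt_def.2 (by omega)
    exact ⟨⟨i, k, l, -1⟩, Or.inl ⟨hkl, Or.inl rfl⟩, rfl⟩
  · have hkl : l < k := Fin.lt_def.2 (by omega)
    exact ⟨⟨i, l, k, -1⟩, Or.inl ⟨hkl, Or.inl rfl⟩, Sym2.eq_swap⟩
  · have := k.isLt
    have := l.isLt
    omega

theorem xv_of_lt (i : Q₀) {k : ℕ} (h : k < Q.rk c i) : Q.xv c i k = X ⟨i, ⟨k, h⟩⟩ := by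
  rw [xv, dif_pos h]

variable {a b : Q₀ → ℕ}

/-- The root with index `t` belongs to the Levi subgroup of type `(a, b)`. -/
def IsLeviIdx (t : Q.RootIdx (Q.total a b)) : Prop :=
  blk a b t.1 t.2.1 = blk a b t.1 t.2.2.1 ∧ (t.2.2.2 = -1 ∨ blk a b t.1 t.2.1 = 1)

section

variable [Fintype Q₀]

variable (Q a b) in
open Classical in
/-- The indices of the positive roots outside the Levi subgroup. -/
def nilIdx : Finset (Q.RootIdx (Q.total a b)) :=
  Finset.univ.filter fun t => IsPosIdx t ∧ IsTrueIdx t ∧ ¬ IsLeviIdx t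

theorem mem_nilIdx (t : Q.RootIdx (Q.total a b)) :
    t ∈ nilIdx Q a b ↔ IsPosIdx t ∧ IsTrueIdx t ∧ ¬ IsLeviIdx t := by
  simp [nilIdx]

-- The combinatorial root system also contains doubled variables at even orthogonal vertices. They
-- are not roots of the group, but `rootInv` is `1` on them, so only the true roots contribute.
open Classical in
theorem prod_rootInv :
    ∏ z ∈ (weylAction Q (Q.total a b)).posSet \ (leviAction Q a b).posSet, rootInv z =
      ∏ t ∈ nilIdx Q a b, (algebraMap (Q.Poly (Q.total a b)) (Q.K _) (idxPoly t))⁻¹ := by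
  have hL : ∀ t : Q.RootIdx (Q.total a b), IsPosIdx t →
      (idxRoot t ∈ (leviAction Q a b).posSet ↔ IsLeviIdx t) := by
    intro t ht
    have h1 := rootRel_idx ht
    rw [RootAction.mem_posSet]
    change s(_, _) ∈ rootSys (vblk Q a b) ∧ _ ↔ _
    rw [mem_rootSys]
    constructor
    · rintro ⟨⟨-, h2, h3⟩, -⟩
      refine ⟨h2, h3.imp (fun h => ?_) id⟩
      exact (Int.units_eq_one_or _).resolve_left (Ne.symm h)
    · rintro ⟨h2, h3⟩
      refine ⟨⟨h1.1, h2, h3.imp (fun h => ?_) id⟩, h1.2⟩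
      simp [h]
  have e1 : ∏ z ∈ (weylAction Q (Q.total a b)).posSet \ (leviAction Q a b).posSet, rootInv z =
      ∏ t ∈ Finset.univ.filter fun t : Q.RootIdx (Q.total a b) => IsPosIdx t ∧ ¬ IsLeviIdx t,
        rootInv (idxRoot t) := by
    symm
    refine Finset.prod_bij (fun t _ => idxRoot t) ?_ ?_ ?_ fun _ _ => rfl
    · intro t ht
      simp only [Finset.mem_filter, Finset.mem_univ, true_and] at ht
      rw [Finset.mem_sdiff, hL t ht.1, RootAction.mem_posSet]
      have h1 := rootRel_idx ht.1
      refine ⟨⟨?_, h1.2⟩, ht.2⟩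
      exact (mem_rootSys _ _ _).2 ((leviRel_one _ _).2 h1.1)
    · intro t ht t' ht' h
      simp only [Finset.mem_filter, Finset.mem_univ, true_and] at ht ht'
      exact idxRoot_injOn ht.1 ht'.1 h
    · intro z hz
      rw [Finset.mem_sdiff, RootAction.mem_posSet] at hz
      induction z with | _ p r => ?_
      obtain ⟨t, h1, h2⟩ := exists_idx ((mem_rootSys _ p r).1 hz.1.1).1 hz.1.2
      refine ⟨t, ?_, h2⟩
      simp only [Finset.mem_filter, Finset.mem_univ, true_and]
      exact ⟨h1, fun h => hz.2 (h2 ▸ (hL t h1).2 h)⟩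
  rw [e1]
  symm
  refine Eq.trans (b := ∏ t ∈ nilIdx Q a b, rootInv (idxRoot t)) ?_ (Finset.prod_subset ?_ ?_)
  · refine Finset.prod_congr rfl fun t ht => ?_
    rw [mem_nilIdx] at ht
    exact (rootInv_idxRoot ht.1 ht.2.1).symm
  · intro t ht
    rw [mem_nilIdx] at ht
    simp only [Finset.mem_filter, Finset.mem_univ, true_and]
    exact ⟨ht.1, ht.2.2⟩
  · intro t ht ht'
    simp only [Finset.mem_filter, Finset.mem_univ, true_and] at ht
    rw [mem_nilIdx] at ht'
    exact rootInv_idxRoot_of_not ht.1 fun h => ht' ⟨ht.1, h, ht.2⟩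

/-! ### The number of roots outside the Levi subgroup -/

-- Evaluation at coordinate vectors reads off which variables occur in a root. This distinguishes
-- the roots as linear forms, so that counting indices counts roots.
open Classical in
theorem eval_idxPoly_ne_zero {t : Q.RootIdx c} (h : IsPosIdx t) (v : Q.Var c) :
    MvPolynomial.eval (Pi.single v (1 : ℂ)) (idxPoly t) ≠ 0 ↔
      v = ⟨t.1, t.2.1⟩ ∨ v = ⟨t.1, t.2.2.1⟩ := by
  obtain ⟨i, k, l, e⟩ := t
  simp only [idxPoly]
  by_cases hkl : k = l
  · subst hkl
    rw [if_pos rfl]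
    split_ifs <;> simp [Pi.single_apply, eq_comm]
  · rw [if_neg hkl]
    simp only [polyLin, map_add, map_zsmul, eval_X, Pi.single_apply]
    have hne : (⟨i, k⟩ : Q.Var c) ≠ ⟨i, l⟩ := by simpa using hkl
    by_cases h1 : (⟨i, k⟩ : Q.Var c) = v
    · subst h1
      simp [hne.symm]
    · by_cases h2 : (⟨i, l⟩ : Q.Var c) = v
      · subst h2
        rcases Int.units_eq_one_or e with rfl | rfl <;> simp [hne]
      · simp [h1, h2, Ne.symm h1, Ne.symm h2]

theorem idxPoly_injOn : Set.InjOn (idxPoly (Q := Q) (c := c)) {t | IsPosIdx t} := by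
  classical
  intro t h t' h' he
  have key : ∀ v, (v = (⟨t.1, t.2.1⟩ : Q.Var c) ∨ v = ⟨t.1, t.2.2.1⟩) ↔
      (v = ⟨t'.1, t'.2.1⟩ ∨ v = ⟨t'.1, t'.2.2.1⟩) := fun v => by
    rw [← eval_idxPoly_ne_zero h, ← eval_idxPoly_ne_zero h', he]
  obtain ⟨i, k, l, e⟩ := t
  obtain ⟨i', k', l', e'⟩ := t'
  simp only at key
  have hi : i = i' := by
    rcases (key _).1 (Or.inl rfl) with h | h
    · exact (Sigma.mk.inj_iff.1 h).1
    · exact (Sigma.mk.inj_iff.1 h).1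
  subst hi
  have h1 := (key ⟨i, k⟩).1 (Or.inl rfl)
  have h2 := (key ⟨i, l⟩).1 (Or.inr rfl)
  have h3 := (key ⟨i, k'⟩).2 (Or.inl rfl)
  have h4 := (key ⟨i, l'⟩).2 (Or.inr rfl)
  simp only [Sigma.mk.inj_iff, heq_eq_eq, true_and] at h1 h2 h3 h4
  simp only [Set.mem_ofPred_eq, IsPosIdx] at h h'
  have hk : k ≤ l := by
    rcases h with h | h
    · exact h.1.le
    · exact h.1.le
  have hk' : k' ≤ l' := by
    rcases h' with h | h
    · exact h.1.le
    · exact h.1.le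
  have e1 : k = k' := by
    rcases h1 with h1 | h1
    · exact h1
    · rcases h3 with h3 | h3
      · exact h3.symm
      · exact le_antisymm (hk.trans h3.ge) (hk'.trans h1.ge)
  have e2 : l = l' := by
    rcases h2 with h2 | h2
    · rcases h4 with h4 | h4
      · exact le_antisymm (by rw [h2]; exact hk') (by rw [h4]; exact hk)
      · exact h4.symm
    · exact h2
  subst e1 e2
  have e3 : e = e' := by
    by_cases hkl : k = l
    · subst hkl
      simp only [lt_irrefl, false_and, true_and, false_or] at h h'
      rw [h.1, h'.1]
    · simp only [idxPoly, if_neg hkl, add_right_inj] at he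
      exact (Prod.ext_iff.1 (polyLin_injective he)).2
  rw [e3]

/-- The sign `e = -1` gives the differences. The sign `e = 1` gives the sums for `k < l` and the
roots in one variable for `k = l`; `IsTrueIdx` keeps the latter only in types B and C. -/
theorem rootSet_eq (lin : Q.Var c → Q.Var c → Prop) (iso : Q.Var c → Prop) :
    Q.rootSet c lin iso = idxPoly '' {t | IsPosIdx t ∧ IsTrueIdx t ∧
      (t.2.2.2 = -1 → lin ⟨t.1, t.2.1⟩ ⟨t.1, t.2.2.1⟩) ∧
      (t.2.2.2 = 1 → iso ⟨t.1, t.2.1⟩ ∧ iso ⟨t.1, t.2.2.1⟩)} := by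
  have hne : (1 : ℤˣ) ≠ -1 := by decide
  apply Set.Subset.antisymm
  · rintro α (((⟨⟨i, k⟩, ⟨j, l⟩, h1, h2, h3, rfl⟩ | ⟨⟨i, k⟩, ⟨j, l⟩, h1, h2, hf, h3, h4, rfl⟩) |
      ⟨⟨i, k⟩, hf, hσ, ho, h3, rfl⟩) | ⟨⟨i, k⟩, hf, hσ, h3, rfl⟩)
    · obtain rfl : i = j := h1
      have hkl : k < l := h2
      refine ⟨⟨i, k, l, -1⟩, ⟨Or.inl ⟨hkl, Or.inl rfl⟩, Or.inl hkl.ne, fun _ => h3,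
        fun h => absurd h.symm hne⟩, ?_⟩
      simp [idxPoly, hkl.ne, polyLin, sub_eq_add_neg]
    · obtain rfl : i = j := h1
      have hkl : k < l := h2
      refine ⟨⟨i, k, l, 1⟩, ⟨Or.inl ⟨hkl, Or.inr hf⟩, Or.inl hkl.ne, fun h => absurd h hne,
        fun _ => ⟨h3, h4⟩⟩, ?_⟩
      simp [idxPoly, hkl.ne, polyLin]
    · refine ⟨⟨i, k, k, 1⟩, ⟨Or.inr ⟨rfl, rfl, hf⟩, Or.inr (Or.inr ho), fun h => absurd h hne,
        fun _ => ⟨h3, h3⟩⟩, ?_⟩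
      have : Q.σ i ≠ -1 := by
        change Q.σ i = 1 at hσ
        rw [hσ]; exact hne
      simp [idxPoly, this]
    · refine ⟨⟨i, k, k, 1⟩, ⟨Or.inr ⟨rfl, rfl, hf⟩, Or.inr (Or.inl hσ), fun h => absurd h hne,
        fun _ => ⟨h3, h3⟩⟩, ?_⟩
      simp only at hσ
      simp [idxPoly, hσ]
  · rintro _ ⟨⟨i, k, l, e⟩, ⟨h1, h2, h3, h4⟩, rfl⟩
    simp only [IsPosIdx, IsTrueIdx] at h1 h2 h3 h4
    rcases h1 with ⟨hkl, hf⟩ | ⟨rfl, rfl, hf⟩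
    · rcases Int.units_eq_one_or e with rfl | rfl
      · refine Or.inl (Or.inl (Or.inr ⟨⟨i, k⟩, ⟨i, l⟩, rfl, hkl, hf.resolve_left hne, (h4 rfl).1,
          (h4 rfl).2, ?_⟩))
        simp [idxPoly, hkl.ne, polyLin]
      · refine Or.inl (Or.inl (Or.inl ⟨⟨i, k⟩, ⟨i, l⟩, rfl, hkl, h3 rfl, ?_⟩))
        simp [idxPoly, hkl.ne, polyLin, sub_eq_add_neg]
    · by_cases hσ : Q.σ i = -1
      · refine Or.inr ⟨⟨i, k⟩, hf, hσ, (h4 rfl).1, ?_⟩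
        simp [idxPoly, hσ]
      · refine Or.inl (Or.inr ⟨⟨i, k⟩, hf, (Int.units_eq_one_or _).resolve_right hσ,
          (h2.resolve_left (by simp)).resolve_left hσ, (h4 rfl).1, ?_⟩)
        simp [idxPoly, hσ]

/-- Indexing by `idxPoly` is injective, so the difference of the two sets of roots is the image of a
difference of index sets. -/
theorem codimRoots_eq : Q.codimRoots a b = (nilIdx Q a b).card := by
  classical
  have h1 : Q.posRoots (Q.total a b) \ Q.leviRoots a b =
      idxPoly '' (nilIdx Q a b : Set (Q.RootIdx (Q.total a b))) := by
    rw [posRoots, leviRoots, rootSet_eq, rootSet_eq, ← Set.InjOn.image_sdiff_subset]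
    · congr 1
      ext ⟨i, k, l, e⟩
      rw [Finset.mem_coe, mem_nilIdx]
      simp only [IsLeviIdx, Set.mem_sdiff, Set.mem_ofPred_eq, implies_true, and_true]
      rcases Int.units_eq_one_or e with rfl | rfl
      · have hne : (1 : ℤˣ) ≠ -1 := by decide
        simp only [hne, false_imp_iff, true_imp_iff, true_and, false_or]
        constructor
        · rintro ⟨⟨h1, h2⟩, h3⟩
          exact ⟨h1, h2, fun h => h3 ⟨h1, h2, h.2, h.1 ▸ h.2⟩⟩
        · rintro ⟨h1, h2, h3⟩
          exact ⟨⟨h1, h2⟩, fun h => h3 ⟨h.2.2.1.trans h.2.2.2.symm, h.2.2.1⟩⟩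
      · have hne : (-1 : ℤˣ) ≠ 1 := by decide
        simp only [hne, false_imp_iff, true_imp_iff, and_true, true_or]
        tauto
    · exact idxPoly_injOn.mono fun t h => h.1
    · exact fun t h => ⟨h.1, h.2.1, fun _ => trivial, fun _ => ⟨trivial, trivial⟩⟩
  rw [codimRoots, h1, Set.InjOn.ncard_image, Set.ncard_coe_finset]
  refine idxPoly_injOn.mono fun t h => ?_
  exact ((mem_nilIdx t).1 (Finset.mem_coe.1 h)).1

/-! ### The class `θS` as a product of roots -/

/-- Decomposes the pairs of strictly increasing blocks into the three rectangles 0–1, 1–2 and 0–2,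
in which `classSAt` at `Q₀⁺` and `classEAt` at `Q₁⁺` are written. -/
theorem prod_blk {M : Type*} [CommMonoid M] (i j : Q₀) {n m : ℕ} (hn : a i + b i ≤ n)
    (hm : a j + b j ≤ m) (F : ℕ → ℕ → M) :
    (∏ k ∈ Finset.range n, ∏ l ∈ Finset.range m, if blk a b i k < blk a b j l then F k l else 1) =
      (∏ k ∈ Finset.range (a i), ∏ l ∈ Finset.Ico (a j) (a j + b j), F k l) *
      (∏ k ∈ Finset.Ico (a i) (a i + b i), ∏ l ∈ Finset.Ico (a j + b j) m, F k l) *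
      (∏ k ∈ Finset.range (a i), ∏ l ∈ Finset.Ico (a j + b j) m, F k l) := by
  have split : ∀ (i : Q₀) {n : ℕ} (_ : a i + b i ≤ n) (f : ℕ → M),
      ∏ k ∈ Finset.range n, f k = (∏ k ∈ Finset.range (a i), f k) *
        (∏ k ∈ Finset.Ico (a i) (a i + b i), f k) * ∏ k ∈ Finset.Ico (a i + b i) n, f k := by
    intro i n hn f
    rw [Finset.prod_range_mul_prod_Ico f (by omega), Finset.prod_range_mul_prod_Ico f hn]
  have b0 : ∀ i, ∀ k ∈ Finset.range (a i), blk a b i k = 0 := fun i k hk => by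
    rw [Finset.mem_range] at hk; rw [blk, if_pos hk]
  have b1 : ∀ i, ∀ k ∈ Finset.Ico (a i) (a i + b i), blk a b i k = 1 := fun i k hk => by
    rw [Finset.mem_Ico] at hk; rw [blk, if_neg (by omega), if_pos hk.2]
  have b2 : ∀ i n, ∀ k ∈ Finset.Ico (a i + b i) n, blk a b i k = 2 := fun i n k hk => by
    rw [Finset.mem_Ico] at hk; rw [blk, if_neg (by omega), if_neg (by omega)]
  rw [split i hn]
  have c0 : ∀ k ∈ Finset.range (a i),
      (∏ l ∈ Finset.range m, if blk a b i k < blk a b j l then F k l else 1) =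
      (∏ l ∈ Finset.Ico (a j) (a j + b j), F k l) * ∏ l ∈ Finset.Ico (a j + b j) m, F k l := by
    intro k hk
    rw [split j hm, Finset.prod_eq_one (s := Finset.range (a j)), one_mul]
    · congr 1
      · refine Finset.prod_congr rfl fun l hl => ?_
        rw [b0 i k hk, b1 j l hl, if_pos (by omega)]
      · refine Finset.prod_congr rfl fun l hl => ?_
        rw [b0 i k hk, b2 j m l hl, if_pos (by omega)]
    · intro l hl
      rw [b0 i k hk, b0 j l hl, if_neg (by omega)]
  have c1 : ∀ k ∈ Finset.Ico (a i) (a i + b i),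
      (∏ l ∈ Finset.range m, if blk a b i k < blk a b j l then F k l else 1) =
      ∏ l ∈ Finset.Ico (a j + b j) m, F k l := by
    intro k hk
    rw [split j hm, Finset.prod_eq_one (s := Finset.range (a j)),
      Finset.prod_eq_one (s := Finset.Ico (a j) _), one_mul, one_mul]
    · refine Finset.prod_congr rfl fun l hl => ?_
      rw [b1 i k hk, b2 j m l hl, if_pos (by omega)]
    · intro l hl
      rw [b1 i k hk, b1 j l hl, if_neg (by omega)]
    · intro l hl
      rw [b1 i k hk, b0 j l hl, if_neg (by omega)]
  have c2 : ∀ k ∈ Finset.Ico (a i + b i) n,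
      (∏ l ∈ Finset.range m, if blk a b i k < blk a b j l then F k l else 1) = 1 := by
    intro k hk
    refine Finset.prod_eq_one fun l hl => ?_
    rw [b2 i n k hk, if_neg]
    rw [blk]; split_ifs <;> omega
  rw [Finset.prod_congr rfl c0, Finset.prod_congr rfl c1, Finset.prod_congr rfl c2,
    Finset.prod_const_one, mul_one, Finset.prod_mul_distrib]
  exact mul_right_comm _ _ _

theorem prod_units {M : Type*} [CommMonoid M] (f : ℤˣ → M) : ∏ e, f e = f 1 * f (-1) := by
  rw [show (Finset.univ : Finset ℤˣ) = {1, -1} from by decide, Finset.prod_pair (by decide)]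

open Classical in
/-- The contribution of an index to `θS`, as a function on natural numbers. -/
def sFactor (a b : Q₀ → ℕ) (i : Q₀) (k l : ℕ) (e : ℤˣ) : Q.Poly (Q.total a b) :=
  if ((k < l ∧ (e = -1 ∨ Q.θ i = i)) ∨ (k = l ∧ e = 1 ∧ Q.θ i = i)) ∧
    (k ≠ l ∨ Q.σ i = -1 ∨ Odd (Q.total a b i)) ∧
    ¬ (blk a b i k = blk a b i l ∧ (e = -1 ∨ blk a b i k = 1)) then
    -(if k = l then if Q.σ i = -1 then 2 * Q.xv (Q.total a b) i k else Q.xv (Q.total a b) i k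
      else Q.xv (Q.total a b) i k + (e : ℤ) • Q.xv (Q.total a b) i l)
  else 1

theorem prod_nilIdx : ∏ t ∈ nilIdx Q a b, -idxPoly t =
    ∏ i, ∏ k ∈ Finset.range (Q.rk (Q.total a b) i), ∏ l ∈ Finset.range (Q.rk (Q.total a b) i),
      ∏ e, sFactor a b i k l e := by
  classical
  rw [nilIdx, Finset.prod_filter, Fintype.prod_sigma]
  refine Finset.prod_congr rfl fun i _ => ?_
  rw [Fintype.prod_prod_type, Finset.prod_range]
  refine Finset.prod_congr rfl fun k _ => ?_
  rw [Fintype.prod_prod_type, Finset.prod_range]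
  refine Finset.prod_congr rfl fun l _ => ?_
  refine Finset.prod_congr rfl fun e _ => ?_
  simp only [sFactor, IsPosIdx, IsTrueIdx, IsLeviIdx, idxPoly, xv_of_lt i k.isLt, xv_of_lt i l.isLt,
    Fin.lt_def, ne_eq, Fin.ext_iff, polyLin]

/-- Only differences are roots at `Q₀⁺`, and the negative of `x_k - x_l` is the factor `x_l - x_k`.
-/
theorem classSAt_of_pos {i : Q₀} (hi : Q.pos i) :
    ∏ k ∈ Finset.range (Q.rk (Q.total a b) i), ∏ l ∈ Finset.range (Q.rk (Q.total a b) i),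
      ∏ e, sFactor a b i k l e = Q.classSAt a b i := by
  classical
  have hne := Q.pos_ne i hi
  have hrk : Q.rk (Q.total a b) i = Q.total a b i := by rw [rk, if_pos hi]
  have hle : a i + b i ≤ Q.total a b i := by rw [total]; omega
  have hb := fun {k l : ℕ} (h : k ≤ l) => blk_mono (a := a) (b := b) i h
  rw [classSAt, if_pos hi, hrk, ← prod_blk i i hle hle
    fun k l => Q.xv (Q.total a b) i l - Q.xv (Q.total a b) i k]
  refine Finset.prod_congr rfl fun k _ => Finset.prod_congr rfl fun l _ => ?_
  rw [prod_units]
  have e1 : (1 : ℤˣ) ≠ -1 := by decide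
  simp only [sFactor, hne, e1, or_false, and_false, false_and, if_false, one_mul, true_or, and_true]
  by_cases h : blk a b i k < blk a b i l
  · have hkl : k < l := by
      by_contra hc
      have := hb (not_lt.1 hc)
      omega
    rw [if_pos h, if_pos ⟨hkl, Or.inl hkl.ne, h.ne⟩, if_neg hkl.ne]
    simp [sub_eq_add_neg]
  · rw [if_neg h, if_neg]
    rintro ⟨h1, -, h2⟩
    have := hb h1.le
    omega

/-- Consider the row of `k < a i`. The diagonal index gives the type-dependent factor. For `k < l <
a i` only the sum lies outside the Levi. For `l` in block `1` both sum and difference do, and the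
two minus signs cancel in `x_k ^ 2 - x_l ^ 2`. -/
theorem classSAt_of_fixed {i : Q₀} (hi : Q.θ i = i) :
    ∏ k ∈ Finset.range (Q.rk (Q.total a b) i), ∏ l ∈ Finset.range (Q.rk (Q.total a b) i),
      ∏ e, sFactor a b i k l e = Q.classSAt a b i := by
  classical
  have hpos : ¬ Q.pos i := fun hp => Q.pos_ne i hp hi
  have htot : Q.total a b i = a i + a i + b i := by rw [total, hi]
  have hrk : Q.rk (Q.total a b) i = Q.total a b i / 2 := by rw [rk, if_neg hpos, if_pos hi]
  have e1 : (1 : ℤˣ) ≠ -1 := by decide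
  have b0 : ∀ k, k < a i → blk a b i k = 0 := fun k hk => by rw [blk, if_pos hk]
  have b1 : ∀ k, a i ≤ k → k < Q.total a b i / 2 → blk a b i k = 1 := fun k hk hk' => by
    rw [blk, if_neg (by omega), if_pos (by omega)]
  have han : a i ≤ Q.total a b i / 2 := by omega
  set n := Q.total a b i / 2 with hn
  set x := Q.xv (Q.total a b) i with hx
  set g : Q.Poly (Q.total a b) := (if Q.σ i = -1 then -2 else if Odd (Q.total a b i) then -1 else 1)
    with hg
  -- the contribution of one row
  have row : ∀ k ∈ Finset.range (a i), ∏ l ∈ Finset.range n, ∏ e, sFactor a b i k l e =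
      (if Q.σ i = -1 ∨ Odd (Q.total a b i) then g * x k else 1) *
        (∏ l ∈ Finset.Ico (k + 1) (a i), (-x k - x l)) *
        ∏ l ∈ Finset.Ico (a i) n, (x k ^ 2 - x l ^ 2) := by
    intro k hk
    rw [Finset.mem_range] at hk
    rw [← Finset.prod_range_mul_prod_Ico _ han,
      ← Finset.prod_range_mul_prod_Ico _ (show k + 1 ≤ a i by omega), Finset.prod_range_succ,
      Finset.prod_eq_one (s := Finset.range k), one_mul]
    · congr 1
      · congr 1
        · rw [prod_units]
          simp only [sFactor, lt_irrefl, false_and, false_or, e1, e1.symm, true_and, hi, ne_eq,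
            not_true_eq_false, b0 k hk, zero_ne_one, and_false, not_false_eq_true, and_true,
            if_true, if_false, mul_one, hg]
          by_cases h1 : Q.σ i = -1
          · simp only [h1, true_or, if_true]; ring
          · by_cases h2 : Odd (Q.total a b i)
            · simp [h1, h2, hx]
            · simp [h1, h2]
        · refine Finset.prod_congr rfl fun l hl => ?_
          rw [Finset.mem_Ico] at hl
          have hkl : k < l := by omega
          rw [prod_units]
          simp only [sFactor, hkl, hkl.ne, hi, e1, b0 k hk, b0 l hl.2, or_true, true_or,
            ne_eq, not_false_eq_true, zero_ne_one, or_false, if_true, if_false, and_true,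
            not_true_eq_false, and_false, false_and, mul_one]
          simp
          ring
      · refine Finset.prod_congr rfl fun l hl => ?_
        rw [Finset.mem_Ico] at hl
        have hkl : k < l := by omega
        rw [prod_units]
        simp only [sFactor, hkl, hkl.ne, hi, e1, b0 k hk, b1 l hl.1 hl.2, or_true, true_or,
          ne_eq, not_false_eq_true, zero_ne_one, if_true, if_false, and_true, false_and]
        simp
        ring
    · intro l hl
      rw [Finset.mem_range] at hl
      refine Finset.prod_eq_one fun e _ => ?_
      rw [sFactor, if_neg]
      rintro ⟨h | h, -⟩ <;> omega
  -- The remaining rows start in block `1`, where all roots belong to the Levi.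
  have zero : ∀ k ∈ Finset.Ico (a i) n, ∏ l ∈ Finset.range n,
      ∏ e, sFactor (Q := Q) a b i k l e = 1 := by
    intro k hk
    rw [Finset.mem_Ico] at hk
    refine Finset.prod_eq_one fun l hl => Finset.prod_eq_one fun e _ => ?_
    rw [Finset.mem_range] at hl
    rw [sFactor, if_neg]
    rintro ⟨h, -, h'⟩
    have hkl : k ≤ l := by rcases h with h | h <;> omega
    exact h' ⟨by rw [b1 k hk.1 hk.2, b1 l (by omega) hl], Or.inr (b1 k hk.1 hk.2)⟩
  rw [hrk, ← Finset.prod_range_mul_prod_Ico _ han, Finset.prod_congr rfl zero,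
    Finset.prod_const_one, mul_one, Finset.prod_congr rfl row, Finset.prod_mul_distrib,
    Finset.prod_mul_distrib, classSAt, if_neg hpos, if_pos hi]
  congr 2
  rw [hg]
  by_cases h1 : Q.σ i = -1
  · simp only [h1, true_or, if_true, Finset.prod_mul_distrib, Finset.prod_const, Finset.card_range]
    rfl
  · by_cases h2 : Odd (Q.total a b i)
    · simp only [h1, h2, or_true, if_true, if_false, Finset.prod_mul_distrib, Finset.prod_const,
        Finset.card_range]
      rfl
    · simp [h1, h2]

/-- The source of the sign in the theorem: the factors of this class are the negatives of the
positive roots outside the Levi. -/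
theorem classS_eq : Q.classS a b = ∏ t ∈ nilIdx Q a b, -idxPoly t := by
  rw [prod_nilIdx, classS]
  refine Finset.prod_congr rfl fun i _ => ?_
  by_cases h1 : Q.pos i
  · exact (classSAt_of_pos h1).symm
  by_cases h2 : Q.θ i = i
  · exact (classSAt_of_fixed h2).symm
  · rw [classSAt, if_neg h1, if_neg h2, rk, if_neg h1, if_neg h2]
    simp

end

end DualQuiver

end

noncomputable section

theorem smul_natCast_mul {G k : Type*} [Group G] [Field k] [MulSemiringAction G k] (g : G) (n : ℕ)
    (y : k) : g • ((n : k) * y) = n * g • y := by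
  rw [smul_mul']
  congr 1
  exact map_natCast (MulSemiringAction.toRingHom G k g) n

-- Multiplied by the order of `H`, this sum is a sum over all of `G`, which is visibly invariant;
-- then divide.
open Classical in
theorem RootAction.IsLevi.smul_sum_isMin {G R I J k : Type*} [Group G] [MulAction G R]
    {A : RootAction G R I} {H : Subgroup G} {B : RootAction H R J} {ι : J → I}
    (hB : A.IsLevi B ι) [Field k] [CharZero k] [MulSemiringAction G k] [Fintype G] {X : k}
    (hX : ∀ u : H, u • X = X) (g : G) :
    g • ∑ w ∈ Finset.univ.filter (A.IsMin B), w • X =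
      ∑ w ∈ Finset.univ.filter (A.IsMin B), w • X := by
  have h1 := hB.sum_smul_eq X hX
  have h2 : g • ∑ v : G, v • X = ∑ v : G, v • X := by
    rw [Finset.smul_sum]
    exact Fintype.sum_equiv (Equiv.mulLeft g) _ _ fun v => (mul_smul _ _ _).symm
  have h0 : (Fintype.card H : k) ≠ 0 := Nat.cast_ne_zero.2 Fintype.card_ne_zero
  rw [h1, nsmul_eq_mul, smul_natCast_mul] at h2
  exact mul_left_cancel₀ h0 h2

namespace DualQuiver

variable {Q₀ Q₁ : Type*} {Q : DualQuiver Q₀ Q₁} {c : Q₀ → ℕ} {a b : Q₀ → ℕ} [Fintype Q₀]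

/-! ### The shuffle formula for the Demazure operator -/

instance weylFintype : Fintype (Q.weyl c) := by
  classical exact Fintype.ofFinite _

variable (Q a b) in
open Classical in
/-- The minimal length representatives as elements of the Weyl group. -/
def minSet : Finset (Q.weyl (Q.total a b)) :=
  Finset.univ.filter ((weylAction Q (Q.total a b)).IsMin (leviAction Q a b))

theorem mem_minSet (w : Q.weyl (Q.total a b)) : w ∈ minSet Q a b ↔ w.1 ∈ Q.minReps a b := by
  simp [minSet, mem_minReps_iff]

open Classical in
theorem prod_rootInv_eq :
    ∏ z ∈ (weylAction Q (Q.total a b)).posSet \ (leviAction Q a b).posSet, rootInv z =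
      (-1) ^ Q.codimRoots a b *
        (algebraMap (Q.Poly (Q.total a b)) (Q.K (Q.total a b)) (Q.classS a b))⁻¹ := by
  rw [prod_rootInv, classS_eq, codimRoots_eq, Finset.prod_neg, map_mul, mul_inv, map_pow,
    map_neg, map_one, ← inv_pow, inv_neg_one, ← mul_assoc, ← mul_pow, neg_one_mul, neg_neg, one_pow,
    one_mul, map_prod, Finset.prod_inv_distrib]

theorem rootInv_ne_zero_of_mem {z : Sym2 (Q.SVar c)} (hz : z ∈ (weylAction Q c).Φ) :
    rootInv z ≠ 0 := by
  induction z with | _ p r => ?_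
  exact rootInv_ne_zero ((mem_rootSys _ p r).1 hz).1.2.1

theorem smul_of_isLeviInv {f : Q.Poly (Q.total a b)} (hf : Q.IsLeviInv a b f) (u : levi Q a b) :
    u • algebraMap (Q.Poly (Q.total a b)) (Q.K (Q.total a b)) f =
      algebraMap (Q.Poly (Q.total a b)) (Q.K (Q.total a b)) f := by
  rw [Subgroup.smul_def, smul_algebraMap_poly]
  exact congrArg _ (hf u.1.1 u.2)

open Classical in
theorem shuffle_eq (f S : Q.Poly (Q.total a b)) :
    Q.shuffle a b f S = ∑ w ∈ minSet Q a b,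
      w • (algebraMap (Q.Poly (Q.total a b)) (Q.K (Q.total a b)) f /
        algebraMap (Q.Poly (Q.total a b)) (Q.K (Q.total a b)) S) := by
  rw [shuffle]
  symm
  refine Finset.sum_bij (fun w _ => w.1) ?_ ?_ ?_ ?_
  · intro w hw
    simpa [mem_minSet] using hw
  · intro w _ w' _ h
    exact Subtype.ext h
  · intro w hw
    have hw' : w ∈ Q.minReps a b := by simpa using hw
    exact ⟨⟨w, hw'.1⟩, by simpa [mem_minSet] using hw', rfl⟩
  · intro w _
    rw [smul_div₀', smul_algebraMap_poly, smul_algebraMap_poly]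

theorem isInv_of_sum {X : Q.K (Q.total a b)} (hX : ∀ u : levi Q a b, u • X = X)
    {f : Q.Poly (Q.total a b)} (hf : algebraMap (Q.Poly (Q.total a b)) (Q.K (Q.total a b)) f =
      ∑ w ∈ minSet Q a b, w • X) :
    Q.IsInv (Q.total a b) f := by
  intro w hw
  apply IsFractionRing.injective (Q.Poly (Q.total a b)) (Q.K (Q.total a b))
  rw [← smul_algebraMap_poly ⟨w, hw⟩, hf]
  exact (isLevi Q a b).smul_sum_isMin hX ⟨w, hw⟩

/-- The coset sum of `foldr_dem_eq` has the inverse roots in place of `1 / S`. The two differ by the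
sign of `prod_rootInv_eq`, which is fixed by the group and is its own inverse. -/
theorem demazure_shuffle {w : Q.SPerm (Q.total a b)}
    (hw : Q.IsLongestRep a b w) {L : List (Q.Gen (Q.total a b))} (hL : IsReducedWord L w)
    {f : Q.Poly (Q.total a b)} (hf : Q.IsLeviInv a b f) :
    Q.IsInv (Q.total a b) (demazure L f) ∧ Q.shuffle a b f (Q.classS a b) =
      (-1) ^ Q.codimRoots a b * algebraMap (Q.Poly (Q.total a b)) (Q.K (Q.total a b)) (demazure L f) := by
  classical
  obtain ⟨hw1, hw2⟩ := hw
  lift w to Q.weyl (Q.total a b) using hw1.1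
  obtain ⟨h1, h2⟩ := (isReducedWord_iff L w).1 hL
  obtain ⟨h3, h4⟩ := (isLevi Q a b).foldr_dem_eq (rankTwo Q (Q.total a b)) smul_rootInv
    (fun z => rootInv_ne_zero_of_mem) ((mem_minReps_iff w).1 hw1)
    (fun v hv => by
      rw [← len_eq, ← len_eq]
      exact hw2 v.1 ((mem_minReps_iff v).2 hv)) L h1 h2 (algebraMap _ _ f) (smul_of_isLeviInv hf)
  rw [← algebraMap_demazure] at h4
  generalize hP : ∏ z ∈ _, rootInv z = P at h3 h4
  replace hP : P = (-1) ^ Q.codimRoots a b *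
      (algebraMap (Q.Poly (Q.total a b)) (Q.K (Q.total a b)) (Q.classS a b))⁻¹ := by
    rw [← hP, ← prod_rootInv_eq]
    congr
    exact Subsingleton.elim _ _
  refine ⟨isInv_of_sum h3 ?_, ?_⟩
  · rw [h4]; rfl
  · rw [shuffle_eq, h4, Finset.mul_sum, minSet]
    refine Finset.sum_congr rfl fun v _ => ?_
    rw [hP, mul_left_comm, smul_mul', ← mul_assoc]
    have : v • ((-1 : Q.K (Q.total a b)) ^ Q.codimRoots a b) = (-1) ^ Q.codimRoots a b := by
      rw [smul_pow', smul_neg, smul_one]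
    rw [this, ← mul_pow, neg_one_mul, neg_neg, one_pow, one_mul, div_eq_mul_inv]

theorem existsUnique_longestRep : ∃! w, Q.IsLongestRep a b w := by
  obtain ⟨w, h1, h2, h3, -⟩ := (isLevi Q a b).exists_longest_isMin
  refine ⟨w.1, ⟨(mem_minReps_iff w).2 h1, fun u hu => ?_⟩, fun v hv => ?_⟩
  · lift u to Q.weyl (Q.total a b) using hu.1
    rw [len_eq, len_eq]
    exact h2 u ((mem_minReps_iff u).1 hu)
  · obtain ⟨hv1, hv2⟩ := hv
    lift v to Q.weyl (Q.total a b) using hv1.1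
    refine congrArg Subtype.val (h3 v ((mem_minReps_iff v).1 hv1) ?_)
    rw [← len_eq, ← len_eq]
    exact hv2 w.1 ((mem_minReps_iff w).2 h1)

theorem exists_reducedWord {w : Q.SPerm c} (hw : w ∈ Q.weyl c) :
    ∃ L : List (Q.Gen c), IsReducedWord L w := by
  obtain ⟨L, h⟩ := (weylAction Q c).exists_word ⟨w, hw⟩
  exact ⟨L, (isReducedWord_iff L ⟨w, hw⟩).2 h⟩

end DualQuiver

end

noncomputable section

namespace DualQuiver

variable {Q₀ Q₁ : Type*} {Q : DualQuiver Q₀ Q₁} {c : Q₀ → ℕ}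

/-! ### The basis of `V_c` -/

theorem bas_ext {p q : Bas c} (h : p.1 = q.1) (h' : p.2.val = q.2.val) : p = q := by
  obtain ⟨i, k⟩ := p
  obtain ⟨j, l⟩ := q
  obtain rfl : i = j := h
  obtain rfl : k = l := Fin.ext h'
  rfl

/-- The basis vector dual to a given one. -/
def dual (hc : ∀ i, c (Q.θ i) = c i) (q : Bas c) : Bas c :=
  ⟨Q.θ q.1, ⟨c q.1 - 1 - q.2, by have := q.2.isLt; rw [hc]; omega⟩⟩

theorem isDual_iff (hc : ∀ i, c (Q.θ i) = c i) (p q : Bas c) : Q.IsDual c p q ↔ q = dual hc p := by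
  have := p.2.isLt
  constructor
  · rintro ⟨h1, h2⟩
    exact bas_ext h1 (by simp only [dual]; omega)
  · rintro rfl
    exact ⟨rfl, by simp only [dual]; omega⟩

@[simp] theorem dual_dual (hc : ∀ i, c (Q.θ i) = c i) (q : Bas c) : dual hc (dual hc q) = q := by
  have := q.2.isLt
  refine bas_ext (Q.θ_θ _) ?_
  simp only [dual, hc]
  omega

theorem dual_injective (hc : ∀ i, c (Q.θ i) = c i) : Function.Injective (dual (Q := Q) hc) :=
  Function.LeftInverse.injective (dual_dual hc)

theorem rk_le (i : Q₀) : Q.rk c i ≤ c i := by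
  rw [rk]; split_ifs <;> omega

/-- The basis vector whose weight is a given signed variable. -/
def bas (hc : ∀ i, c (Q.θ i) = c i) (p : Q.SVar c) : Bas c :=
  if p.2 = 1 then ⟨p.1.1, Fin.castLE (rk_le _) p.1.2⟩
  else dual hc ⟨p.1.1, Fin.castLE (rk_le _) p.1.2⟩

theorem bas_one (hc : ∀ i, c (Q.θ i) = c i) (v : Q.Var c) :
    bas hc (v, 1) = ⟨v.1, Fin.castLE (rk_le _) v.2⟩ := if_pos rfl

theorem bas_svNeg (hc : ∀ i, c (Q.θ i) = c i) (p : Q.SVar c) : bas hc (svNeg p) = dual hc (bas hc p) := by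
  obtain ⟨v, e⟩ := p
  rcases Int.units_eq_one_or e with rfl | rfl <;> simp [svNeg, bas]

theorem bas_neg_one (hc : ∀ i, c (Q.θ i) = c i) (v : Q.Var c) :
    bas hc (v, -1) = dual hc (bas hc (v, 1)) := bas_svNeg hc (v, 1)

/-- The basis vector is self-dual, of weight `0`. -/
def IsMid (Q : DualQuiver Q₀ Q₁) (q : Bas c) : Prop := Q.θ q.1 = q.1 ∧ 2 * q.2.val + 1 = c q.1

theorem isMid_iff (hc : ∀ i, c (Q.θ i) = c i) (q : Bas c) : IsMid Q q ↔ dual hc q = q := by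
  have := q.2.isLt
  constructor
  · rintro ⟨h1, h2⟩
    exact bas_ext h1 (by simp only [dual]; omega)
  · intro h
    have h1 := congrArg Sigma.fst h
    have h2 : (dual hc q).2.val = q.2.val := by rw [h]
    exact ⟨h1, by simp only [dual] at h2; omega⟩

theorem rk_pos {i : Q₀} (h : Q.pos i) : Q.rk c i = c i := by rw [rk, if_pos h]

theorem not_pos_of_fixed {i : Q₀} (h : Q.θ i = i) : ¬ Q.pos i := fun hp => Q.pos_ne i hp h

theorem rk_fixed {i : Q₀} (h : Q.θ i = i) : Q.rk c i = c i / 2 := by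
  rw [rk, if_neg (not_pos_of_fixed h), if_pos h]

theorem pos_or_fixed (v : Q.Var c) : Q.pos v.1 ∨ Q.θ v.1 = v.1 := by
  by_contra! h
  have := v.2.isLt
  simp [rk, h.1, h.2] at this

theorem pos_of_neg {i : Q₀} (h : ¬ Q.pos i) (h' : Q.θ i ≠ i) : Q.pos (Q.θ i) := by
  by_contra h2
  exact h ((Q.pos_iff i h').2 h2)

theorem bas_not_isMid (hc : ∀ i, c (Q.θ i) = c i) (p : Q.SVar c) : ¬ IsMid Q (bas hc p) := by
  have key : ∀ v : Q.Var c, ¬ IsMid Q (bas hc (v, 1)) := by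
    intro v ⟨h1, h2⟩
    rw [bas_one] at h1 h2
    have := v.2.isLt
    have h3 := rk_fixed (c := c) h1
    simp only [Fin.val_castLE] at h1 h2 h3
    omega
  obtain ⟨v, e⟩ := p
  rcases Int.units_eq_one_or e with rfl | rfl
  · exact key v
  · rw [isMid_iff hc, bas_neg_one, dual_dual, eq_comm, ← isMid_iff hc]
    exact key v

theorem bas_cases (hc : ∀ i, c (Q.θ i) = c i) (q : Bas c) : (∃ p, q = bas hc p) ∨ IsMid Q q := by
  have hq := q.2.isLt
  have key : ∀ q : Bas c, q.2.val < Q.rk c q.1 → ∃ p, q = bas hc p := by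
    intro q h
    exact ⟨(⟨q.1, ⟨q.2, h⟩⟩, 1), by rw [bas_one]; rfl⟩
  have key' : ∀ q : Bas c, (dual hc q).2.val < Q.rk c (dual hc q).1 → ∃ p, q = bas hc p := by
    intro q h
    obtain ⟨p, hp⟩ := key _ h
    exact ⟨svNeg p, by rw [bas_svNeg, ← hp, dual_dual]⟩
  by_cases h1 : Q.pos q.1
  · exact Or.inl (key q (by rw [rk_pos h1]; exact hq))
  by_cases h2 : Q.θ q.1 = q.1
  · rcases lt_trichotomy (2 * q.2.val + 1) (c q.1) with h | h | h
    · exact Or.inl (key q (by rw [rk_fixed h2]; omega))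
    · exact Or.inr ⟨h2, h⟩
    · refine Or.inl (key' q ?_)
      simp only [dual]
      rw [rk_fixed (by rw [h2, h2]), hc]
      omega
  · refine Or.inl (key' q ?_)
    simp only [dual]
    rw [rk_pos (pos_of_neg h1 h2), hc]
    omega

/-- A variable and a negated variable cannot give the same vector. Negatives of variables at `i` in
`Q₀⁺` live at `θ i`, which carries no variables; at a fixed vertex they occupy the second half of
the basis. -/
theorem bas_injective (hc : ∀ i, c (Q.θ i) = c i) : Function.Injective (bas (Q := Q) hc) := by
  have key1 : ∀ v u : Q.Var c, bas hc (v, 1) = bas hc (u, 1) → v = u := by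
    intro v u h
    rw [bas_one, bas_one] at h
    obtain ⟨i, k⟩ := v
    obtain ⟨j, l⟩ := u
    obtain ⟨rfl, h⟩ := Sigma.mk.inj_iff.1 h
    have := congrArg Fin.val (eq_of_heq h)
    exact var_ext rfl (by simpa using this)
  have key2 : ∀ v u : Q.Var c, bas hc (v, 1) ≠ bas hc (u, -1) := by
    intro v u h
    rw [bas_neg_one, bas_one, bas_one] at h
    have h1 : v.1 = Q.θ u.1 := congrArg Sigma.fst h
    have h2 : v.2.val = c u.1 - 1 - u.2.val := congrArg (fun q : Bas c => q.2.val) h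
    have hv := v.2.isLt
    have hu := u.2.isLt
    rcases pos_or_fixed u with h3 | h3
    · have h4 : Q.θ u.1 ≠ u.1 := Q.pos_ne _ h3
      have h5 := (Q.pos_iff _ h4).1 h3
      rcases pos_or_fixed v with h6 | h6
      · rw [h1] at h6; exact h5 h6
      · rw [h1, Q.θ_θ] at h6; exact h4 h6.symm
    · have h4 : v.1 = u.1 := by rw [h1, h3]
      have h5 := rk_congr h4
      have h6 := rk_fixed (c := c) h3
      omega
  rintro ⟨v, e⟩ ⟨u, e'⟩ h
  rcases Int.units_eq_one_or e with rfl | rfl <;> rcases Int.units_eq_one_or e' with rfl | rfl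
  · rw [key1 v u h]
  · exact absurd h (key2 v u)
  · exact absurd h.symm (key2 u v)
  · rw [bas_neg_one, bas_neg_one] at h
    rw [key1 v u (dual_injective hc h)]

/-- Makes the torus weights equivariant under the Weyl group, since they become signed variables or,
on self-dual vectors, zero. -/
theorem wt_bas (hc : ∀ i, c (Q.θ i) = c i) (p : Q.SVar c) :
    Q.wt c (bas hc p).1 (bas hc p).2 = polyLin p := by
  have key : ∀ v : Q.Var c, Q.wt c (bas hc (v, 1)).1 (bas hc (v, 1)).2 = polyLin (v, 1) := by
    intro v
    rw [bas_one, polyLin_one]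
    have hv := v.2.isLt
    simp only [wt, Fin.val_castLE]
    rcases pos_or_fixed v with h | h
    · rw [if_pos h, xv_of_lt v.1 hv]
    · rw [if_neg (not_pos_of_fixed h), if_pos h, if_pos, xv_of_lt v.1 hv]
      have := rk_fixed (c := c) h
      omega
  obtain ⟨v, e⟩ := p
  rcases Int.units_eq_one_or e with rfl | rfl
  · exact key v
  · have h1 := polyLin_svNeg (v, (1 : ℤˣ))
    have h2 := Q.wt_add_wt c hc _ _ ((isDual_iff hc (bas hc (v, 1)) _).2 rfl)
    rw [key, ← bas_neg_one] at h2
    rw [show svNeg (v, (1 : ℤˣ)) = (v, -1) from rfl] at h1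
    rw [h1]
    exact eq_neg_of_add_eq_zero_right h2

theorem wt_mid {q : Bas c} (h : IsMid Q q) : Q.wt c q.1 q.2 = 0 := by
  rw [wt, if_neg (not_pos_of_fixed h.1), if_pos h.1, if_neg (by have := h.2; omega), if_pos h.2]

/-! ### The action of the Weyl group on the basis of `V_c` -/

/-- The permutation of the basis of `V_c` given by an element of the Weyl group. -/
def basMap (hc : ∀ i, c (Q.θ i) = c i) (w : Q.weyl c) : Bas c → Bas c :=
  Function.extend (bas hc) (fun p => bas hc (w.1 p)) id

theorem basMap_bas (hc : ∀ i, c (Q.θ i) = c i) (w : Q.weyl c) (p : Q.SVar c) :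
    basMap hc w (bas hc p) = bas hc (w.1 p) := (bas_injective hc).extend_apply _ _ _

theorem basMap_mid (hc : ∀ i, c (Q.θ i) = c i) (w : Q.weyl c) {q : Bas c} (h : IsMid Q q) :
    basMap hc w q = q :=
  Function.extend_apply' _ _ _ fun ⟨p, hp⟩ => bas_not_isMid hc p (hp ▸ h)

theorem basMap_one (hc : ∀ i, c (Q.θ i) = c i) (q : Bas c) : basMap hc (1 : Q.weyl c) q = q := by
  rcases bas_cases hc q with ⟨p, rfl⟩ | h
  · rw [basMap_bas]; rfl
  · exact basMap_mid hc _ h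

theorem basMap_mul (hc : ∀ i, c (Q.θ i) = c i) (w w' : Q.weyl c) (q : Bas c) :
    basMap hc (w * w') q = basMap hc w (basMap hc w' q) := by
  rcases bas_cases hc q with ⟨p, rfl⟩ | h
  · rw [basMap_bas, basMap_bas, basMap_bas]; rfl
  · rw [basMap_mid hc _ h, basMap_mid hc _ h, basMap_mid hc _ h]

/-- The action of the Weyl group on the basis of `V_c`. -/
def basHom (hc : ∀ i, c (Q.θ i) = c i) : Q.weyl c →* Equiv.Perm (Bas c) where
  toFun w :=
    { toFun := basMap hc w
      invFun := basMap hc w⁻¹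
      left_inv := fun q => by rw [← basMap_mul, inv_mul_cancel, basMap_one]
      right_inv := fun q => by rw [← basMap_mul, mul_inv_cancel, basMap_one] }
  map_one' := Equiv.ext (basMap_one hc)
  map_mul' w w' := Equiv.ext (basMap_mul hc w w')

theorem basHom_bas (hc : ∀ i, c (Q.θ i) = c i) (w : Q.weyl c) (p : Q.SVar c) :
    basHom hc w (bas hc p) = bas hc (w.1 p) := basMap_bas hc w p

theorem basHom_mid (hc : ∀ i, c (Q.θ i) = c i) (w : Q.weyl c) {q : Bas c} (h : IsMid Q q) :
    basHom hc w q = q := basMap_mid hc w h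

theorem bas_vertex (hc : ∀ i, c (Q.θ i) = c i) (p : Q.SVar c) :
    (bas hc p).1 = if p.2 = 1 then p.1.1 else Q.θ p.1.1 := by
  rw [bas]; split_ifs <;> rfl

theorem basHom_vertex (hc : ∀ i, c (Q.θ i) = c i) (w : Q.weyl c) (q : Bas c) :
    (basHom hc w q).1 = q.1 := by
  rcases bas_cases hc q with ⟨p, rfl⟩ | h
  · rw [basHom_bas, bas_vertex, bas_vertex, weyl_vertex w.2]
    by_cases hf : Q.θ p.1.1 = p.1.1
    · rw [hf, ite_self, ite_self]
    · rw [weyl_pos w.2 hf]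
  · rw [basHom_mid hc w h]

theorem basHom_dual (hc : ∀ i, c (Q.θ i) = c i) (w : Q.weyl c) (q : Bas c) :
    basHom hc w (dual hc q) = dual hc (basHom hc w q) := by
  rcases bas_cases hc q with ⟨p, rfl⟩ | h
  · rw [← bas_svNeg, basHom_bas, basHom_bas, weyl_svNeg w.2, bas_svNeg]
  · rw [basHom_mid hc w h, (isMid_iff hc q).1 h, basHom_mid hc w h]

theorem actPoly_wt (hc : ∀ i, c (Q.θ i) = c i) (w : Q.weyl c) (q : Bas c) :
    actPoly w.1 (Q.wt c q.1 q.2) = Q.wt c (basHom hc w q).1 (basHom hc w q).2 := by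
  rcases bas_cases hc q with ⟨p, rfl⟩ | h
  · rw [basHom_bas, wt_bas, wt_bas, actPoly_polyLin w.2]
  · rw [basHom_mid hc w h, wt_mid h, map_zero]

/-- A permutation of the basis of `V_c` that is compatible with the grading and the duality comes
from the Weyl group. -/
theorem exists_basHom_eq (hc : ∀ i, c (Q.θ i) = c i) (β : Equiv.Perm (Bas c))
    (hv : ∀ q, (β q).1 = q.1) (hd : ∀ q, β (dual hc q) = dual hc (β q)) :
    ∃ w : Q.weyl c, basHom hc w = β := by
  -- Compatibility with duality preserves the self-dual vectors, so `β` restricts to a permutation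
  -- of the vectors that come from signed variables.
  have hmid : ∀ q, IsMid Q (β q) ↔ IsMid Q q := fun q => by
    rw [isMid_iff hc, isMid_iff hc, ← hd, β.apply_eq_iff_eq]
  have h1 : ∀ p : Q.SVar c, ∃ r : Q.SVar c, bas hc r = β (bas hc p) := fun p => by
    rcases bas_cases hc (β (bas hc p)) with ⟨r, hr⟩ | h
    · exact ⟨r, hr.symm⟩
    · exact absurd ((hmid _).1 h) (bas_not_isMid hc p)
  have h2 : ∀ p : Q.SVar c, ∃ r : Q.SVar c, bas hc r = β.symm (bas hc p) := fun p => by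
    rcases bas_cases hc (β.symm (bas hc p)) with ⟨r, hr⟩ | h
    · exact ⟨r, hr.symm⟩
    · rw [← hmid, Equiv.apply_symm_apply] at h
      exact absurd h (bas_not_isMid hc p)
  choose f hf using h1
  choose g hg using h2
  let w : Q.SPerm c :=
    { toFun := f
      invFun := g
      left_inv := fun p => bas_injective hc (by rw [hg, hf, Equiv.symm_apply_apply])
      right_inv := fun p => bas_injective hc (by rw [hf, hg, Equiv.apply_symm_apply]) }
  -- The vector of a negated variable lies at the image of the vertex under `θ`. A change of sign
  -- that respects the grading therefore forces the vertex to be fixed, as `θ` maps `Q₀⁺` outside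
  -- `Q₀⁺`.
  have hfv : ∀ p, (f p).1.1 = p.1.1 ∧ (Q.θ p.1.1 ≠ p.1.1 → (f p).2 = p.2) := by
    intro p
    have h := congrArg Sigma.fst (hf p)
    rw [hv, bas_vertex, bas_vertex] at h
    have hp := pos_or_fixed p.1
    have hfp := pos_or_fixed (f p).1
    rcases Int.units_eq_one_or p.2 with e | e <;> rcases Int.units_eq_one_or (f p).2 with e' | e' <;>
      simp only [e, e', if_true, if_false, show (-1 : ℤˣ) ≠ 1 by decide] at h
    · exact ⟨h, fun _ => by rw [e, e']⟩
    · have h3 : Q.θ p.1.1 = (f p).1.1 := by rw [← h, Q.θ_θ]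
      by_cases hx : Q.θ p.1.1 = p.1.1
      · exact ⟨by rw [← h3, hx], fun hn => absurd hx hn⟩
      · have h4 := hp.resolve_right hx
        have h5 := (Q.pos_iff _ hx).1 h4
        rw [h3] at h5
        rw [h, ← h3] at hfp
        rw [← h3] at h5
        rcases hfp with h6 | h6
        · exact absurd h6 h5
        · exact absurd h6.symm hx
    · by_cases hx : Q.θ p.1.1 = p.1.1
      · exact ⟨by rw [h, hx], fun hn => absurd hx hn⟩
      · have h4 := hp.resolve_right hx
        have h5 := (Q.pos_iff _ hx).1 h4
        rw [h, Q.θ_θ] at hfp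
        rcases hfp with h6 | h6
        · exact absurd h6 h5
        · exact absurd h6.symm hx
    · have := congrArg Q.θ h
      rw [Q.θ_θ, Q.θ_θ] at this
      exact ⟨this, fun _ => by rw [e, e']⟩
  have hneg : ∀ p, f (svNeg p) = svNeg (f p) := fun p =>
    bas_injective hc (by rw [hf, bas_svNeg, bas_svNeg, hf, hd])
  have hw : w ∈ Q.weyl c := ⟨fun v e => hneg (v, e), fun p => (hfv p).1, fun p hp =>
    (hfv p).2 (Q.pos_ne _ hp)⟩
  refine ⟨⟨w, hw⟩, Equiv.ext fun q => ?_⟩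
  rcases bas_cases hc q with ⟨p, rfl⟩ | h
  · rw [basHom_bas]
    exact hf p
  · rw [basHom_mid hc _ h]
    rcases bas_cases hc (β q) with ⟨p, hp⟩ | h'
    · exact absurd (hp ▸ (hmid q).2 h) (bas_not_isMid hc p)
    -- A vertex has at most one self-dual basis vector.
    · refine (bas_ext (hv q) ?_).symm
      have h3 := h.2
      have h4 := h'.2
      have h5 : c (β q).1 = c q.1 := by rw [hv]
      omega

end DualQuiver

end

noncomputable section

namespace DualQuiver

variable {Q₀ Q₁ : Type*} {Q : DualQuiver Q₀ Q₁} {c : Q₀ → ℕ} {a b : Q₀ → ℕ} [Fintype Q₀]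

/-! ### Flags -/

theorem blk_dual (hb : Q.IsSelfDual b) (q : Bas (Q.total a b)) :
    blk a b (dual (Q.total_θ hb) q).1 (dual (Q.total_θ hb) q).2 = 2 - blk a b q.1 q.2 := by
  have h1 := q.2.isLt
  have h2 : Q.total a b q.1 = a q.1 + a (Q.θ q.1) + b q.1 := rfl
  have h3 := hb.1 q.1
  change blk a b (Q.θ q.1) (Q.total a b q.1 - 1 - q.2.val) = _
  rw [blk, blk]
  split_ifs <;> omega

theorem blk_le (i : Q₀) (k : ℕ) : blk a b i k ≤ 2 := by
  rw [blk]; split_ifs <;> omega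

theorem blk_bas_one (hb : Q.IsSelfDual b) (v : Q.Var (Q.total a b)) :
    blk a b (bas (Q.total_θ hb) (v, 1)).1 (bas (Q.total_θ hb) (v, 1)).2 = blk a b v.1 v.2 := by
  rw [bas_one]; rfl

theorem blk_bas_neg_one (hb : Q.IsSelfDual b) (v : Q.Var (Q.total a b)) :
    blk a b (bas (Q.total_θ hb) (v, -1)).1 (bas (Q.total_θ hb) (v, -1)).2 =
      2 - blk a b v.1 v.2 := by
  rw [bas_neg_one, blk_dual hb, blk_bas_one hb]

theorem blk_var_le (v : Q.Var (Q.total a b)) (h : Q.θ v.1 = v.1) : blk a b v.1 v.2 ≤ 1 :=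
  isBlocks_vblk.fixed v h

theorem blk_basHom_of_mem (hb : Q.IsSelfDual b) {w : Q.weyl (Q.total a b)}
    (hw : w.1 ∈ Q.weylLevi a b) (q : Bas (Q.total a b)) :
    blk a b (basHom (Q.total_θ hb) w q).1 (basHom (Q.total_θ hb) w q).2 = blk a b q.1 q.2 := by
  have key : ∀ v : Q.Var (Q.total a b), blk a b (bas (Q.total_θ hb) (w.1 (v, 1))).1
      (bas (Q.total_θ hb) (w.1 (v, 1))).2 = blk a b v.1 v.2 := by
    intro v
    have h1 := hw.2.1 (v, 1)
    obtain ⟨u, e, hu⟩ : ∃ u e, w.1 (v, 1) = (u, e) := ⟨_, _, rfl⟩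
    have h2 := hw.2.2 (v, 1)
    have h3 := weyl_vertex w.2 (v, 1)
    have h4 := weyl_pos w.2 (p := (v, 1))
    rw [hu] at h1 h2 h3 h4 ⊢
    simp only at h1 h2 h3 h4
    rcases Int.units_eq_one_or e with rfl | rfl
    · rw [blk_bas_one hb, h1]
    -- The Levi changes signs only in block `1`, which duality, taking block `s` to `2 - s`, sends
    -- to itself.
    · have h5 : blk a b v.1 v.2 ≠ 0 := fun h => absurd (h2 h) (by decide)
      have h6 : Q.θ v.1 = v.1 := by
        by_contra h
        exact absurd (h4 h) (by decide)
      have h7 := blk_var_le v h6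
      rw [blk_bas_neg_one hb, h1]
      omega
  rcases bas_cases (Q.total_θ hb) q with ⟨⟨v, e⟩, rfl⟩ | h
  · rw [basHom_bas]
    rcases Int.units_eq_one_or e with rfl | rfl
    · rw [key, blk_bas_one hb]
    · rw [show ((v, -1) : Q.SVar _) = svNeg (v, 1) from rfl, weyl_svNeg w.2, bas_svNeg, blk_dual hb,
        key, bas_svNeg, blk_dual hb, blk_bas_one hb]
  · rw [basHom_mid _ w h]

/-- With `blk_basHom_of_mem`: the parabolic subgroup is the stabilizer of the standard flag. A
change of sign that respects the blocks of the basis must happen in block `1`. -/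
theorem mem_of_blk_basHom (hb : Q.IsSelfDual b) {w : Q.weyl (Q.total a b)}
    (hw : ∀ q : Bas (Q.total a b), blk a b (basHom (Q.total_θ hb) w q).1
      (basHom (Q.total_θ hb) w q).2 = blk a b q.1 q.2) : w.1 ∈ Q.weylLevi a b := by
  have key : ∀ v : Q.Var (Q.total a b), blk a b (w.1 (v, 1)).1.1 (w.1 (v, 1)).1.2 =
      blk a b v.1 v.2 ∧ (blk a b v.1 v.2 = 0 → (w.1 (v, 1)).2 = 1) := by
    intro v
    obtain ⟨u, e, hu⟩ : ∃ u e, w.1 (v, 1) = (u, e) := ⟨_, _, rfl⟩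
    have h1 := hw (bas (Q.total_θ hb) (v, 1))
    have h3 := weyl_vertex w.2 (v, 1)
    have h4 := weyl_pos w.2 (p := (v, 1))
    rw [basHom_bas, blk_bas_one hb] at h1
    rw [hu] at h1 h3 h4 ⊢
    simp only at h1 h3 h4 ⊢
    rcases Int.units_eq_one_or e with rfl | rfl
    · rw [blk_bas_one hb] at h1
      exact ⟨h1, fun _ => rfl⟩
    · have h6 : Q.θ v.1 = v.1 := by
        by_contra h
        exact absurd (h4 h) (by decide)
      have h7 := blk_var_le v h6
      have h8 := blk_var_le u (by rw [h3, h6])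
      rw [blk_bas_neg_one hb] at h1
      exact ⟨by omega, fun h => by omega⟩
  refine ⟨w.2, fun ⟨v, e⟩ => ?_, fun ⟨v, e⟩ h => ?_⟩
  · rcases Int.units_eq_one_or e with rfl | rfl
    · exact (key v).1
    · rw [show ((v, -1) : Q.SVar _) = svNeg (v, 1) from rfl, weyl_svNeg w.2]
      exact (key v).1
  · rcases Int.units_eq_one_or e with rfl | rfl
    · exact (key v).2 h
    · rw [show ((v, -1) : Q.SVar _) = svNeg (v, 1) from rfl, weyl_svNeg w.2]
      exact congrArg Neg.neg ((key v).2 h)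

theorem step_eq_zero_iff {I : Finset (Bas c)} {q : Bas c} : Q.step I q = 0 ↔ q ∈ I := by
  rw [step]; split_ifs <;> simp_all

theorem exists_isDual_iff (hc : ∀ i, c (Q.θ i) = c i) {I : Finset (Bas c)} {q : Bas c} :
    (∃ p ∈ I, Q.IsDual c p q) ↔ dual hc q ∈ I := by
  constructor
  · rintro ⟨p, hp, h⟩
    rw [(isDual_iff hc p q).1 h, dual_dual]
    exact hp
  · intro h
    exact ⟨_, h, (isDual_iff hc _ _).2 (dual_dual hc q).symm⟩

open Classical in
theorem step_eq (hc : ∀ i, c (Q.θ i) = c i) (I : Finset (Bas c)) (q : Bas c) :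
    Q.step I q = if q ∈ I then 0 else if dual hc q ∈ I then 2 else 1 := by
  rw [step]
  simp only [exists_isDual_iff hc]

theorem step_le (I : Finset (Bas c)) (q : Bas c) : Q.step I q ≤ 2 := by
  rw [step]; split_ifs <;> omega

theorem step_map (hc : ∀ i, c (Q.θ i) = c i) (w : Q.weyl c) (I : Finset (Bas c)) (q : Bas c) :
    Q.step (I.map (basHom hc w).toEmbedding) (basHom hc w q) = Q.step I q := by
  classical
  have h : ∀ q, basHom hc w q ∈ I.map (basHom hc w).toEmbedding ↔ q ∈ I := fun q =>
    Finset.mem_map' (basHom hc w).toEmbedding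
  rw [step_eq hc, step_eq hc, ← basHom_dual]
  simp only [h]

variable (Q a b) in
open Classical in
/-- The basis of the standard isotropic subspace of dimension `a`. -/
def stdFlag : Finset (Bas (Q.total a b)) := Finset.univ.filter fun q => blk a b q.1 q.2 = 0

theorem mem_stdFlag (q : Bas (Q.total a b)) : q ∈ stdFlag Q a b ↔ blk a b q.1 q.2 = 0 := by
  simp [stdFlag]

theorem step_stdFlag (hb : Q.IsSelfDual b) (q : Bas (Q.total a b)) :
    Q.step (stdFlag Q a b) q = blk a b q.1 q.2 := by
  rw [step_eq (Q.total_θ hb)]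
  simp only [mem_stdFlag, blk_dual hb]
  have := blk_le (a := a) (b := b) q.1 q.2
  split_ifs <;> omega

/-- The image of the standard flag under an element of the Weyl group. -/
def flag (hb : Q.IsSelfDual b) (w : Q.weyl (Q.total a b)) : Finset (Bas (Q.total a b)) :=
  (stdFlag Q a b).map (basHom (Q.total_θ hb) w).toEmbedding

theorem step_flag (hb : Q.IsSelfDual b) (w : Q.weyl (Q.total a b)) (q : Bas (Q.total a b)) :
    Q.step (flag hb w) (basHom (Q.total_θ hb) w q) = blk a b q.1 q.2 := by
  rw [flag, step_map, step_stdFlag hb]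

theorem mem_flag (hb : Q.IsSelfDual b) (w : Q.weyl (Q.total a b)) (q : Bas (Q.total a b)) :
    basHom (Q.total_θ hb) w q ∈ flag hb w ↔ blk a b q.1 q.2 = 0 := by
  rw [← step_eq_zero_iff (Q := Q), step_flag]

/-- Orbit and stabilizer: the flags in the orbit of the standard one correspond to cosets of the
parabolic subgroup. -/
theorem flag_eq_iff (hb : Q.IsSelfDual b) (w w' : Q.weyl (Q.total a b)) :
    flag hb w = flag hb w' ↔ (w'⁻¹ * w).1 ∈ Q.weylLevi a b := by
  have e : ∀ q, basHom (Q.total_θ hb) w' (basHom (Q.total_θ hb) (w'⁻¹ * w) q) =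
      basHom (Q.total_θ hb) w q := fun q => by
    rw [← Equiv.Perm.mul_apply, ← map_mul, mul_inv_cancel_left]
  constructor
  · intro h
    refine mem_of_blk_basHom hb fun q => ?_
    rw [← step_flag hb w', e, ← h, step_flag]
  · intro h
    ext q
    obtain ⟨q, rfl⟩ := (basHom (Q.total_θ hb) w).surjective q
    rw [mem_flag hb, ← e, mem_flag hb, blk_basHom_of_mem hb h]

theorem flag_mem_fixedPts (hb : Q.IsSelfDual b) (w : Q.weyl (Q.total a b)) :
    flag hb w ∈ Q.fixedPts a b := by
  classical
  rw [fixedPts, Finset.mem_filter]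
  refine ⟨Finset.mem_univ _, fun i => ?_, fun p hp q hq h => ?_⟩
  · have hle : a i ≤ Q.total a b i := by rw [total]; omega
    rw [flag, Finset.filter_map, Finset.card_map]
    have : Finset.filter ((fun p : Bas (Q.total a b) => p.1 = i) ∘
        (basHom (Q.total_θ hb) w).toEmbedding) (stdFlag Q a b) =
        (Finset.univ : Finset (Fin (a i))).map
          ⟨fun k => (⟨i, Fin.castLE hle k⟩ : Bas (Q.total a b)), fun k l h => by simpa using h⟩ := by
      ext ⟨j, k⟩
      simp only [Finset.mem_filter, mem_stdFlag, Function.comp,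
        basHom_vertex, Finset.mem_map, Finset.mem_univ, true_and, Function.Embedding.coeFn_mk]
      constructor
      · rintro ⟨h1, rfl⟩
        have : k.val < a j := by
          rw [blk] at h1
          by_contra hk
          rw [if_neg hk] at h1
          split_ifs at h1
        exact ⟨⟨k, this⟩, rfl⟩
      · rintro ⟨l, hl⟩
        obtain ⟨rfl, hl⟩ := Sigma.mk.inj_iff.1 hl
        obtain rfl := eq_of_heq hl
        exact ⟨by rw [blk, if_pos]; exact l.isLt, rfl⟩
    convert Finset.card_map _ using 1
    · congr 1
      convert this
    · simp
  · rw [(isDual_iff (Q.total_θ hb) p q).1 h] at hq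
    obtain ⟨p, rfl⟩ := (basHom (Q.total_θ hb) w).surjective p
    rw [← basHom_dual, mem_flag hb, blk_dual hb] at hq
    rw [mem_flag hb] at hp
    omega

end DualQuiver

end

noncomputable section

namespace DualQuiver

variable {Q₀ Q₁ : Type*} {Q : DualQuiver Q₀ Q₁} {c : Q₀ → ℕ} {a b : Q₀ → ℕ} [Fintype Q₀]

/-! ### The Weyl group element of a fixed point -/

variable (Q) in
/-- The basis vectors at each vertex are ordered first by their position in the flag of `I`, then by
their index. -/
def flagKey (I : Finset (Bas c)) (q : Bas c) : ℕ := Q.step I q * c q.1 + q.2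

theorem flagKey_lt_iff (I : Finset (Bas c)) {i : Q₀} (k l : Fin (c i)) :
    flagKey Q I ⟨i, k⟩ < flagKey Q I ⟨i, l⟩ ↔ Q.step I ⟨i, k⟩ < Q.step I ⟨i, l⟩ ∨
      Q.step I ⟨i, k⟩ = Q.step I ⟨i, l⟩ ∧ k < l := by
  have hk := k.isLt
  have hl := l.isLt
  simp only [flagKey, Fin.lt_def]
  have key : ∀ s s' : ℕ, s < s' → s * c i + c i ≤ s' * c i := fun s s' h => by
    rw [← Nat.succ_mul]
    exact Nat.mul_le_mul_right _ h
  rcases lt_trichotomy (Q.step I ⟨i, k⟩) (Q.step I ⟨i, l⟩) with h | h | h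
  · have := key _ _ h
    exact ⟨fun _ => Or.inl h, fun _ => by omega⟩
  · rw [h]
    simp
  · have := key _ _ h
    exact ⟨fun h' => by omega, fun h' => by omega⟩

theorem flagKey_injective (I : Finset (Bas c)) {i : Q₀} {k l : Fin (c i)}
    (h : flagKey Q I ⟨i, k⟩ = flagKey Q I ⟨i, l⟩) : k = l := by
  have h1 := mt (flagKey_lt_iff I k l).2 h.not_lt
  have h2 := mt (flagKey_lt_iff I l k).2 h.symm.not_lt
  push Not at h1 h2
  exact le_antisymm (h2.2 (by omega)) (h1.2 (by omega))

variable (Q) in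
/-- The position of a basis vector in this order. -/
def flagRank (I : Finset (Bas c)) (q : Bas c) : ℕ :=
  (Finset.univ.filter fun k : Fin (c q.1) => flagKey Q I ⟨q.1, k⟩ < flagKey Q I q).card

theorem flagRank_lt (I : Finset (Bas c)) (q : Bas c) : flagRank Q I q < c q.1 := by
  refine lt_of_lt_of_eq (Finset.card_lt_univ_of_notMem (x := q.2) ?_) (Fintype.card_fin _)
  simp

variable (Q) in
/-- The map that lists the basis vectors in this order. -/
def flagPos (I : Finset (Bas c)) (q : Bas c) : Bas c := ⟨q.1, ⟨flagRank Q I q, flagRank_lt I q⟩⟩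

theorem flagRank_strictMono (I : Finset (Bas c)) {i : Q₀} {k l : Fin (c i)}
    (h : flagKey Q I ⟨i, k⟩ < flagKey Q I ⟨i, l⟩) : flagRank Q I ⟨i, k⟩ < flagRank Q I ⟨i, l⟩ := by
  refine Finset.card_lt_card ⟨fun m hm => ?_, fun hs => ?_⟩
  · simp only [Finset.mem_filter, Finset.mem_univ, true_and] at hm ⊢
    exact hm.trans h
  · have := hs (x := k) (by simpa using h)
    simp at this

theorem flagPos_injective (I : Finset (Bas c)) : Function.Injective (flagPos Q I) := by
  rintro ⟨i, k⟩ ⟨j, l⟩ h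
  obtain ⟨rfl, h⟩ := Sigma.mk.inj_iff.1 h
  have h : flagRank Q I ⟨i, k⟩ = flagRank Q I ⟨i, l⟩ := congrArg Fin.val (eq_of_heq h)
  rcases lt_trichotomy (flagKey Q I ⟨i, k⟩) (flagKey Q I ⟨i, l⟩) with h1 | h1 | h1
  · exact absurd h (flagRank_strictMono I h1).ne
  · rw [flagKey_injective I h1]
  · exact absurd h (flagRank_strictMono I h1).ne'

/-- The index of the basis vector dual to a given one. -/
def dualIdx (hc : ∀ i, c (Q.θ i) = c i) {i : Q₀} (k : Fin (c i)) : Fin (c (Q.θ i)) :=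
  (dual hc ⟨i, k⟩).2

theorem dualIdx_val (hc : ∀ i, c (Q.θ i) = c i) {i : Q₀} (k : Fin (c i)) :
    (dualIdx hc k).val = c i - 1 - k.val := rfl

theorem step_dual (hc : ∀ i, c (Q.θ i) = c i) {I : Finset (Bas c)}
    (hI : ∀ p ∈ I, ∀ q ∈ I, ¬ Q.IsDual c p q) (q : Bas c) :
    Q.step I (dual hc q) = 2 - Q.step I q := by
  classical
  have h : q ∈ I → dual hc q ∉ I := fun h h' => hI _ h _ h' ((isDual_iff hc _ _).2 rfl)
  rw [step_eq hc, step_eq hc, dual_dual]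
  split_ifs <;> simp_all

/-- Duality reverses both the step in the flag and the index, hence the lexicographic order that the
key encodes. -/
theorem flagKey_dual (hc : ∀ i, c (Q.θ i) = c i) {I : Finset (Bas c)}
    (hI : ∀ p ∈ I, ∀ q ∈ I, ¬ Q.IsDual c p q) (q : Bas c) :
    flagKey Q I (dual hc q) + flagKey Q I q + 1 = 3 * c q.1 := by
  have h1 := step_le (Q := Q) I q
  have h2 := q.2.isLt
  rw [flagKey, flagKey, step_dual hc hI]
  change (2 - Q.step I q) * c (Q.θ q.1) + (c q.1 - 1 - q.2.val) + _ + 1 = _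
  rw [hc]
  interval_cases Q.step I q <;> omega

/-- As duality reverses the order, the vectors before the dual of `q` are the duals of those after
`q`. So sorting commutes with duality, which is what makes it come from the Weyl group. -/
theorem flagPos_dual (hc : ∀ i, c (Q.θ i) = c i) {I : Finset (Bas c)}
    (hI : ∀ p ∈ I, ∀ q ∈ I, ¬ Q.IsDual c p q) (q : Bas c) :
    flagPos Q I (dual hc q) = dual hc (flagPos Q I q) := by
  classical
  refine bas_ext rfl ?_
  change flagRank Q I (dual hc q) = c q.1 - 1 - flagRank Q I q
  obtain ⟨i, k⟩ := q
  have h1 : flagRank Q I (dual hc ⟨i, k⟩) =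
      (Finset.univ.filter fun l : Fin (c i) => flagKey Q I ⟨i, k⟩ < flagKey Q I ⟨i, l⟩).card := by
    symm
    refine Finset.card_bij (fun l _ => dualIdx hc l) ?_ ?_ ?_
    · intro l hl
      simp only [Finset.mem_filter, Finset.mem_univ, true_and] at hl
      refine Finset.mem_filter.2 ⟨Finset.mem_univ _, ?_⟩
      have h2 := flagKey_dual hc hI ⟨i, k⟩
      have h3 := flagKey_dual hc hI ⟨i, l⟩
      change flagKey Q I (dual hc ⟨i, l⟩) < flagKey Q I (dual hc ⟨i, k⟩)
      simp only at h2 h3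
      omega
    · intro l _ l' _ h
      have h2 : dual hc ⟨i, l⟩ = dual hc ⟨i, l'⟩ := bas_ext rfl (congrArg Fin.val h)
      simpa using dual_injective hc h2
    · intro m hm
      simp only [Finset.mem_filter, Finset.mem_univ, true_and] at hm
      have hm' := m.isLt
      have hci : c (Q.θ i) = c i := hc i
      change m.val < c (Q.θ i) at hm'
      have h4 : dual hc ⟨i, ⟨c i - 1 - m.val, by omega⟩⟩ = ⟨Q.θ i, m⟩ :=
        bas_ext rfl (by simp only [dual]; omega)
      refine ⟨⟨c i - 1 - m.val, by omega⟩, ?_, ?_⟩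
      · simp only [Finset.mem_filter, Finset.mem_univ, true_and]
        have h2 := flagKey_dual hc hI ⟨i, k⟩
        have h3 := flagKey_dual hc hI ⟨i, ⟨c i - 1 - m.val, by omega⟩⟩
        rw [h4] at h3
        change flagKey Q I ⟨Q.θ i, m⟩ < _ at hm
        simp only at h2 h3
        omega
      · exact Fin.ext (by rw [dualIdx_val]; simp only; omega)
  have h2 : (Finset.univ.filter fun l : Fin (c i) => flagKey Q I ⟨i, l⟩ ≤ flagKey Q I ⟨i, k⟩) =
      insert k (Finset.univ.filter fun l : Fin (c i) => flagKey Q I ⟨i, l⟩ < flagKey Q I ⟨i, k⟩) := by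
    ext l
    simp only [Finset.mem_filter, Finset.mem_univ, true_and, Finset.mem_insert, le_iff_lt_or_eq]
    constructor
    · rintro (h | h)
      · exact Or.inr h
      · exact Or.inl (flagKey_injective I h)
    · rintro (rfl | h)
      · exact Or.inr rfl
      · exact Or.inl h
  have h3 := Finset.card_filter_add_card_filter_not (s := (Finset.univ : Finset (Fin (c i))))
    fun l : Fin (c i) => flagKey Q I ⟨i, l⟩ ≤ flagKey Q I ⟨i, k⟩
  rw [h2, Finset.card_insert_of_notMem (by simp), Finset.card_univ, Fintype.card_fin] at h3
  simp only [not_le] at h3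
  rw [h1]
  change _ = c i - 1 - (Finset.univ.filter fun l : Fin (c i) =>
    flagKey Q I ⟨i, l⟩ < flagKey Q I ⟨i, k⟩).card
  omega

variable (Q) in
open Classical in
/-- The basis vectors at `i` in position `s` of the flag of `I`. -/
def stepSet (I : Finset (Bas c)) (s : ℕ) (i : Q₀) : Finset (Fin (c i)) :=
  Finset.univ.filter fun k => Q.step I ⟨i, k⟩ = s

theorem mem_stepSet {I : Finset (Bas c)} {s : ℕ} {i : Q₀} {k : Fin (c i)} :
    k ∈ stepSet Q I s i ↔ Q.step I ⟨i, k⟩ = s := by simp [stepSet]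

/-- What precedes a vector in the sorted order is everything in earlier steps, and the smaller
indices in its own step. -/
theorem flagRank_eq (I : Finset (Bas c)) {s : ℕ} {i : Q₀} {k : Fin (c i)}
    (hk : k ∈ stepSet Q I s i) : flagRank Q I ⟨i, k⟩ =
      (∑ r ∈ Finset.range s, (stepSet Q I r i).card) +
        ((stepSet Q I s i).filter (· < k)).card := by
  classical
  have hk' := mem_stepSet.1 hk
  have h1 : (Finset.univ.filter fun l : Fin (c i) => flagKey Q I ⟨i, l⟩ < flagKey Q I ⟨i, k⟩) =
      ((Finset.range s).biUnion fun r => stepSet Q I r i) ∪ (stepSet Q I s i).filter (· < k) := by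
    ext l
    simp only [Finset.mem_filter, Finset.mem_univ, true_and, Finset.mem_union, Finset.mem_biUnion,
      mem_stepSet, flagKey_lt_iff, hk', Finset.mem_range, exists_eq_right']
  rw [flagRank]
  simp only
  rw [h1, Finset.card_union_of_disjoint, Finset.card_biUnion]
  · intro r _ r' _ hr
    refine Finset.disjoint_left.2 fun l hl hl' => hr ?_
    rw [← mem_stepSet.1 hl, ← mem_stepSet.1 hl']
  · refine Finset.disjoint_left.2 fun l hl hl' => ?_
    simp only [Finset.mem_filter, Finset.mem_biUnion, mem_stepSet, Finset.mem_range] at hl hl'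
    obtain ⟨r, hr, hl⟩ := hl
    omega

theorem card_stepSet_zero {I : Finset (Bas (Q.total a b))} (hI : I ∈ Q.fixedPts a b) (i : Q₀) :
    (stepSet Q I 0 i).card = a i := by
  classical
  rw [fixedPts, Finset.mem_filter] at hI
  rw [← hI.2.1 i]
  refine Finset.card_bij (fun k _ => (⟨i, k⟩ : Bas (Q.total a b))) ?_ ?_ ?_
  · intro k hk
    rw [mem_stepSet, step_eq_zero_iff] at hk
    simpa using hk
  · intro k _ l _ h
    simpa using h
  · rintro ⟨j, k⟩ h
    simp only [Finset.mem_filter] at h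
    obtain ⟨h, rfl⟩ := h
    exact ⟨k, by rwa [mem_stepSet, step_eq_zero_iff], rfl⟩

/-- Duality exchanges the steps `0` and `2`, at vertices exchanged by `θ`. -/
theorem card_stepSet_two (hb : Q.IsSelfDual b) {I : Finset (Bas (Q.total a b))}
    (hI : I ∈ Q.fixedPts a b) (i : Q₀) : (stepSet Q I 2 i).card = a (Q.θ i) := by
  classical
  have hc := Q.total_θ (a := a) hb
  rw [← card_stepSet_zero hI]
  rw [fixedPts, Finset.mem_filter] at hI
  refine Finset.card_bij (fun k _ => dualIdx hc k) ?_ ?_ ?_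
  · intro k hk
    have h := step_dual hc hI.2.2 ⟨i, k⟩
    rw [mem_stepSet] at hk ⊢
    rw [hk] at h
    exact h
  · intro l _ l' _ h
    have h2 : dual hc ⟨i, l⟩ = dual hc ⟨i, l'⟩ := bas_ext rfl (congrArg Fin.val h)
    simpa using dual_injective hc h2
  · intro m hm
    have hm' := m.isLt
    have hci : Q.total a b (Q.θ i) = Q.total a b i := hc i
    have h4 : dual hc ⟨i, ⟨Q.total a b i - 1 - m.val, by omega⟩⟩ = ⟨Q.θ i, m⟩ :=
      bas_ext rfl (by simp only [dual]; omega)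
    refine ⟨⟨Q.total a b i - 1 - m.val, by omega⟩, ?_, Fin.ext (by rw [dualIdx_val]; simp only; omega)⟩
    have h := step_dual hc hI.2.2 ⟨i, ⟨Q.total a b i - 1 - m.val, by omega⟩⟩
    have hle := step_le (Q := Q) I ⟨i, ⟨Q.total a b i - 1 - m.val, by omega⟩⟩
    rw [h4, mem_stepSet.1 hm] at h
    rw [mem_stepSet]
    omega

theorem card_stepSet_one (hb : Q.IsSelfDual b) {I : Finset (Bas (Q.total a b))}
    (hI : I ∈ Q.fixedPts a b) (i : Q₀) : (stepSet Q I 1 i).card = b i := by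
  classical
  have h1 : ∑ r ∈ Finset.range 3, (stepSet Q I r i).card = Q.total a b i := by
    rw [← Finset.card_biUnion]
    · convert Finset.card_univ (α := Fin (Q.total a b i))
      · refine Finset.eq_univ_of_forall fun k => ?_
        simp only [Finset.mem_biUnion, Finset.mem_range, mem_stepSet, exists_eq_right']
        have := step_le (Q := Q) I ⟨i, k⟩
        omega
      · simp
    · intro r _ r' _ hr
      refine Finset.disjoint_left.2 fun l hl hl' => hr ?_
      rw [← mem_stepSet.1 hl, ← mem_stepSet.1 hl']
  simp only [Finset.sum_range_succ, Finset.sum_range_zero, card_stepSet_zero hI,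
    card_stepSet_two hb hI] at h1
  have h2 : Q.total a b i = a i + a (Q.θ i) + b i := rfl
  omega

/-- The steps of any fixed point have the sizes of the standard blocks, so sorting carries its flag
to the standard one. -/
theorem blk_flagPos (hb : Q.IsSelfDual b) {I : Finset (Bas (Q.total a b))}
    (hI : I ∈ Q.fixedPts a b) (q : Bas (Q.total a b)) :
    blk a b (flagPos Q I q).1 (flagPos Q I q).2 = Q.step I q := by
  classical
  obtain ⟨i, k⟩ := q
  change blk a b i (flagRank Q I ⟨i, k⟩) = _
  have hk : k ∈ stepSet Q I (Q.step I ⟨i, k⟩) i := mem_stepSet.2 rfl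
  have h1 := flagRank_eq I hk
  have h2 : ((stepSet Q I (Q.step I ⟨i, k⟩) i).filter (· < k)).card <
      (stepSet Q I (Q.step I ⟨i, k⟩) i).card := by
    refine Finset.card_lt_card ⟨Finset.filter_subset _ _, fun h => ?_⟩
    have := h hk
    simp at this
  have h3 := step_le (Q := Q) I ⟨i, k⟩
  have h0 := card_stepSet_zero hI i
  have h1' := card_stepSet_one hb hI i
  rw [blk]
  generalize Q.step I ⟨i, k⟩ = s at *
  interval_cases s <;>
    simp only [Finset.sum_range_succ, Finset.sum_range_zero, h0, h1'] at h1 h2 <;>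
    split_ifs <;> omega

-- Chern roots and ranks list the vectors of a step in the same order. So the root number `n` is the
-- weight of the vector in sorted position `n` after all earlier steps.
open Classical in
theorem chernRoot_eq (I : Finset (Bas c)) (s : ℕ) (i : Q₀) (n : ℕ)
    (hn : n < (stepSet Q I s i).card) : ∃ k : Fin (c i), k ∈ stepSet Q I s i ∧
      chernRoot I s i n = algebraMap (Q.Poly c) (Q.K c) (Q.wt c i k) ∧
      flagRank Q I ⟨i, k⟩ = (∑ r ∈ Finset.range s, (stepSet Q I r i).card) + n := by
  have hmem := Finset.orderEmbOfFin_mem (stepSet Q I s i) rfl ⟨n, hn⟩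
  refine ⟨(stepSet Q I s i).orderEmbOfFin rfl ⟨n, hn⟩, hmem, ?_, ?_⟩
  · rw [chernRoot, List.getD_eq_getElem _ _ (by simpa [stepSet] using hn), List.getElem_map,
      Finset.orderEmbOfFin_apply]
    simp [stepSet, ← List.map_eq_flatMap]
  · rw [flagRank_eq I hmem]
    congr 1
    have : (stepSet Q I s i).filter (· < (stepSet Q I s i).orderEmbOfFin rfl ⟨n, hn⟩) =
        (Finset.Iio (⟨n, hn⟩ : Fin (stepSet Q I s i).card)).map
          ((stepSet Q I s i).orderEmbOfFin rfl).toEmbedding := by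
      ext k
      simp only [Finset.mem_filter, Finset.mem_map, Finset.mem_Iio]
      constructor
      · rintro ⟨h1, h2⟩
        have h3 : k ∈ Set.range ((stepSet Q I s i).orderEmbOfFin rfl) := by
          rw [Finset.range_orderEmbOfFin]; exact h1
        obtain ⟨m, rfl⟩ := h3
        exact ⟨m, by simpa using h2, rfl⟩
      · rintro ⟨m, hm, rfl⟩
        exact ⟨Finset.orderEmbOfFin_mem _ _ _, by simpa using hm⟩
    rw [this, Finset.card_map, Fin.card_Iio]

/-- Every fixed point is the image of the standard one under an element of the Weyl group that is
increasing on each block, so that it carries the standard weights to the Chern roots. -/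
theorem exists_flag_eq (hb : Q.IsSelfDual b) {I : Finset (Bas (Q.total a b))}
    (hI : I ∈ Q.fixedPts a b) : ∃ w : Q.weyl (Q.total a b), flag hb w = I ∧
      (∀ i, ∀ n < a i, chernRoot I 0 i n =
        w • algebraMap (Q.Poly (Q.total a b)) (Q.K _) (Q.wt (Q.total a b) i n)) ∧
      ∀ i, ∀ n < b i, chernRoot I 1 i n =
        w • algebraMap (Q.Poly (Q.total a b)) (Q.K _) (Q.wt (Q.total a b) i (a i + n)) := by
  classical
  have hc := Q.total_θ (a := a) hb
  have hI' : ∀ p ∈ I, ∀ q ∈ I, ¬ Q.IsDual _ p q := (Finset.mem_filter.1 hI).2.2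
  let γ : Equiv.Perm (Bas (Q.total a b)) :=
    Equiv.ofBijective _ (Finite.injective_iff_bijective.1 (flagPos_injective (Q := Q) I))
  -- Sorting takes the given flag to the standard one, so the Weyl group element sought is its
  -- inverse.
  obtain ⟨w, hw⟩ := exists_basHom_eq hc γ.symm
    (fun q => by
      obtain ⟨p, rfl⟩ := γ.surjective q
      rw [Equiv.symm_apply_apply]; rfl)
    (fun q => by
      obtain ⟨p, rfl⟩ := γ.surjective q
      rw [Equiv.symm_apply_apply, Equiv.symm_apply_eq]
      exact (flagPos_dual hc hI' p).symm)
  have hw' : ∀ q, basHom hc w (flagPos Q I q) = q := fun q => by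
    rw [hw]; exact γ.symm_apply_apply q
  have key : ∀ s i n, n < (stepSet Q I s i).card → chernRoot I s i n =
      w • algebraMap (Q.Poly (Q.total a b)) (Q.K _) (Q.wt (Q.total a b) i
        ((∑ r ∈ Finset.range s, (stepSet Q I r i).card) + n)) := by
    intro s i n hn
    obtain ⟨k, h1, h2, h3⟩ := chernRoot_eq I s i n hn
    rw [h2, ← h3, smul_algebraMap_poly]
    have := actPoly_wt hc w (flagPos Q I ⟨i, k⟩)
    rw [hw'] at this
    exact congrArg _ this.symm
  refine ⟨w, ?_, fun i n hn => ?_, fun i n hn => ?_⟩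
  · ext q
    rw [← hw' q, mem_flag hb, blk_flagPos hb hI, hw', step_eq_zero_iff]
  · rw [key 0 i n (by rwa [card_stepSet_zero hI])]
    simp
  · rw [key 1 i n (by rwa [card_stepSet_one hb hI])]
    simp [card_stepSet_zero hI]

end DualQuiver

end

/-! ### Fixed points as cosets, and restrictions of classes to them -/

noncomputable section

namespace DualQuiver

variable {Q₀ Q₁ : Type*} {Q : DualQuiver Q₀ Q₁} {c : Q₀ → ℕ} {a b : Q₀ → ℕ} [Fintype Q₀]

/-- Every fixed point lies in the orbit of the standard one, and each coset of its stabilizer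
contains exactly one minimal representative. -/
theorem sum_fixedPts {M : Type*} [AddCommMonoid M] (hb : Q.IsSelfDual b)
    (F : Finset (Bas (Q.total a b)) → M) :
    ∑ I ∈ Q.fixedPts a b, F I = ∑ w ∈ minSet Q a b, F (flag hb w) := by
  symm
  refine Finset.sum_bij (fun w _ => flag hb w) (fun w _ => flag_mem_fixedPts hb w) ?_ ?_
    fun _ _ => rfl
  · intro w hw w' hw' h
    have h1 := (flag_eq_iff hb w w').1 h
    rw [mem_minSet, mem_minReps_iff] at hw hw'
    have h2 := (isLevi Q a b).eq_one_of_isMin_mul hw' (u := ⟨w'⁻¹ * w, h1⟩) (by simpa using hw)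
    have h3 : w'⁻¹ * w = 1 := congrArg Subtype.val h2
    exact (inv_mul_eq_one.1 h3).symm
  · intro I hI
    obtain ⟨w, rfl, -⟩ := exists_flag_eq hb hI
    obtain ⟨u, hu⟩ := (isLevi Q a b).exists_mul_isMin w
    refine ⟨w * u, by rwa [mem_minSet, mem_minReps_iff], ?_⟩
    rw [flag_eq_iff, inv_mul_cancel_left]
    exact u.2

/-! ### The invariance of the classes under the Levi subgroup -/

theorem lt_of_blk_eq_zero {i : Q₀} {k : ℕ} (h : blk a b i k = 0) : k < a i := by
  rw [blk] at h
  by_contra hk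
  rw [if_neg hk] at h
  split_ifs at h

/-- A Levi element preserves the standard isotropic subspace, so it permutes its basis at each
vertex, including those in `Q₀⁻`. On weights this is a permutation of the variables of `f` at each
vertex. -/
theorem actPoly_inclA (hb : Q.IsSelfDual b) {w : Q.SPerm (Q.total a b)} (hw : w ∈ Q.weylLevi a b)
    {f : MvPolynomial (Σ i : Q₀, Fin (a i)) ℂ} (hf : IsSymm a f) :
    actPoly w (Q.inclA a b f) = Q.inclA a b f := by
  have hc := Q.total_θ (a := a) hb
  have hle : ∀ i, a i ≤ Q.total a b i := fun i => by rw [total]; omega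
  lift w to Q.weyl (Q.total a b) using hw.1
  let emb : (Σ i : Q₀, Fin (a i)) → Bas (Q.total a b) := fun v => ⟨v.1, Fin.castLE (hle v.1) v.2⟩
  have hemb : Function.Injective emb := by
    rintro ⟨i, k⟩ ⟨j, l⟩ h
    obtain ⟨rfl, h⟩ := Sigma.mk.inj_iff.1 h
    simpa using eq_of_heq h
  have h1 : ∀ i (k : Fin (a i)), ∃ l : Fin (a i), emb ⟨i, l⟩ = basHom hc w (emb ⟨i, k⟩) := by
    intro i k
    have h2 := basHom_vertex hc w (emb ⟨i, k⟩)
    have h3 := blk_basHom_of_mem hb hw (emb ⟨i, k⟩)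
    have h4 := lt_of_blk_eq_zero (h3.trans (by rw [blk, if_pos]; exact k.isLt))
    refine ⟨⟨(basHom hc w (emb ⟨i, k⟩)).2, ?_⟩, bas_ext h2.symm rfl⟩
    exact lt_of_lt_of_eq h4 (congrArg a h2)
  choose m hm using h1
  have hinj : ∀ i, Function.Injective (m i) := fun i k l h => by
    have h2 := (hm i k).symm.trans ((congrArg (fun l => emb ⟨i, l⟩) h).trans (hm i l))
    simpa using hemb ((basHom hc w).injective h2)
  let π : ∀ i, Equiv.Perm (Fin (a i)) := fun i =>
    Equiv.ofBijective (m i) (Finite.injective_iff_bijective.1 (hinj i))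
  have h2 : (actPoly w.1).comp (Q.inclA a b) =
      (Q.inclA a b).comp (rename (Sigma.map id fun i => π i)) := by
    refine algHom_ext fun v => ?_
    simp only [AlgHom.comp_apply, rename_X, inclA, aeval_X]
    have h3 := actPoly_wt hc w (emb v)
    rw [← hm v.1 v.2] at h3
    exact h3
  have h3 := DFunLike.congr_fun h2 f
  rw [AlgHom.comp_apply, AlgHom.comp_apply, hf π] at h3
  exact h3

theorem add_lt_rk (v : Q.Var b) : a v.1 + v.2 < Q.rk (Q.total a b) v.1 := by
  have h := v.2.isLt
  rcases pos_or_fixed v with hv | hv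
  · have h1 := rk_pos (c := b) hv
    have h2 := rk_pos (c := Q.total a b) hv
    have h3 : Q.total a b v.1 = a v.1 + a (Q.θ v.1) + b v.1 := rfl
    omega
  · have h1 := rk_fixed (c := b) hv
    have h2 := rk_fixed (c := Q.total a b) hv
    have h3 : Q.total a b v.1 = a v.1 + a v.1 + b v.1 := by rw [total, hv]
    omega

/-- The signed variables of `θP_b` as signed variables of `θP_c`. -/
def shift (a : Q₀ → ℕ) (p : Q.SVar b) : Q.SVar (Q.total a b) :=
  (⟨p.1.1, ⟨a p.1.1 + p.1.2, add_lt_rk p.1⟩⟩, p.2)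

theorem shift_injective : Function.Injective (shift (Q := Q) (b := b) a) := by
  rintro ⟨⟨i, k⟩, e⟩ ⟨⟨j, l⟩, e'⟩ h
  obtain ⟨h1, h2⟩ := Prod.ext_iff.1 h
  obtain rfl : i = j := congrArg (fun v : Q.Var (Q.total a b) => v.1) h1
  have h4 : a i + k.val = a i + l.val := congrArg (fun v : Q.Var (Q.total a b) => v.2.val) h1
  exact Prod.ext (var_ext rfl (Nat.add_left_cancel h4)) h2

theorem shift_svNeg (p : Q.SVar b) :
    shift a (svNeg p) = svNeg (shift a p) := rfl

theorem exists_shift_eq_iff (p : Q.SVar (Q.total a b)) :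
    (∃ r, shift a r = p) ↔ vblk Q a b p.1 = 1 := by
  constructor
  · rintro ⟨r, rfl⟩
    have h := r.1.2.isLt
    have h1 := rk_le (Q := Q) (c := b) r.1.1
    change blk a b r.1.1 (a r.1.1 + r.1.2) = 1
    rw [blk, if_neg (by omega), if_pos (by omega)]
  · intro h
    obtain ⟨⟨i, k⟩, e⟩ := p
    have hk := k.isLt
    change blk a b i k = 1 at h
    have h1 : a i ≤ k.val ∧ k.val < a i + b i := by
      rw [blk] at h
      split_ifs at h <;> omega
    have h2 : k.val - a i < Q.rk b i := by
      rcases pos_or_fixed (⟨i, k⟩ : Q.Var (Q.total a b)) with hv | hv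
      · have := rk_pos (c := b) hv
        simp only at this
        omega
      · have h3 := rk_fixed (c := b) hv
        have h4 := rk_fixed (c := Q.total a b) hv
        have h5 : Q.total a b i = a i + a i + b i := by
          rw [total]
          simp only at hv
          rw [hv]
        simp only at h3 h4
        omega
    refine ⟨(⟨i, ⟨k.val - a i, h2⟩⟩, e), Prod.ext (var_ext rfl ?_) rfl⟩
    simp only [shift]
    omega

/-- Restriction of a Levi element to the signed variables of block `1`, which are exactly the
shifted variables of `b`. -/
theorem exists_weyl_shift {w : Q.SPerm (Q.total a b)}
    (hw : w ∈ Q.weylLevi a b) : ∃ u ∈ Q.weyl b, ∀ p, shift a (u p) = w (shift a p) := by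
  have h1 : ∀ v : Q.SPerm (Q.total a b), v ∈ Q.weylLevi a b →
      ∀ p, ∃ r, shift a r = v (shift a p) := by
    intro v hv p
    rw [exists_shift_eq_iff]
    exact (hv.2.1 _).trans ((exists_shift_eq_iff _).1 ⟨p, rfl⟩)
  choose f hf using h1 w hw
  choose g hg using h1 w⁻¹ (inv_mem hw)
  let u : Q.SPerm b :=
    { toFun := f
      invFun := g
      left_inv := fun p => shift_injective (a := a) (by rw [hg, hf]; simp)
      right_inv := fun p => shift_injective (a := a)
        (by rw [hf, hg]; simp) }
  have hneg : ∀ p, f (svNeg p) = svNeg (f p) := fun p => shift_injective (a := a) (by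
    rw [hf, shift_svNeg, weyl_svNeg hw.1, shift_svNeg, hf])
  refine ⟨u, ⟨fun v e => hneg (v, e), fun p => ?_, fun p hp => ?_⟩, hf⟩
  · have := weyl_vertex hw.1 (shift a p)
    rw [← hf] at this
    exact this
  · have := hw.1.2.2 (shift a p) hp
    rw [← hf] at this
    exact this

theorem actPoly_inclB {w : Q.SPerm (Q.total a b)} (hw : w ∈ Q.weylLevi a b)
    {g : Q.Poly b} (hg : Q.IsInv b g) : actPoly w (Q.inclB a b g) = Q.inclB a b g := by
  obtain ⟨u, hu, huw⟩ := exists_weyl_shift hw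
  have h0 : ∀ p : Q.SVar b, Q.inclB a b (polyLin p) = polyLin (shift a p) := by
    intro p
    rw [polyLin, polyLin, map_zsmul, inclB, aeval_X, xv_of_lt _ (add_lt_rk p.1)]
    rfl
  have h1 : (actPoly w).comp (Q.inclB a b) = (Q.inclB a b).comp (actPoly u) := by
    refine algHom_ext fun v => ?_
    rw [AlgHom.comp_apply, AlgHom.comp_apply, ← polyLin_one, h0, actPoly_polyLin hw.1,
      actPoly_polyLin hu, h0, huw]
  have h2 := DFunLike.congr_fun h1 g
  rw [AlgHom.comp_apply, AlgHom.comp_apply, hg u hu] at h2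
  exact h2

/-- The restriction of `f ⊗ g` to a fixed point. -/
theorem restr_flag (hb : Q.IsSelfDual b) {f : MvPolynomial (Σ i : Q₀, Fin (a i)) ℂ} {g : Q.Poly b}
    (hf : IsSymm a f) (hg : Q.IsInv b g) (w : Q.weyl (Q.total a b)) :
    Q.restrA (flag hb w) f * Q.restrB (flag hb w) g =
      w • algebraMap (Q.Poly (Q.total a b)) (Q.K (Q.total a b))
        (Q.inclA a b f * Q.inclB a b g) := by
  -- Chern roots are matched in order only by the sorting element `v`. It differs from `w` by a Levi
  -- element, which fixes the product of the two classes.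
  obtain ⟨v, hv, h0, h1⟩ := exists_flag_eq hb (flag_mem_fixedPts hb w)
  have hlevi := (flag_eq_iff hb v w).1 hv
  have hvw : v = w * (w⁻¹ * v) := by rw [mul_inv_cancel_left]
  have h2 : w • algebraMap (Q.Poly (Q.total a b)) (Q.K (Q.total a b))
      (Q.inclA a b f * Q.inclB a b g) = v • algebraMap (Q.Poly (Q.total a b))
        (Q.K (Q.total a b)) (Q.inclA a b f * Q.inclB a b g) := by
    conv_rhs => rw [hvw, mul_smul, smul_algebraMap_poly (w⁻¹ * v), map_mul,
      actPoly_inclA hb hlevi hf, actPoly_inclB hlevi hg]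
  let ψ : Q.Poly (Q.total a b) →ₐ[ℂ] Q.K (Q.total a b) :=
    (IsScalarTower.toAlgHom ℂ (Q.Poly (Q.total a b)) (Q.K (Q.total a b))).comp (actPoly v.1)
  have hψ : ∀ F, ψ F = v • algebraMap (Q.Poly (Q.total a b)) (Q.K (Q.total a b)) F := fun F =>
    (smul_algebraMap_poly v F).symm
  have h3 : Q.restrA (flag hb w) = ψ.comp (Q.inclA a b) := by
    refine algHom_ext fun u => ?_
    rw [restrA, aeval_X, AlgHom.comp_apply, hψ, inclA, aeval_X]
    exact h0 _ _ u.2.isLt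
  have h4 : Q.restrB (flag hb w) = ψ.comp (Q.inclB a b) := by
    refine algHom_ext fun u => ?_
    rw [restrB, aeval_X, AlgHom.comp_apply, hψ, inclB, aeval_X, h1 _ _ (by
      have := rk_le (Q := Q) (c := b) u.1
      have := u.2.isLt
      omega)]
    congr 2
    have h5 := wt_bas (Q.total_θ hb) (shift a (u, 1))
    rw [shift, bas_one, polyLin_one] at h5
    rw [xv_of_lt _ (add_lt_rk u)]
    exact h5
  rw [h2, ← hψ, map_mul, h3, h4]
  rfl

end DualQuiver

end

noncomputable section

namespace DualQuiver

/-! ### Euler classes -/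

/-- The Euler class of `N / N'`, where `N` consists of the families of entries supported on `S` that
are symmetric up to signs `ε` under an involution `τ` of the positions, and `N'` is the subspace where
the entries in `D` vanish: the product of the weights over a set `B` of representatives. -/
theorem eulerQuot_eq_prod {k M T : Type*} [Field k] [CharZero k] [AddCommGroup M] [Module k M]
    {φ : Module.End k M} {N N' : Submodule k M} {h : ∀ x ∈ N, φ x ∈ N} {h' : ∀ x ∈ N', φ x ∈ N'}
    (e : M →ₗ[k] T → k) (he : Function.Surjective e) {τ : T → T} (hτ : ∀ t, τ (τ t) = t)
    {ε : T → ℤˣ} {S D : T → Prop} (hS : ∀ t, S t → S (τ t))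
    (hε : ∀ t, S t → ε t * ε (τ t) = 1)
    (hN : ∀ m, m ∈ N ↔ (∀ t, S t ∨ e m t = 0) ∧ ∀ t, S t → e m (τ t) = ((ε t : ℤ) : k) * e m t)
    (hN' : ∀ m ∈ N, (m ∈ N' ↔ ∀ t, D t → e m t = 0))
    {ω : T → k} (hφ : ∀ m t, e (φ m) t = ω t * e m t) (B : Finset T)
    (hB : ∀ t ∈ B, S t ∧ D t)
    (hcov : ∀ t, S t → D t → t ∈ B ∨ τ t ∈ B ∨ (τ t = t ∧ ε t = -1))
    (hdis : ∀ t ∈ B, τ t ∈ B → τ t = t ∧ ε t = 1) :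
    eulerQuot φ N N' h h' = ∏ t ∈ B, ω t := by
  classical
  let r : N →ₗ[k] (B → k) := LinearMap.pi fun t => LinearMap.proj t.1 ∘ₗ e ∘ₗ N.subtype
  have hr : ∀ m t, r m t = e m.1 t.1 := fun _ _ => rfl
  have hker : N'.submoduleOf N = LinearMap.ker r := by
    ext m
    rw [LinearMap.mem_ker]
    refine (hN' m.1 m.2).trans ?_
    obtain ⟨h1, h2⟩ := (hN m.1).1 m.2
    constructor
    · intro h
      ext t
      exact h t.1 (hB t.1 t.2).2
    · intro h t ht
      have h0 : ∀ t ∈ B, e m.1 t = 0 := fun t ht => congrFun h ⟨t, ht⟩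
      rcases h1 t with hs | hs
      · rcases hcov t hs ht with h3 | h3 | ⟨h3, h4⟩
        · exact h0 t h3
        · have h5 := h2 (τ t) (hS t hs)
          rw [hτ, h0 _ h3, mul_zero] at h5
          exact h5
        · have h5 := h2 t hs
          rw [h3, h4] at h5
          simp only [Units.val_neg, Units.val_one, Int.cast_neg, Int.cast_one, neg_mul,
            one_mul] at h5
          -- An entry that the symmetry fixes with sign `-1` equals its own negative, so it vanishes
          -- in characteristic zero.
          exact self_eq_neg.1 h5
      · exact hs
  have hsurj : Function.Surjective r := by
    intro y
    -- Prescribe the entries in `B`, transport them by the symmetry, and put zero elsewhere. An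
    -- overlap occurs only at fixed positions with sign `+1`, where both prescriptions agree.
    let Y : T → k := fun t => if ht : t ∈ B then y ⟨t, ht⟩
      else if ht' : τ t ∈ B then ((ε (τ t) : ℤ) : k) * y ⟨τ t, ht'⟩ else 0
    obtain ⟨m, hm⟩ := he Y
    have hmN : m ∈ N := by
      rw [hN, hm]
      refine ⟨fun t => ?_, fun t ht => ?_⟩
      · by_cases h1 : t ∈ B
        · exact Or.inl (hB t h1).1
        by_cases h2 : τ t ∈ B
        · have := hS _ (hB _ h2).1
          rw [hτ] at this
          exact Or.inl this
        · right
          simp only [Y, h1, h2, dif_neg, not_false_eq_true]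
      · have hε' : ((ε t : ℤ) : k) * ((ε (τ t) : ℤ) : k) = 1 := by
          rw [← Int.cast_mul, ← Units.val_mul, hε t ht]
          simp
        by_cases h1 : t ∈ B
        · by_cases h2 : τ t ∈ B
          · obtain ⟨h3, h4⟩ := hdis t h1 h2
            rw [h3, h4]
            simp
          · have h3 : τ (τ t) ∈ B := by rwa [hτ]
            simp only [Y, h1, h2, h3, dif_pos, dif_neg, not_false_eq_true]
            simp only [hτ]
        · by_cases h2 : τ t ∈ B
          · simp only [Y, h1, h2, dif_pos, dif_neg, not_false_eq_true]
            rw [← mul_assoc, hε', one_mul]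
          · have h3 : ¬ τ (τ t) ∈ B := by rwa [hτ]
            simp only [Y, h1, h2, h3, dif_neg, not_false_eq_true, mul_zero]
    refine ⟨⟨m, hmN⟩, funext fun t => ?_⟩
    rw [hr, hm]
    simp only [Y, t.2, dif_pos]
  let Ψ : (N ⧸ N'.submoduleOf N) ≃ₗ[k] (B → k) :=
    (Submodule.quotEquivOfEq _ _ hker).trans (r.quotKerEquivOfSurjective hsurj)
  have hΨ : ∀ m : N, Ψ (Submodule.Quotient.mk m) = r m := fun m => rfl
  rw [eulerQuot, ← LinearMap.det_conj _ Ψ]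
  -- The entries in `B` are coordinates on the quotient, and there the operator is the diagonal
  -- matrix of the weights.
  have hdiag : (Ψ : (N ⧸ N'.submoduleOf N) →ₗ[k] (B → k)) ∘ₗ
      (Submodule.mapQ (N'.submoduleOf N) (N'.submoduleOf N) (φ.restrict h) fun x hx => h' x hx) ∘ₗ
        (Ψ.symm : (B → k) →ₗ[k] (N ⧸ N'.submoduleOf N)) =
      Matrix.toLin' (Matrix.diagonal fun t : B => ω t.1) := by
    refine LinearMap.ext fun y => ?_
    obtain ⟨z, rfl⟩ := Ψ.surjective y
    obtain ⟨m, rfl⟩ := Submodule.Quotient.mk_surjective _ z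
    ext t
    simp only [LinearMap.comp_apply, LinearEquiv.coe_coe, LinearEquiv.symm_apply_apply]
    simp only [hΨ, Matrix.toLin'_apply, Matrix.mulVec_diagonal, hr]
    exact hφ _ _
  rw [hdiag, LinearMap.det_toLin', Matrix.det_diagonal, Finset.prod_coe_sort]

variable {Q₀ Q₁ : Type*} {Q : DualQuiver Q₀ Q₁} {c : Q₀ → ℕ}

/-! ### The bilinear form -/

variable (Q) in
open Classical in
/-- The value of the form on a basis vector and its dual. -/
def formSign (q : Bas c) : ℤˣ :=
  if Q.pos q.1 ∨ Q.θ q.1 = q.1 ∧ 2 * q.2.val + 1 ≤ c q.1 then 1 else Q.σ q.1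

-- The form is symmetric up to `σ`. A self-dual basis vector would require `σ = 1`; indeed none
-- exists at a symplectic vertex, because its dimension is even.
open Classical in
theorem gram_eq (hc : ∀ i, c (Q.θ i) = c i) (p q : Bas c) :
    Q.gram c p q = if q = dual hc p then ((formSign Q p : ℤ) : Q.K c) else 0 := by
  rw [gram, formSign]
  simp only [isDual_iff hc]
  split_ifs <;> simp

open Classical in
theorem formSign_mul_dual (hc : ∀ i, c (Q.θ i) = c i)
    (hσ : ∀ i, Q.θ i = i → Q.σ i = -1 → Even (c i)) (q : Bas c) :
    formSign Q q * formSign Q (dual hc q) = Q.σ q.1 := by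
  have hq := q.2.isLt
  have h1 : formSign Q (dual hc q) = if Q.pos (Q.θ q.1) ∨ Q.θ (Q.θ q.1) = Q.θ q.1 ∧
      2 * (c q.1 - 1 - q.2.val) + 1 ≤ c (Q.θ q.1) then 1 else Q.σ (Q.θ q.1) := rfl
  rw [h1, formSign]
  simp only [hc, Q.θ_θ, Q.σ_θ]
  by_cases hf : Q.θ q.1 = q.1
  · have hp := not_pos_of_fixed hf
    simp only [hf, hp, false_or, true_and]
    rcases lt_trichotomy (2 * q.2.val + 1) (c q.1) with h | h | h
    · rw [if_pos (by omega), if_neg (by omega), one_mul]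
    · rw [if_pos (by omega), if_pos (by omega), one_mul]
      by_contra hne
      obtain ⟨m, hm⟩ := hσ _ hf ((Int.units_eq_one_or _).resolve_left (Ne.symm hne))
      omega
    · rw [if_neg (by omega), if_pos (by omega), mul_one]
  · by_cases hp : Q.pos q.1
    · have hn := (Q.pos_iff _ hf).1 hp
      simp [hp, hn, Ne.symm hf]
    · have hn := pos_of_neg hp hf
      simp [hp, hn, hf]

section

variable [Fintype Q₀]

theorem transpose_mul_gram (hc : ∀ i, c (Q.θ i) = c i) (A : Matrix (Bas c) (Bas c) (Q.K c))
    (p q : Bas c) : (A.transpose * Q.gram c) q (dual hc p) = A p q * ((formSign Q p : ℤ) : Q.K c) := by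
  classical
  rw [Matrix.mul_apply, Finset.sum_eq_single p]
  · rw [gram_eq hc, if_pos rfl, Matrix.transpose_apply]
  · intro r _ hr
    rw [gram_eq hc, if_neg fun h => hr (dual_injective hc h.symm), mul_zero]
  · simp

theorem gram_mul (hc : ∀ i, c (Q.θ i) = c i) (A : Matrix (Bas c) (Bas c) (Q.K c))
    (q r : Bas c) : (Q.gram c * A) q r = ((formSign Q q : ℤ) : Q.K c) * A (dual hc q) r := by
  classical
  rw [Matrix.mul_apply, Finset.sum_eq_single (dual hc q)]
  · rw [gram_eq hc, if_pos rfl]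
  · intro r _ hr
    rw [gram_eq hc, if_neg hr, zero_mul]
  · simp

/-- The Gram matrix has one nonzero entry, a sign, in each row and column. Adjointness therefore
compares single entries at positions exchanged by reflection in the antidiagonal. -/
theorem adjoint_iff (hc : ∀ i, c (Q.θ i) = c i) (A B : Matrix (Bas c) (Bas c) (Q.K c)) (u : ℤˣ) :
    A.transpose * Q.gram c = ((u : ℤ) : Q.K c) • (Q.gram c * B) ↔
      ∀ p q, B (dual hc q) (dual hc p) =
        (((u * formSign Q p * formSign Q q : ℤˣ) : ℤ) : Q.K c) * A p q := by
  have key : ∀ (x y z : ℤˣ) (α β : Q.K c), α * ((x : ℤ) : Q.K c) =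
      ((y : ℤ) : Q.K c) * (((z : ℤ) : Q.K c) * β) ↔
        β = (((y * x * z : ℤˣ) : ℤ) : Q.K c) * α := by
    intro x y z α β
    have hsq : ∀ x : ℤˣ, ((x : ℤ) : Q.K c) * ((x : ℤ) : Q.K c) = 1 := fun x => by
      rw [← Int.cast_mul, ← Units.val_mul, Int.units_mul_self]; simp
    have hx := hsq x
    have hy := hsq y
    have hz := hsq z
    push_cast
    generalize ((x : ℤ) : Q.K c) = x at *
    generalize ((y : ℤ) : Q.K c) = y at *
    generalize ((z : ℤ) : Q.K c) = z at *
    constructor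
    · intro h
      linear_combination (-(β * z * z)) * hy - β * hz - y * z * h
    · rintro rfl
      linear_combination (-(α * x * z * z)) * hy - α * x * hz
  constructor
  · intro h p q
    have h1 := congrFun (congrFun h q) (dual hc p)
    rw [transpose_mul_gram, Matrix.smul_apply, gram_mul hc, smul_eq_mul] at h1
    exact (key _ _ _ _ _).1 h1
  · intro h
    ext q r
    obtain ⟨p, rfl⟩ : ∃ p, r = dual hc p := ⟨dual hc r, (dual_dual hc r).symm⟩
    rw [transpose_mul_gram, Matrix.smul_apply, gram_mul hc, smul_eq_mul]
    exact (key _ _ _ _ _).2 (h p q)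

end

end DualQuiver

end

noncomputable section

namespace DualQuiver

variable {Q₀ Q₁ : Type*} {Q : DualQuiver Q₀ Q₁} {c : Q₀ → ℕ} {a b : Q₀ → ℕ}
  [Fintype Q₀]

/-! ### Weights of the normal spaces -/

/-- One half of the entries below the block diagonal of a self-adjoint block matrix, for the form of
sign `e` (in rows indexed by `l`, columns indexed by `k`, dual to each other if `k + l + 1 = n`). -/
def Half (a b : Q₀ → ℕ) (n : ℕ) (e : ℤˣ) (i j : Q₀) (k l : ℕ) : Prop :=
  blk a b i k = 0 ∧ (blk a b j l = 1 ∨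
    blk a b j l = 2 ∧ (k + l + 1 < n ∨ k + l + 1 = n ∧ e = 1))

/-- Reflection exchanges the blocks 0–1 and 1–2, and folds the block 0–2 along its antidiagonal.
`Half` keeps the block 0–1 and one side of the fold, with the antidiagonal only for `e = 1`; for `e
= -1` the antidiagonal is left over. -/
theorem half_cases (hb : Q.IsSelfDual b) (e : ℤˣ) {p q : Bas (Q.total a b)} (hpq : p.1 = Q.θ q.1)
    (h : blk a b q.1 q.2 < blk a b p.1 p.2) :
    Half a b (Q.total a b q.1) e q.1 p.1 q.2 p.2 ∨
    Half a b (Q.total a b p.1) e (dual (Q.total_θ hb) p).1 (dual (Q.total_θ hb) q).1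
      (dual (Q.total_θ hb) p).2 (dual (Q.total_θ hb) q).2 ∨
    (p = dual (Q.total_θ hb) q ∧ (e = -1)) := by
  have h1 := blk_dual hb p
  have h2 := blk_dual hb q
  have h3 := blk_le (a := a) (b := b) p.1 p.2
  have h4 := blk_le (a := a) (b := b) q.1 q.2
  have h5 : Q.total a b p.1 = Q.total a b q.1 := by rw [hpq, Q.total_θ hb]
  have h6 : (dual (Q.total_θ hb) p).2.val = Q.total a b p.1 - 1 - p.2 := rfl
  have h7 : (dual (Q.total_θ hb) q).2.val = Q.total a b q.1 - 1 - q.2 := rfl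
  have h8 := p.2.isLt
  have h9 := q.2.isLt
  rw [Half, Half, h1, h2, h6, h7]
  by_cases h10 : q.2.val + p.2.val + 1 = Q.total a b q.1 ∧ e = -1
  · exact Or.inr (Or.inr ⟨bas_ext hpq (by omega), h10.2⟩)
  · rcases Int.units_eq_one_or e with rfl | rfl
    · simp only [and_true]
      omega
    · simp only [and_true] at h10
      omega

/-- The chosen half meets its reflection only in the antidiagonal, so no weight is counted twice. -/
theorem half_both (hb : Q.IsSelfDual b) {e : ℤˣ} {p q : Bas (Q.total a b)} (hpq : p.1 = Q.θ q.1)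
    (h : Half a b (Q.total a b q.1) e q.1 p.1 q.2 p.2)
    (h' : Half a b (Q.total a b p.1) e (dual (Q.total_θ hb) p).1 (dual (Q.total_θ hb) q).1
      (dual (Q.total_θ hb) p).2 (dual (Q.total_θ hb) q).2) :
    p = dual (Q.total_θ hb) q ∧ e = 1 := by
  have h1 := blk_dual hb p
  have h2 := blk_dual hb q
  have h5 : Q.total a b p.1 = Q.total a b q.1 := by rw [hpq, Q.total_θ hb]
  have h6 : (dual (Q.total_θ hb) p).2.val = Q.total a b p.1 - 1 - p.2 := rfl
  have h7 : (dual (Q.total_θ hb) q).2.val = Q.total a b q.1 - 1 - q.2 := rfl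
  have h8 := p.2.isLt
  have h9 := q.2.isLt
  rw [Half] at h
  rw [Half, h1, h2, h6, h7] at h'
  obtain ⟨h10, h11⟩ := h
  obtain ⟨h12, h13⟩ := h'
  rcases Int.units_eq_one_or e with rfl | rfl
  · exact ⟨bas_ext hpq (by simp only [and_true] at h11 h13; omega), rfl⟩
  · simp only [show (-1 : ℤˣ) ≠ 1 by decide, and_false, or_false] at h11 h13
    omega

theorem half_lt {n : ℕ} {e : ℤˣ} {i j : Q₀} {k l : ℕ} (h : Half a b n e i j k l) :
    blk a b i k < blk a b j l := by
  rcases h with ⟨h1, h2 | h2⟩ <;> omega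

/-- The entries of a matrix in the basis moved by an element of the Weyl group. -/
def entries (hc : ∀ i, c (Q.θ i) = c i) (w : Q.weyl c) :
    Matrix (Bas c) (Bas c) (Q.K c) →ₗ[Q.K c] Bas c × Bas c → Q.K c where
  toFun A t := A (basHom hc w t.1) (basHom hc w t.2)
  map_add' _ _ := rfl
  map_smul' _ _ := rfl

theorem entries_apply (hc : ∀ i, c (Q.θ i) = c i) (w : Q.weyl c)
    (A : Matrix (Bas c) (Bas c) (Q.K c)) (t : Bas c × Bas c) :
    entries hc w A t = A (basHom hc w t.1) (basHom hc w t.2) := rfl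

theorem entries_surjective (hc : ∀ i, c (Q.θ i) = c i) (w : Q.weyl c) :
    Function.Surjective (entries hc w) := fun y =>
  ⟨Matrix.of fun P R => y ((basHom hc w).symm P, (basHom hc w).symm R), by
    ext ⟨p, q⟩
    rw [entries_apply]
    simp⟩

theorem entries_adT (hc : ∀ i, c (Q.θ i) = c i) (w : Q.weyl c)
    (A : Matrix (Bas c) (Bas c) (Q.K c)) (t : Bas c × Bas c) :
    entries hc w (Q.adT c A) t = (w • algebraMap (Q.Poly c) (Q.K c)
      (Q.wt c t.1.1 t.1.2 - Q.wt c t.2.1 t.2.2)) * entries hc w A t := by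
  rw [entries_apply, adT_entry, smul_algebraMap_poly, map_sub, map_sub, actPoly_wt hc, actPoly_wt hc,
    entries_apply]

theorem mem_flagEnd_iff (hb : Q.IsSelfDual b) (w : Q.weyl (Q.total a b))
    (A : Matrix (Bas (Q.total a b)) (Bas (Q.total a b)) (Q.K (Q.total a b))) :
    A ∈ Q.flagEnd (flag hb w) ↔ ∀ t : Bas (Q.total a b) × Bas (Q.total a b),
      blk a b t.2.1 t.2.2 < blk a b t.1.1 t.1.2 → entries (Q.total_θ hb) w A t = 0 := by
  constructor
  · intro h t ht
    exact h (basHom (Q.total_θ hb) w t.1) (basHom (Q.total_θ hb) w t.2)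
      (by rwa [step_flag, step_flag])
  · intro h P R hPR
    obtain ⟨p, rfl⟩ := (basHom (Q.total_θ hb) w).surjective P
    obtain ⟨q, rfl⟩ := (basHom (Q.total_θ hb) w).surjective R
    rw [step_flag, step_flag] at hPR
    exact h (p, q) hPR

theorem adjoint_iff_entries (hc : ∀ i, c (Q.θ i) = c i) (w : Q.weyl c)
    (A B : Matrix (Bas c) (Bas c) (Q.K c)) (u : ℤˣ) :
    A.transpose * Q.gram c = ((u : ℤ) : Q.K c) • (Q.gram c * B) ↔
      ∀ p q, entries hc w B (dual hc q, dual hc p) =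
        (((u * formSign Q (basHom hc w p) * formSign Q (basHom hc w q) : ℤˣ) : ℤ) : Q.K c) *
          entries hc w A (p, q) := by
  rw [adjoint_iff hc]
  simp only [entries_apply, basHom_dual]
  constructor
  · exact fun h p q => h _ _
  · intro h P R
    obtain ⟨p, rfl⟩ := (basHom hc w).surjective P
    obtain ⟨q, rfl⟩ := (basHom hc w).surjective R
    exact h p q

theorem even_total (hb : Q.IsSelfDual b) (i : Q₀) (h : Q.θ i = i) (h' : Q.σ i = -1) :
    Even (Q.total a b i) := by
  rw [total, h]
  exact Even.add ⟨a i, rfl⟩ (hb.2 i h h')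

/-! ### The adjoint representation -/

variable (Q a b) in
open Classical in
/-- Representatives of the entries in the normal space of the parabolic subalgebra. -/
def lieIdx : Finset (Bas (Q.total a b) × Bas (Q.total a b)) :=
  Finset.univ.filter fun t => t.1.1 = t.2.1 ∧ blk a b t.2.1 t.2.2 < blk a b t.1.1 t.1.2 ∧
    (Q.pos t.1.1 ∨ Q.θ t.1.1 = t.1.1 ∧
      Half a b (Q.total a b t.2.1) (-Q.σ t.2.1) t.2.1 t.1.1 t.2.2 t.1.2)

/-- At a vertex in `Q₀⁺` all entries below the block diagonal are free, and they determine those at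
the dual vertex. At a fixed vertex the matrix is skew-adjoint, so the antidiagonal carries the sign
`-σ` and is present exactly in the symplectic case. -/
theorem eulerQuot_lie (hb : Q.IsSelfDual b) (w : Q.weyl (Q.total a b)) :
    eulerQuot (Q.adT (Q.total a b)) (Q.lieAlg _) (Q.lieStab (flag hb w))
      (Q.adT_lieAlg _ (Q.total_θ hb)) (Q.adT_lieStab (Q.total_θ hb) _) =
    ∏ t ∈ lieIdx Q a b, w • algebraMap (Q.Poly (Q.total a b)) (Q.K (Q.total a b))
      (Q.wt _ t.1.1 t.1.2 - Q.wt _ t.2.1 t.2.2) := by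
  classical
  have hc := Q.total_θ (a := a) hb
  have hdual : ∀ p : Bas (Q.total a b), (dual hc p).1 = Q.θ p.1 := fun _ => rfl
  refine eulerQuot_eq_prod (entries hc w) (entries_surjective hc w)
    (τ := fun t => (dual hc t.2, dual hc t.1))
    (ε := fun t => -1 * formSign Q (basHom hc w t.1) * formSign Q (basHom hc w t.2))
    (S := fun t => t.1.1 = t.2.1) (D := fun t => blk a b t.2.1 t.2.2 < blk a b t.1.1 t.1.2)
    ?_ ?_ ?_ ?_ ?_ (entries_adT hc w) (lieIdx Q a b) ?_ ?_ ?_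
  · simp
  · intro t ht
    simp only [hdual, ht]
  · intro t ht
    simp only [basHom_dual]
    have h1 := formSign_mul_dual hc (even_total hb) (basHom hc w t.1)
    have h2 := formSign_mul_dual hc (even_total hb) (basHom hc w t.2)
    rw [basHom_vertex] at h1 h2
    rw [← ht] at h2
    calc _ = (formSign Q (basHom hc w t.1) * formSign Q (dual hc (basHom hc w t.1))) *
        (formSign Q (basHom hc w t.2) * formSign Q (dual hc (basHom hc w t.2))) := by
          rw [show (-1 : ℤˣ) = -1 from rfl]
          simp only [neg_mul, one_mul, mul_neg, neg_neg]
          ac_rfl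
      _ = 1 := by rw [h1, h2, Int.units_mul_self]
  · intro A
    have hadj : A.transpose * Q.gram _ + Q.gram _ * A = 0 ↔
        A.transpose * Q.gram _ = (((-1 : ℤˣ) : ℤ) : Q.K (Q.total a b)) • (Q.gram _ * A) := by
      simp [eq_neg_iff_add_eq_zero]
    change ((∀ p q, p.1 = q.1 ∨ A p q = 0) ∧ A.transpose * Q.gram _ + Q.gram _ * A = 0) ↔ _
    rw [hadj, adjoint_iff_entries hc w]
    constructor
    · rintro ⟨h1, h2⟩
      refine ⟨fun t => ?_, fun t _ => h2 t.1 t.2⟩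
      have := h1 (basHom hc w t.1) (basHom hc w t.2)
      rwa [basHom_vertex, basHom_vertex] at this
    · rintro ⟨h1, h2⟩
      refine ⟨fun P R => ?_, fun p q => ?_⟩
      · obtain ⟨p, rfl⟩ := (basHom hc w).surjective P
        obtain ⟨q, rfl⟩ := (basHom hc w).surjective R
        rw [basHom_vertex, basHom_vertex]
        exact h1 (p, q)
      · by_cases hpq : p.1 = q.1
        · exact h2 (p, q) hpq
        · rw [(h1 (p, q)).resolve_left hpq, mul_zero]
          refine (h1 (dual hc q, dual hc p)).resolve_left fun h => hpq ?_
          have := congrArg Q.θ h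
          simp only [hdual, Q.θ_θ] at this
          exact this.symm
  · intro A hA
    change (A ∈ Q.lieAlg _ ∧ A ∈ Q.flagEnd _) ↔ _
    rw [mem_flagEnd_iff]
    exact ⟨fun h => h.2, fun h => ⟨hA, h⟩⟩
  · intro t ht
    simp only [lieIdx, Finset.mem_filter] at ht
    exact ⟨ht.2.1, ht.2.2.1⟩
  · rintro ⟨p, q⟩ hS hD
    simp only at hS hD
    simp only [lieIdx, Finset.mem_filter, Finset.mem_univ, true_and, hdual]
    have hD' : blk a b (dual hc p).1 (dual hc p).2 < blk a b (dual hc q).1 (dual hc q).2 := by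
      have h4 := blk_le (a := a) (b := b) p.1 p.2
      rw [blk_dual hb, blk_dual hb]
      omega
    by_cases h1 : Q.pos p.1
    · exact Or.inl ⟨hS, hD, Or.inl h1⟩
    by_cases h2 : Q.θ p.1 = p.1
    · rcases half_cases hb (-Q.σ q.1) (p := p) (q := q) (by rw [← hS, h2]) hD with h | h | h
      · exact Or.inl ⟨hS, hD, Or.inr ⟨h2, h⟩⟩
      · refine Or.inr (Or.inl ⟨by rw [hS], hD', Or.inr ⟨by rw [← hS, h2, h2], ?_⟩⟩)
        rw [Q.total_θ hb, Q.σ_θ, hS]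
        rw [hS] at h
        convert h using 1
        · exact (congrArg Q.θ hS).symm
        · rfl
      -- The antidiagonal at an orthogonal vertex: skew-adjointness forces these entries to vanish.
      · refine Or.inr (Or.inr ⟨Prod.ext h.1.symm ?_, ?_⟩)
        · simp only
          rw [h.1, dual_dual]
        · have h3 := formSign_mul_dual hc (even_total hb) (basHom hc w q)
          have h4 : Q.σ q.1 = 1 := neg_injective h.2
          rw [basHom_vertex, ← basHom_dual, ← h.1, h4] at h3
          rw [mul_assoc, mul_comm (formSign Q _), h3, mul_one]
    · exact Or.inr (Or.inl ⟨by rw [hS], hD', Or.inl (by rw [← hS]; exact pos_of_neg h1 h2)⟩)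
  · rintro ⟨p, q⟩ h h'
    simp only [lieIdx, Finset.mem_filter, Finset.mem_univ, true_and, hdual] at h h'
    obtain ⟨hS, hD, h1⟩ := h
    obtain ⟨hS', hD', h2⟩ := h'
    rw [← hS] at h2
    rcases h1 with h1 | ⟨h1, h3⟩
    · exfalso
      have hne := Q.pos_ne _ h1
      rcases h2 with h2 | ⟨h2, -⟩
      · exact (Q.pos_iff _ hne).1 h1 h2
      · rw [Q.θ_θ] at h2
        exact hne h2.symm
    · have h4 := h2.resolve_left fun h => by
        rw [h1] at h
        exact Q.pos_ne _ h h1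
      have h5 := half_both hb (by rw [← hS, h1]) h3 (by
        have := h4.2
        rw [Q.total_θ hb, Q.σ_θ, hS] at this
        rw [hS]
        convert this using 1
        · exact congrArg Q.θ hS
        · rfl)
      refine ⟨Prod.ext h5.1.symm ?_, ?_⟩
      · simp only
        rw [h5.1, dual_dual]
      · have h6 := formSign_mul_dual hc (even_total hb) (basHom hc w q)
        have h7 : Q.σ q.1 = -1 := by rw [← h5.2, neg_neg]
        rw [basHom_vertex, ← basHom_dual, ← h5.1, h7] at h6
        simp only
        rw [mul_assoc, mul_comm (formSign Q _), h6, neg_mul_neg, one_mul]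

end DualQuiver

end

noncomputable section

namespace DualQuiver

variable {Q₀ Q₁ : Type*} {Q : DualQuiver Q₀ Q₁} {c : Q₀ → ℕ} {a b : Q₀ → ℕ}
  [Fintype Q₀]

/-! ### The space of self-dual representations -/

/-- The entries of a representation in the basis moved by an element of the Weyl group. -/
def repEntries (hc : ∀ i, c (Q.θ i) = c i) (w : Q.weyl c) :
    (Q₁ → Matrix (Bas c) (Bas c) (Q.K c)) →ₗ[Q.K c] Q₁ × Bas c × Bas c → Q.K c where
  toFun ρ t := entries hc w (ρ t.1) t.2
  map_add' _ _ := rfl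
  map_smul' _ _ := rfl

theorem repEntries_surjective (hc : ∀ i, c (Q.θ i) = c i) (w : Q.weyl c) :
    Function.Surjective (repEntries hc w) := fun y => by
  choose ρ hρ using fun x => entries_surjective hc w fun t => y (x, t)
  exact ⟨ρ, funext fun t => congrFun (hρ t.1) t.2⟩

variable (Q a b) in
open Classical in
/-- Representatives of the entries in the normal space of the stable representations. -/
def repIdx [Fintype Q₁] : Finset (Q₁ × Bas (Q.total a b) × Bas (Q.total a b)) :=
  Finset.univ.filter fun t => (t.2.1.1 = Q.t t.1 ∧ t.2.2.1 = Q.s t.1) ∧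
    blk a b t.2.2.1 t.2.2.2 < blk a b t.2.1.1 t.2.1.2 ∧
    (Q.apos t.1 ∨ Q.θ₁ t.1 = t.1 ∧ Half a b (Q.total a b t.2.2.1) (Q.σ (Q.s t.1) * Q.ς t.1)
      t.2.2.1 t.2.1.1 t.2.2.2 t.2.1.2)

/-- The symmetry now also exchanges an arrow with its dual, so the arrows in `Q₁⁺` contribute all
their entries below the block diagonal. For a self-dual arrow the antidiagonal carries the product
of `σ` at the source and `ς`, whose value decides between `≤` and `<` in `classEAt`. -/
theorem eulerQuot_rep [Fintype Q₁] (hb : Q.IsSelfDual b) (w : Q.weyl (Q.total a b)) :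
    eulerQuot (Q.repT (Q.total a b)) (Q.repSpace _) (Q.repStab (flag hb w))
      (Q.repT_repSpace _ (Q.total_θ hb)) (Q.repT_repStab (Q.total_θ hb) _) =
    ∏ t ∈ repIdx Q a b, w • algebraMap (Q.Poly (Q.total a b)) (Q.K (Q.total a b))
      (Q.wt _ t.2.1.1 t.2.1.2 - Q.wt _ t.2.2.1 t.2.2.2) := by
  classical
  have hc := Q.total_θ (a := a) hb
  have hdual : ∀ p : Bas (Q.total a b), (dual hc p).1 = Q.θ p.1 := fun _ => rfl
  have hfs : ∀ q : Bas (Q.total a b), formSign Q (basHom hc w (dual hc q)) *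
      formSign Q (basHom hc w q) = Q.σ q.1 := fun q => by
    rw [basHom_dual, mul_comm, formSign_mul_dual hc (even_total hb), basHom_vertex]
  refine eulerQuot_eq_prod (repEntries hc w) (repEntries_surjective hc w)
    (τ := fun t => (Q.θ₁ t.1, dual hc t.2.2, dual hc t.2.1))
    (ε := fun t => Q.ς t.1 * formSign Q (basHom hc w t.2.1) * formSign Q (basHom hc w t.2.2))
    (S := fun t => t.2.1.1 = Q.t t.1 ∧ t.2.2.1 = Q.s t.1)
    (D := fun t => blk a b t.2.2.1 t.2.2.2 < blk a b t.2.1.1 t.2.1.2)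
    ?_ ?_ ?_ ?_ ?_ (fun ρ t => entries_adT hc w (ρ t.1) t.2) (repIdx Q a b) ?_ ?_ ?_
  · simp [Q.θ₁_θ₁]
  · rintro t ⟨h1, h2⟩
    simp only [hdual, h1, h2, Q.t_θ₁, Q.s_θ₁, and_self]
  · rintro t ⟨h1, h2⟩
    simp only
    calc _ = (Q.ς t.1 * Q.ς (Q.θ₁ t.1)) *
        ((formSign Q (basHom hc w (dual hc t.2.1)) * formSign Q (basHom hc w t.2.1)) *
        (formSign Q (basHom hc w (dual hc t.2.2)) * formSign Q (basHom hc w t.2.2))) := by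
          ac_rfl
      _ = 1 := by
        rw [hfs, hfs, Q.ς_θ₁, h1, h2, mul_comm (Q.σ (Q.t t.1)), Int.units_mul_self]
  · intro ρ
    change ((∀ x p q, (p.1 = Q.t x ∧ q.1 = Q.s x) ∨ ρ x p q = 0) ∧
      ∀ x, (ρ x).transpose * Q.gram _ =
        ((Q.ς x : ℤ) : Q.K _) • (Q.gram _ * ρ (Q.θ₁ x))) ↔ _
    simp only [adjoint_iff_entries hc w]
    constructor
    · rintro ⟨h1, h2⟩
      refine ⟨fun t => ?_, fun t _ => h2 t.1 t.2.1 t.2.2⟩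
      have := h1 t.1 (basHom hc w t.2.1) (basHom hc w t.2.2)
      rwa [basHom_vertex, basHom_vertex] at this
    · rintro ⟨h1, h2⟩
      refine ⟨fun x P R => ?_, fun x p q => ?_⟩
      · obtain ⟨p, rfl⟩ := (basHom hc w).surjective P
        obtain ⟨q, rfl⟩ := (basHom hc w).surjective R
        rw [basHom_vertex, basHom_vertex]
        exact h1 (x, p, q)
      · by_cases hpq : p.1 = Q.t x ∧ q.1 = Q.s x
        · exact h2 (x, p, q) hpq
        · have h3 : entries hc w (ρ x) (p, q) = 0 := (h1 (x, p, q)).resolve_left hpq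
          rw [h3, mul_zero]
          refine (h1 (Q.θ₁ x, dual hc q, dual hc p)).resolve_left fun h => hpq ?_
          simp only [hdual, Q.t_θ₁, Q.s_θ₁] at h
          have h4 := congrArg Q.θ h.1
          have h5 := congrArg Q.θ h.2
          rw [Q.θ_θ, Q.θ_θ] at h4 h5
          exact ⟨h5, h4⟩
  · intro ρ hρ
    change (ρ ∈ Q.repSpace _ ∧ ρ ∈ Submodule.pi Set.univ fun _ => Q.flagEnd _) ↔ _
    rw [Submodule.mem_pi]
    simp only [mem_flagEnd_iff]
    exact ⟨fun h t ht => h.2 t.1 trivial t.2 ht, fun h => ⟨hρ, fun x _ t ht => h (x, t) ht⟩⟩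
  · intro t ht
    simp only [repIdx, Finset.mem_filter] at ht
    exact ⟨ht.2.1, ht.2.2.1⟩
  · rintro ⟨x, p, q⟩ hS hD
    simp only at hS hD
    obtain ⟨hp, hq⟩ := hS
    simp only [repIdx, Finset.mem_filter, Finset.mem_univ, true_and, hdual]
    have hS' : Q.θ q.1 = Q.t (Q.θ₁ x) ∧ Q.θ p.1 = Q.s (Q.θ₁ x) := by
      rw [Q.t_θ₁, Q.s_θ₁, hp, hq]
      exact ⟨rfl, rfl⟩
    have hD' : blk a b (dual hc p).1 (dual hc p).2 < blk a b (dual hc q).1 (dual hc q).2 := by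
      have h4 := blk_le (a := a) (b := b) p.1 p.2
      rw [blk_dual hb, blk_dual hb]
      omega
    by_cases h1 : Q.apos x
    · exact Or.inl ⟨⟨hp, hq⟩, hD, Or.inl h1⟩
    by_cases h2 : Q.θ₁ x = x
    · have hpq : p.1 = Q.θ q.1 := by rw [hp, hq, ← Q.t_θ₁, h2]
      rcases half_cases hb (Q.σ (Q.s x) * Q.ς x) hpq hD with h | h | h
      · exact Or.inl ⟨⟨hp, hq⟩, hD, Or.inr ⟨h2, h⟩⟩
      · refine Or.inr (Or.inl ⟨hS', hD', Or.inr ⟨by rw [h2, h2], ?_⟩⟩)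
        rw [Q.total_θ hb, h2]
        exact h
      · refine Or.inr (Or.inr ⟨?_, ?_⟩)
        · rw [h.1, dual_dual, h2]
        · rw [h.1, mul_assoc, hfs, hq, mul_comm]
          exact h.2
    · refine Or.inr (Or.inl ⟨hS', hD', Or.inl ?_⟩)
      by_contra h3
      exact h1 ((Q.apos_iff x h2).2 h3)
  · rintro ⟨x, p, q⟩ h h'
    simp only [repIdx, Finset.mem_filter, Finset.mem_univ, true_and, hdual] at h h'
    obtain ⟨⟨hp, hq⟩, hD, h1⟩ := h
    obtain ⟨-, -, h2⟩ := h'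
    rcases h1 with h1 | ⟨h1, h3⟩
    · exfalso
      have hne := Q.apos_ne _ h1
      rcases h2 with h2 | ⟨h2, -⟩
      · exact (Q.apos_iff _ hne).1 h1 h2
      · rw [Q.θ₁_θ₁] at h2
        exact hne h2.symm
    · have hpq : p.1 = Q.θ q.1 := by rw [hp, hq, ← Q.t_θ₁, h1]
      have h4 := h2.resolve_left fun h => by
        rw [h1] at h
        exact Q.apos_ne _ h h1
      have h5 := half_both hb hpq h3 (by
        have := h4.2
        rw [Q.total_θ hb, h1] at this
        exact this)
      refine ⟨?_, ?_⟩
      · rw [h5.1, dual_dual, h1]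
      · rw [h5.1, mul_assoc, hfs, hq, mul_comm]
        exact h5.2

end DualQuiver

end

noncomputable section

namespace DualQuiver

variable {Q₀ Q₁ : Type*} {Q : DualQuiver Q₀ Q₁} {c : Q₀ → ℕ} {a b : Q₀ → ℕ}
  [Fintype Q₀]

/-! ### The Euler classes at the standard fixed point -/

open Classical in
theorem prod_vertex {M : Type*} [CommMonoid M] (i : Q₀) (f : ℕ → M) :
    ∏ p : Bas c, (if p.1 = i then f p.2 else 1) = ∏ k ∈ Finset.range (c i), f k := by
  rw [Fintype.prod_sigma, Finset.prod_eq_single i, Finset.prod_range]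
  · simp
  · intro j _ hj
    simp [hj]
  · simp

open Classical in
theorem prod_vertex₂ {M : Type*} [CommMonoid M] (i j : Q₀) (F : ℕ → ℕ → M)
    {H : Bas c → Bas c → M} (h : ∀ p q, p.1 = j → q.1 = i → H p q = F q.2 p.2)
    (h' : ∀ p q, ¬ (p.1 = j ∧ q.1 = i) → H p q = 1) :
    ∏ p, ∏ q, H p q = ∏ k ∈ Finset.range (c i), ∏ l ∈ Finset.range (c j), F k l := by
  rw [← prod_vertex i fun k => ∏ l ∈ Finset.range (c j), F k l, Finset.prod_comm]
  refine Finset.prod_congr rfl fun q _ => ?_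
  by_cases hq : q.1 = i
  · rw [if_pos hq, ← prod_vertex j]
    refine Finset.prod_congr rfl fun p _ => ?_
    by_cases hp : p.1 = j
    · rw [if_pos hp, h p q hp hq]
    · rw [if_neg hp, h' p q fun h => hp h.1]
  · rw [if_neg hq]
    exact Finset.prod_eq_one fun p _ => h' p q fun h => hq h.2

-- Splits the half into its two blocks; in the block 0–2 the rows are renumbered from the end, so
-- that they are indexed by the dual vectors in block `0`.
open Classical in
theorem prod_half {M : Type*} [CommMonoid M] (hb : Q.IsSelfDual b) {i j : Q₀} (hj : j = Q.θ i)
    (e : ℤˣ) (F : ℕ → ℕ → M) :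
    (∏ k ∈ Finset.range (Q.total a b i), ∏ l ∈ Finset.range (Q.total a b j),
      if Half a b (Q.total a b i) e i j k l then F k l else 1) =
    (∏ k ∈ Finset.range (a i), ∏ l ∈ Finset.Ico (if e = 1 then k else k + 1) (a i),
      F k (Q.total a b i - 1 - l)) *
    ∏ k ∈ Finset.range (a i), ∏ l ∈ Finset.Ico (a j) (a j + b j), F k l := by
  have hn : Q.total a b i = a i + a j + b j := by rw [total, hj, hb.1]
  have hn' : Q.total a b j = Q.total a b i := by rw [hj, Q.total_θ hb]
  rw [hn', ← Finset.prod_mul_distrib]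
  symm
  refine Finset.prod_subset_one_on_sdiff (Finset.range_subset_range.2 (by omega)) ?_ ?_
  · intro k hk
    simp only [Finset.mem_sdiff, Finset.mem_range, not_lt] at hk
    refine Finset.prod_eq_one fun l _ => if_neg fun h => ?_
    have := h.1
    rw [blk, if_neg (by omega)] at this
    split_ifs at this
  · intro k hk
    rw [Finset.mem_range] at hk
    have hblk : blk a b i k = 0 := by rw [blk, if_pos hk]
    have hsplit : ∀ l, (if Half a b (Q.total a b i) e i j k l then F k l else 1) =
        (if a j + b j ≤ l ∧ (k + l + 1 < Q.total a b i ∨ k + l + 1 = Q.total a b i ∧ e = 1)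
          then F k l else 1) *
        if a j ≤ l ∧ l < a j + b j then F k l else 1 := by
      intro l
      simp only [Half, hblk, true_and]
      simp only [blk]
      by_cases h1 : l < a j
      · simp [h1, not_le.2 h1, show ¬ a j + b j ≤ l by omega]
      · by_cases h2 : l < a j + b j
        · simp [h1, h2, not_lt.1 h1, show ¬ a j + b j ≤ l by omega]
        · simp [h1, h2, show a j + b j ≤ l by omega]
    rw [Finset.prod_congr rfl fun l _ => hsplit l, Finset.prod_mul_distrib]
    congr 1
    -- With `l` replaced by `n - 1 - l`, being strictly before the antidiagonal means `k < l`, and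
    -- lying on it means `k = l`.
    · rw [← Finset.prod_range_reflect, ← Finset.prod_filter]
      refine (Finset.prod_congr ?_ fun _ _ => rfl)
      ext l
      simp only [Finset.mem_filter, Finset.mem_range, Finset.mem_Ico]
      split_ifs with he
      · simp only [he, and_true]
        omega
      · simp only [he, and_false, or_false]
        omega
    · rw [← Finset.prod_filter]
      refine (Finset.prod_congr ?_ fun _ _ => rfl)
      ext l
      simp only [Finset.mem_filter, Finset.mem_range, Finset.mem_Ico]
      omega

theorem wt_reflect (hc : ∀ i, c (Q.θ i) = c i) (i : Q₀) {k : ℕ} (hk : k < c i) :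
    Q.wt c (Q.θ i) (c i - 1 - k) = -Q.wt c i k :=
  eq_neg_of_add_eq_zero_right (Q.wt_add_wt c hc ⟨i, k, hk⟩
    ⟨Q.θ i, c i - 1 - k, by rw [hc]; omega⟩ ⟨rfl, by simp only; omega⟩)

/-- For a self-dual arrow the weight of a row in block `2` is minus the weight of its dual vector in
block `0`. This turns differences of weights into the factors `-y_k - y_l`. -/
theorem prod_repIdx [Fintype Q₁] (hb : Q.IsSelfDual b) :
    ∏ t ∈ repIdx Q a b, (Q.wt (Q.total a b) t.2.1.1 t.2.1.2 - Q.wt _ t.2.2.1 t.2.2.2) =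
      Q.classE a b := by
  classical
  rw [repIdx, Finset.prod_filter, Fintype.prod_prod_type, classE]
  refine Finset.prod_congr rfl fun x _ => ?_
  rw [Fintype.prod_prod_type]
  rw [prod_vertex₂ (Q.s x) (Q.t x) fun k l => if blk a b (Q.s x) k < blk a b (Q.t x) l ∧
    (Q.apos x ∨ Q.θ₁ x = x ∧ Half a b (Q.total a b (Q.s x)) (Q.σ (Q.s x) * Q.ς x)
      (Q.s x) (Q.t x) k l) then Q.wt (Q.total a b) (Q.t x) l - Q.wt _ (Q.s x) k else 1]
  rotate_left
  · intro p q hp hq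
    simp only [hp, hq, true_and]
  · intro p q h
    exact if_neg fun h' => h h'.1
  simp only [classEAt]
  by_cases h1 : Q.apos x
  · simp only [h1, true_or, and_true, if_true]
    exact prod_blk (Q.s x) (Q.t x) (by rw [total]; omega) (by rw [total]; omega)
      fun k l => Q.wt (Q.total a b) (Q.t x) l - Q.wt _ (Q.s x) k
  by_cases h2 : Q.θ₁ x = x
  · have ht : Q.t x = Q.θ (Q.s x) := by rw [← Q.t_θ₁, h2]
    simp only [h1, h2, false_or, true_and, if_true, if_false, and_iff_right_of_imp half_lt]
    rw [prod_half hb ht]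
    congr 1
    refine Finset.prod_congr rfl fun k _ => Finset.prod_congr rfl fun l hl => ?_
    have := (Finset.mem_Ico.1 hl).2
    rw [ht, wt_reflect (Q.total_θ hb) _ (by rw [total]; omega)]
    ring
  · simp [h1, h2]

theorem prod_range_fold {M : Type*} [CommMonoid M] (f : ℕ → M) (n : ℕ) :
    ∏ k ∈ Finset.range n, f k =
      (if Odd n then f (n / 2) else 1) * ∏ k ∈ Finset.range (n / 2), f k * f (n - 1 - k) := by
  rw [Finset.prod_mul_distrib]
  rcases Nat.even_or_odd' n with ⟨m, rfl | rfl⟩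
  · rw [if_neg (by simp), one_mul, show 2 * m / 2 = m by omega, two_mul, Finset.prod_range_add]
    congr 1
    rw [← Finset.prod_range_reflect]
    refine Finset.prod_congr rfl fun k hk => ?_
    have := Finset.mem_range.1 hk
    congr 1
    omega
  · rw [if_pos (by simp), show (2 * m + 1) / 2 = m by omega,
      show 2 * m + 1 = m + 1 + m by ring, Finset.prod_range_add, Finset.prod_range_succ,
      mul_comm _ (f m), mul_assoc]
    congr 2
    rw [← Finset.prod_range_reflect]
    refine Finset.prod_congr rfl fun k hk => ?_
    have := Finset.mem_range.1 hk
    congr 1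
    omega

/-- The weights on the middle block come in pairs of opposite sign, with a zero weight in odd
dimension: `(x - z) * (-x - z) = z ^ 2 - x ^ 2`, and the zero weight contributes `-z`. -/
theorem prod_mid (hb : Q.IsSelfDual b) {i : Q₀} (hi : Q.θ i = i) (z : Q.Poly (Q.total a b)) :
    ∏ l ∈ Finset.Ico (a i) (a i + b i), (Q.wt (Q.total a b) i l - z) =
      (if Odd (Q.total a b i) then -z else 1) * ∏ l ∈ Finset.Ico (a i) (Q.total a b i / 2),
        (z ^ 2 - Q.xv (Q.total a b) i l ^ 2) := by
  classical
  have hpos : ¬ Q.pos i := fun hp => Q.pos_ne i hp hi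
  have hn : Q.total a b i = a i + a i + b i := by rw [total, hi]
  have hodd : Odd (Q.total a b i) ↔ Odd (b i) := by
    rw [hn, Nat.odd_add']
    simp
  rw [Finset.prod_Ico_eq_prod_range, Finset.prod_Ico_eq_prod_range, prod_range_fold]
  simp only [hodd, Nat.add_sub_cancel_left]
  have h2 : Q.total a b i / 2 - a i = b i / 2 := by omega
  rw [h2]
  congr 1
  · split_ifs with ho
    · obtain ⟨m, hm⟩ := ho
      rw [wt, if_neg hpos, if_pos hi, if_neg (by omega), if_pos (by omega), zero_sub]
    · rfl
  · refine Finset.prod_congr rfl fun k hk => ?_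
    have := Finset.mem_range.1 hk
    have h3 : a i + (b i - 1 - k) = Q.total a b i - 1 - (a i + k) := by omega
    have h4 := wt_reflect (Q.total_θ (a := a) hb) i (k := a i + k) (by omega)
    rw [hi] at h4
    rw [h3, h4, wt, if_neg hpos, if_pos hi, if_pos (by omega)]
    ring

/-- At a fixed vertex the type-dependent factor of `classSAt` has two origins: the antidiagonal
entries give `-2 x_k` in the symplectic case, and the zero weight of the middle block gives `-x_k`
in the odd orthogonal case. -/
theorem prod_lieIdx (hb : Q.IsSelfDual b) :
    ∏ t ∈ lieIdx Q a b, (Q.wt (Q.total a b) t.1.1 t.1.2 - Q.wt _ t.2.1 t.2.2) =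
      Q.classS a b := by
  classical
  -- Each factor is rewritten as a product over the vertices, of which at most one is nontrivial, so
  -- that the product can be regrouped vertex by vertex.
  let H : Q₀ → Bas (Q.total a b) → Bas (Q.total a b) → Q.Poly (Q.total a b) := fun i p q =>
    if (p.1 = i ∧ q.1 = i) ∧ blk a b i q.2 < blk a b i p.2 ∧
      (Q.pos i ∨ Q.θ i = i ∧ Half a b (Q.total a b i) (-Q.σ i) i i q.2 p.2)
    then Q.wt (Q.total a b) i p.2 - Q.wt _ i q.2 else 1
  have hH : ∀ p q : Bas (Q.total a b), (if p.1 = q.1 ∧ blk a b q.1 q.2 < blk a b p.1 p.2 ∧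
      (Q.pos p.1 ∨ Q.θ p.1 = p.1 ∧ Half a b (Q.total a b q.1) (-Q.σ q.1) q.1 p.1 q.2 p.2)
      then Q.wt (Q.total a b) p.1 p.2 - Q.wt _ q.1 q.2 else 1) = ∏ i, H i p q := by
    intro p q
    rw [Finset.prod_eq_single p.1]
    · by_cases hpq : q.1 = p.1
      · simp only [H, hpq, true_and]
      · simp only [H, hpq, Ne.symm hpq, false_and, and_false, if_false]
    · exact fun i _ hi => if_neg fun h => hi h.1.1.symm
    · simp
  rw [lieIdx, Finset.prod_filter, Fintype.prod_prod_type]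
  simp only [hH]
  rw [Finset.prod_congr rfl fun p _ => Finset.prod_comm, Finset.prod_comm, classS]
  refine Finset.prod_congr rfl fun i _ => ?_
  rw [prod_vertex₂ i i fun k l => if blk a b i k < blk a b i l ∧
    (Q.pos i ∨ Q.θ i = i ∧ Half a b (Q.total a b i) (-Q.σ i) i i k l)
      then Q.wt (Q.total a b) i l - Q.wt _ i k else 1]
  rotate_left
  · intro p q hp hq
    simp only [H, hp, hq, true_and]
  · exact fun p q h => if_neg fun h' => h h'.1
  simp only [classSAt]
  by_cases h1 : Q.pos i
  · simp only [h1, true_or, and_true, if_true, wt]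
    exact prod_blk i i (by rw [total]; omega) (by rw [total]; omega)
      fun k l => Q.xv (Q.total a b) i l - Q.xv _ i k
  by_cases h2 : Q.θ i = i
  · simp only [h1, h2, false_or, true_and, if_true, if_false, and_iff_right_of_imp half_lt]
    rw [prod_half hb h2.symm]
    have hn : Q.total a b i = a i + a i + b i := by rw [total, h2]
    have hx : ∀ k < a i, Q.wt (Q.total a b) i k = Q.xv (Q.total a b) i k := fun k hk => by
      rw [wt, if_neg h1, if_pos h2, if_pos (by omega)]
    have hx' : ∀ k < a i, Q.wt (Q.total a b) i (Q.total a b i - 1 - k) =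
        -Q.xv (Q.total a b) i k := fun k hk => by
      have := wt_reflect (Q.total_θ (a := a) hb) i (k := k) (by omega)
      rwa [h2, hx k hk] at this
    rw [← Finset.prod_mul_distrib]
    have hg : (if Q.σ i = -1 then (-2) ^ a i * ∏ k ∈ Finset.range (a i), Q.xv (Q.total a b) i k
        else if Odd (Q.total a b i) then
          (-1) ^ a i * ∏ k ∈ Finset.range (a i), Q.xv (Q.total a b) i k else 1) =
        ∏ k ∈ Finset.range (a i), if Q.σ i = -1 then -2 * Q.xv (Q.total a b) i k
          else if Odd (Q.total a b i) then -1 * Q.xv (Q.total a b) i k else 1 := by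
      split_ifs
      · rw [Finset.prod_mul_distrib, Finset.prod_const, Finset.card_range]
      · rw [Finset.prod_mul_distrib, Finset.prod_const, Finset.card_range]
      · rw [Finset.prod_const_one]
    rw [hg, ← Finset.prod_mul_distrib, ← Finset.prod_mul_distrib]
    refine Finset.prod_congr rfl fun k hk => ?_
    rw [Finset.mem_range] at hk
    rw [hx k hk, prod_mid hb h2, ← mul_assoc]
    refine congrArg₂ (· * ·) ?_ rfl
    have hoff : ∏ l ∈ Finset.Ico (k + 1) (a i),
        (Q.wt (Q.total a b) i (Q.total a b i - 1 - l) - Q.xv (Q.total a b) i k) =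
        ∏ l ∈ Finset.Ico (k + 1) (a i), (-Q.xv (Q.total a b) i k - Q.xv (Q.total a b) i l) :=
      Finset.prod_congr rfl fun l hl => by
        rw [hx' l (Finset.mem_Ico.1 hl).2]
        ring
    -- The inner product starts at `k + 1` in the orthogonal case. In the symplectic case it starts
    -- at `k`, and its first term is `-2 x_k`.
    rcases Int.units_eq_one_or (Q.σ i) with hσ | hσ
    · simp only [hσ, show ¬ (1 : ℤˣ) = -1 by decide, show ¬ (-1 : ℤˣ) = 1 by decide, if_false]
      rw [hoff, mul_comm, neg_one_mul]
    · have heven := even_total (a := a) hb i h2 hσ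
      simp only [hσ, neg_neg, if_true]
      rw [if_neg (Nat.not_odd_iff_even.2 heven), Finset.prod_eq_prod_Ico_succ_bot hk, hoff,
        hx' k hk]
      ring
  · simp [h1, h2]

end DualQuiver

end

noncomputable section

namespace DualQuiver

variable {Q₀ Q₁ : Type*} {Q : DualQuiver Q₀ Q₁} {a b : Q₀ → ℕ} [Fintype Q₀]

/-! ### The action as a shuffle product -/

theorem eulerQuot_rep_eq_smul [Fintype Q₁] (hb : Q.IsSelfDual b) (w : Q.weyl (Q.total a b)) :
    eulerQuot (Q.repT (Q.total a b)) (Q.repSpace _) (Q.repStab (flag hb w))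
      (Q.repT_repSpace _ (Q.total_θ hb)) (Q.repT_repStab (Q.total_θ hb) _) =
    w • algebraMap (Q.Poly (Q.total a b)) (Q.K (Q.total a b)) (Q.classE a b) := by
  rw [eulerQuot_rep, ← Finset.smul_prod', ← map_prod, prod_repIdx hb]

theorem eulerQuot_lie_eq_smul (hb : Q.IsSelfDual b) (w : Q.weyl (Q.total a b)) :
    eulerQuot (Q.adT (Q.total a b)) (Q.lieAlg _) (Q.lieStab (flag hb w))
      (Q.adT_lieAlg _ (Q.total_θ hb)) (Q.adT_lieStab (Q.total_θ hb) _) =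
    w • algebraMap (Q.Poly (Q.total a b)) (Q.K (Q.total a b)) (Q.classS a b) := by
  rw [eulerQuot_lie, ← Finset.smul_prod', ← map_prod, prod_lieIdx hb]

/-- The Euler class depends only on the flag. A Levi element fixes the standard flag, hence also the
Euler class there, which is `classE`. -/
theorem isLeviInv_classE [Fintype Q₁] (hb : Q.IsSelfDual b) : Q.IsLeviInv a b (Q.classE a b) := by
  intro w hw
  lift w to Q.weyl (Q.total a b) using hw.1
  have h1 : flag hb w = flag hb 1 := (flag_eq_iff hb w 1).2 (by simpa using hw)
  have h2 := eulerQuot_rep_eq_smul (a := a) hb w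
  rw [h1, eulerQuot_rep_eq_smul, one_smul, smul_algebraMap_poly] at h2
  exact (IsFractionRing.injective (Q.Poly (Q.total a b)) (Q.K (Q.total a b)) h2).symm

theorem isLeviInv_incl_mul_classE [Fintype Q₁] (hb : Q.IsSelfDual b)
    {f : MvPolynomial (Σ i : Q₀, Fin (a i)) ℂ} {g : Q.Poly b} (hf : IsSymm a f)
    (hg : Q.IsInv b g) :
    Q.IsLeviInv a b (Q.inclA a b f * Q.inclB a b g * Q.classE a b) := fun w hw => by
  rw [map_mul, map_mul, actPoly_inclA hb hw hf, actPoly_inclB hw hg, isLeviInv_classE hb w hw]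

/-- Each localization term is the standard one moved by a minimal representative, so the fixed-point
sum is the shuffle sum term by term. -/
theorem act_eq_shuffle [Fintype Q₁] (hb : Q.IsSelfDual b)
    {f : MvPolynomial (Σ i : Q₀, Fin (a i)) ℂ} {g : Q.Poly b} (hf : IsSymm a f)
    (hg : Q.IsInv b g) :
    Q.act hb f g =
      Q.shuffle a b (Q.inclA a b f * Q.inclB a b g * Q.classE a b) (Q.classS a b) := by
  rw [act, shuffle_eq, sum_fixedPts hb]
  refine Finset.sum_congr rfl fun w _ => ?_
  rw [restr_flag hb hf hg, eulerQuot_rep_eq_smul, eulerQuot_lie_eq_smul, ← smul_mul', ← map_mul,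
    div_eq_mul_inv, div_eq_mul_inv, smul_mul', smul_inv'']

end DualQuiver

end

/-! ### The theorem -/

theorem mainTheorem12 {Q₀ Q₁ : Type*} [Fintype Q₀] [Fintype Q₁] (Q : DualQuiver Q₀ Q₁)
    (a b : Q₀ → ℕ) (hb : Q.IsSelfDual b) :
    (∃! w, Q.IsLongestRep a b w) ∧
    ∀ w, Q.IsLongestRep a b w →
      (∃ L : List (Q.Gen (Q.total a b)), DualQuiver.IsReducedWord L w) ∧
      ∀ L : List (Q.Gen (Q.total a b)), DualQuiver.IsReducedWord L w →
        (∀ f, Q.IsLeviInv a b f →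
          Q.IsInv (Q.total a b) (DualQuiver.demazure L f) ∧
          Q.shuffle a b f (Q.classS a b) =
            (-1) ^ Q.codimRoots a b *
              algebraMap (Q.Poly (Q.total a b)) (Q.K (Q.total a b)) (DualQuiver.demazure L f)) ∧
        ∀ f g, DualQuiver.IsSymm a f → Q.IsInv b g →
          Q.IsInv (Q.total a b)
            (DualQuiver.demazure L (Q.inclA a b f * Q.inclB a b g * Q.classE a b)) ∧
          Q.act hb f g =
            (-1) ^ Q.codimRoots a b *
              algebraMap (Q.Poly (Q.total a b)) (Q.K (Q.total a b))
                (DualQuiver.demazure L (Q.inclA a b f * Q.inclB a b g * Q.classE a b)) := by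
  refine ⟨DualQuiver.existsUnique_longestRep, fun w hw =>
    ⟨DualQuiver.exists_reducedWord hw.1.1, fun L hL =>
      ⟨fun f hf => DualQuiver.demazure_shuffle hw hL hf, fun f g hf hg => ?_⟩⟩⟩
  rw [DualQuiver.act_eq_shuffle hb hf hg]
  exact DualQuiver.demazure_shuffle hw hL (DualQuiver.isLeviInv_incl_mul_classE hb hf hg)
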